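/- Let $m$ be Lebesgue measure on $(0,1)$ and $S(0,1)$ the space of (classes of a.e. equal) real measurable functions on $(0,1)$. For $x\in S(0,1)$ let $\mu(t;x)=\inf\{s\ge 0: m(|x|>s)\le t\}$, $t\in(0,1)$, be its decreasing rearrangement. A symmetric quasi-Banach function space on $(0,1)$ is a linear subspace $E\subset S(0,1)$ with a complete quasi-norm $\|\cdot\|_E$ such that: if $x\in E$, $y\in S(0,1)$ and $|y|\le|x|$, then $y\in E$ and $\|y\|_E\le\|x\|_E$; and if $x\in E$, $y\in S(0,1)$ and $\mu(y)=\mu(x)$, then $y\in E$ and $\|y\|_E=\|x\|_E$. For $E\subset L_1=L_1(0,1)$ put $$\mathcal S_E=\{x\in L_{1,\infty}(0,1):\ \exists\, y\in E,\ \mu(x)\le S\mu(y)\},\qquad \|x\|_{\mathcal S_E}=\inf\{\|y\|_E:\ y\in E,\ \mu(x)\le S\mu(y)\},$$ where $L_{1,\infty}(0,1)=\{x\in S(0,1):\sup_{0<t<1}t\,\mu(t;x)<\infty\}$ and $(Sf)(t)=\frac1t\int_0^t f(s)\,ds+\int_t^1\frac{f(s)}{s}\,ds$ is the Calderón operator.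 Let $\mathbb E_n$ be the conditional expectation onto the $\sigma$-algebra generated by the dyadic subintervals of $(0,1)$ of length $2^{-n}$, $n\ge0$, let $\mathbb E_{-1}=0$, and let $$Tx=\sum_{m\ge0}\left(\mathbb E_{2m}x-\mathbb E_{2m-1}x\right),$$ with convergence in measure. A bounded linear operator $R:E\to X$ into a quasi-Banach space $X$ is called narrow if for every measurable $A\subset(0,1)$ and every $\varepsilon>0$ there is $x\in E$ which takes values in $\{-1,1\}$ on $A$, vanishes off $A$, and satisfies $\|Rx\|_X<\varepsilon$. Theorem. Let $E\ne\{0\}$ be a separable symmetric quasi-Banach function space on $(0,1)$ with $E\subset L_1$. Then $\mathcal S_E$ is a symmetric quasi-Banach function space, the series defining $Tx$ converges in measure for every $x\in E$, and the identity operator on $E$ is the sum of the operators $T$ and $\mathrm{id}-T$, both of which are linear and bounded from $E$ into $\mathcal S_E$ and narrow as operators from $E$ to $\mathcal S_E$. They are the projections associated with the Haar system: for the Haar functions $h_{n,k}=\chi_{((2k-2)2^{-n-1},(2k-1)2^{-n-1})}-\chi_{((2k-1)2^{-n-1},2k\,2^{-n-1})}$, $n\ge0$, $1\le k\le2^n$,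 one has $Th_{n,k}=h_{n,k}$ if $n$ is odd, $Th_{n,k}=0$ if $n$ is even, and $T1=1$. -/

import Mathlib

open MeasureTheory Set Filter Topology

noncomputable section

/-- Lebesgue measure on `(0,1)`. -/
def lebesgue01 : Measure ℝ := volume.restrict (Ioo (0 : ℝ) 1)

/-- `S(0,1)`: classes of almost everywhere equal real measurable functions on `(0,1)`. -/
abbrev S01 : Type := ℝ →ₘ[lebesgue01] ℝ

/-- The decreasing rearrangement `μ(t; x) = inf {s ≥ 0 : m(|x| > s) ≤ t}`, for `t ∈ (0,1)`. -/
def rearr (x : S01) (t : ℝ) : ℝ :=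
  sInf {s : ℝ | 0 ≤ s ∧ lebesgue01 {u | s < |x u|} ≤ ENNReal.ofReal t}

/-- A symmetric quasi-Banach function space on `(0,1)`. Only the values of `qnorm` on `carrier`
are meaningful. -/
structure SymmQuasiBanach where
  carrier : Submodule ℝ S01
  qnorm : S01 → ℝ
  qnorm_nonneg : ∀ x ∈ carrier, 0 ≤ qnorm x
  qnorm_eq_zero : ∀ x ∈ carrier, qnorm x = 0 ↔ x = 0
  qnorm_smul : ∀ (a : ℝ), ∀ x ∈ carrier, qnorm (a • x) = |a| * qnorm x
  qnorm_add : ∃ K : ℝ, ∀ x ∈ carrier, ∀ y ∈ carrier, qnorm (x + y) ≤ K * (qnorm x + qnorm y)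
  complete : ∀ u : ℕ → S01, (∀ n, u n ∈ carrier) →
    (∀ ε > 0, ∃ N, ∀ i ≥ N, ∀ j ≥ N, qnorm (u i - u j) < ε) →
    ∃ x ∈ carrier, Tendsto (fun n => qnorm (u n - x)) atTop (𝓝 0)
  solid : ∀ x ∈ carrier, ∀ y : S01, |y| ≤ |x| → y ∈ carrier ∧ qnorm y ≤ qnorm x
  symmetric : ∀ x ∈ carrier, ∀ y : S01, (∀ t ∈ Ioo (0 : ℝ) 1, rearr y t = rearr x t) →
    y ∈ carrier ∧ qnorm y = qnorm x

namespace SymmQuasiBanach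

/-- Separability for the topology of the quasi-norm. -/
def IsSeparable (E : SymmQuasiBanach) : Prop :=
  ∃ D : Set S01, D.Countable ∧ D ⊆ E.carrier ∧
    ∀ x ∈ E.carrier, ∀ ε > 0, ∃ d ∈ D, E.qnorm (x - d) < ε

/-- The set-theoretic inclusion `E ⊂ L₁(0,1)`. -/
def SubsetL1 (E : SymmQuasiBanach) : Prop :=
  ∀ x ∈ E.carrier, Integrable x lebesgue01

end SymmQuasiBanach

/-- The Calderón operator `(S f)(t) = t⁻¹ ∫₀ᵗ f(s) ds + ∫ₜ¹ f(s)/s ds`. -/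
def calderon (f : ℝ → ℝ) (t : ℝ) : ℝ :=
  (1 / t) * (∫ s in (0 : ℝ)..t, f s) + ∫ s in t..(1 : ℝ), f s / s

/-- The relation `μ(x) ≤ S μ(y)` on `(0,1)`. -/
def CalderonDominated (x y : S01) : Prop :=
  ∀ t ∈ Ioo (0 : ℝ) 1, rearr x t ≤ calderon (rearr y) t

/-- `x ∈ L_{1,∞}(0,1)`. -/
def MemWeakL1 (x : S01) : Prop :=
  ∃ C : ℝ, ∀ t ∈ Ioo (0 : ℝ) 1, t * rearr x t ≤ C

/-- The underlying set of `𝒮_E`, for `E ⊂ L₁`. -/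
def calderonRange (E : SymmQuasiBanach) : Set S01 :=
  {x | MemWeakL1 x ∧ ∃ y ∈ E.carrier, CalderonDominated x y}

/-- The functional `‖x‖_{𝒮_E} = inf {‖y‖_E : μ(x) ≤ S μ(y)}`. -/
def calderonNorm (E : SymmQuasiBanach) (x : S01) : ℝ :=
  sInf {r : ℝ | ∃ y ∈ E.carrier, CalderonDominated x y ∧ r = E.qnorm y}

/-- The `n`-th dyadic σ-algebra, generated by the intervals `[j 2⁻ⁿ, (j+1) 2⁻ⁿ)`. -/
@[reducible] def dyadicSigma (n : ℕ) : MeasurableSpace ℝ :=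
  MeasurableSpace.comap (fun t : ℝ => ⌊(2 : ℝ) ^ n * t⌋) ⊤

/-- The conditional expectation `𝔼ₙ` on `(0,1)` with respect to the `n`-th dyadic σ-algebra. -/
def dyadicExp (n : ℕ) (x : ℝ → ℝ) : ℝ → ℝ :=
  condExp (dyadicSigma n) lebesgue01 x

/-- The martingale difference `𝔼ₙ x - 𝔼ₙ₋₁ x`, with `𝔼₋₁ = 0`. -/
def dyadicDiff : ℕ → (ℝ → ℝ) → ℝ → ℝ
  | 0, x => dyadicExp 0 x
  | n + 1, x => dyadicExp (n + 1) x - dyadicExp n x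

/-- `y = ∑_{m ≥ 0} (𝔼_{2m} x - 𝔼_{2m-1} x)`, the series converging in measure on `(0,1)`. -/
def IsEvenTransform (x y : S01) : Prop :=
  TendstoInMeasure lebesgue01
    (fun N : ℕ => fun t : ℝ => ∑ m ∈ Finset.range N, dyadicDiff (2 * m) x t) atTop y

/-- The Haar function `h_{n,k}`, for `1 ≤ k ≤ 2ⁿ`. -/
def haarFun (n k : ℕ) : ℝ → ℝ := fun t =>
  (Ioo ((2 * (k : ℝ) - 2) / 2 ^ (n + 1)) ((2 * (k : ℝ) - 1) / 2 ^ (n + 1))).indicator 1 t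
    - (Ioo ((2 * (k : ℝ) - 1) / 2 ^ (n + 1)) ((2 * (k : ℝ)) / 2 ^ (n + 1))).indicator 1 t

/-- `x` is a sign on `A`: it takes the values `±1` on `A` and vanishes off `A`. -/
def IsSignOn (A : Set ℝ) (x : S01) : Prop :=
  ∀ᵐ t ∂lebesgue01, (t ∈ A → x t = 1 ∨ x t = -1) ∧ (t ∉ A → x t = 0)

/-- A linear operator between symmetric quasi-Banach function spaces is bounded. -/
def IsBoundedOp {E X : SymmQuasiBanach} (T : E.carrier →ₗ[ℝ] X.carrier) : Prop :=
  ∃ C : ℝ, ∀ x : E.carrier, X.qnorm (T x) ≤ C * E.qnorm x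

/-- A narrow operator: bounded, and small on some sign on every measurable set. -/
def IsNarrow {E X : SymmQuasiBanach} (T : E.carrier →ₗ[ℝ] X.carrier) : Prop :=
  IsBoundedOp T ∧
    ∀ A : Set ℝ, MeasurableSet A → A ⊆ Ioo (0 : ℝ) 1 → ∀ ε > 0,
      ∃ x : E.carrier, IsSignOn A x ∧ X.qnorm (T x) < ε

end

noncomputable section

open scoped ENNReal

/-! The operator `T` is the dyadic martingale transform with coefficients 1 at even levels and 0 at
odd ones. Everything rests on one estimate, uniform in `n`, for its partial sums: μ(Tₙx) ≤ 9 Sμ(x)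
(`decRearr_evenSum_le`). It comes from the weak type (1,1) bound with constant 2, proved with
Burkholder's function (`dist01_evenSum_le`), from the L₂ contraction, and from self-adjointness on
bounded functions. To estimate at `t`, truncate `x` at height μ(t;x): the large part is controlled
by the weak type bound, the bounded part by testing Tₙf against its sign on a superlevel set and
moving Tₙ to that sign. Weak type and L₁ density of dyadic step functions also give convergence in
measure, and the estimate survives the limit with another factor 2. So `T` is bounded from `E` to
𝒮_E, and hence so is id − `T`.

For narrowness, the Rademacher function of level `n` restricted to a dyadic set of level `n` is a
single martingale difference, of level `n + 1`. It is killed by `T` when `n` is even and by id − `T`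
when `n` is odd. Approximate a measurable set `A` by a dyadic set `B` of high level: the signs given
by the Rademacher function on `A` and on `B` differ on a set of small measure, which by separability
makes the difference small in `E` (`exists_qnorm_lt_of_support`), while the sign on `B` is
annihilated (`isNarrow_of_rad`).

That 𝒮_E is a complete symmetric space is shown with the variant `KerDominated`, in which |y| is not
rearranged, so that dominating functions can simply be added. The inclusion of `E` in L₁ is
automatically bounded (`exists_lintegral_le`), so Cauchy sequences of 𝒮_E converge in measure, and
the tails are dominated by convergent series in `E`. -/

instance : IsProbabilityMeasure lebesgue01 :=
  ⟨by simp [lebesgue01]⟩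

/-! ### Decreasing rearrangements and the Hardy–Littlewood inequality. -/

theorem ae_mem_Ioo : ∀ᵐ t ∂lebesgue01, t ∈ Ioo (0 : ℝ) 1 :=
  ae_restrict_mem measurableSet_Ioo

/-- The distribution function of `|f|`. -/
def dist01 (f : ℝ → ℝ) (s : ℝ) : ℝ≥0∞ := lebesgue01 {u | s < |f u|}

/-- The decreasing rearrangement of a function. -/
def decRearr (f : ℝ → ℝ) (t : ℝ) : ℝ := sInf {s : ℝ | 0 ≤ s ∧ dist01 f s ≤ ENNReal.ofReal t}

theorem rearr_eq_decRearr (x : S01) (t : ℝ) : rearr x t = decRearr x t := rfl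

theorem dist01_congr {f g : ℝ → ℝ} (h : f =ᵐ[lebesgue01] g) (s : ℝ) : dist01 f s = dist01 g s := by
  refine measure_congr ?_
  filter_upwards [h] with u hu
  apply propext
  change s < |f u| ↔ s < |g u|
  rw [hu]

theorem decRearr_congr {f g : ℝ → ℝ} (h : f =ᵐ[lebesgue01] g) (t : ℝ) :
    decRearr f t = decRearr g t := by
  simp only [decRearr, dist01_congr h]

theorem dist01_anti (f : ℝ → ℝ) : Antitone (dist01 f) := fun _ _ h =>
  measure_mono fun _ hu => lt_of_le_of_lt h hu

theorem dist01_le_one (f : ℝ → ℝ) (s : ℝ) : dist01 f s ≤ 1 := prob_le_one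

theorem nullMeasurableSet_lt_abs {f : ℝ → ℝ} (hf : AEMeasurable f lebesgue01) (s : ℝ) :
    NullMeasurableSet {u | s < |f u|} lebesgue01 :=
  nullMeasurableSet_lt aemeasurable_const hf.abs

theorem tendsto_dist01 {f : ℝ → ℝ} (hf : AEMeasurable f lebesgue01) :
    Tendsto (fun n : ℕ => dist01 f n) atTop (𝓝 0) := by
  have h := tendsto_measure_iInter_atTop (μ := lebesgue01) (s := fun n : ℕ => {u | (n : ℝ) < |f u|})
    (fun n => nullMeasurableSet_lt_abs hf n)
    (fun a b hab u hu => lt_of_le_of_lt (b := (b : ℝ)) (Nat.cast_le.2 hab) hu) ⟨0, measure_ne_top _ _⟩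
  have h0 : (⋂ n : ℕ, {u | (n : ℝ) < |f u|}) = ∅ := by
    ext u
    simp only [mem_iInter, mem_empty_iff_false, iff_false, not_forall]
    obtain ⟨n, hn⟩ := exists_nat_ge |f u|
    exact ⟨n, not_lt.2 hn⟩
  rw [h0, measure_empty] at h
  exact h

theorem decRearr_set_nonempty {f : ℝ → ℝ} (hf : AEMeasurable f lebesgue01) {t : ℝ} (ht : 0 < t) :
    {s : ℝ | 0 ≤ s ∧ dist01 f s ≤ ENNReal.ofReal t}.Nonempty := by
  have h := (tendsto_dist01 hf).eventually_le_const (ENNReal.ofReal_pos.2 ht)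
  obtain ⟨n, hn⟩ := h.exists
  exact ⟨n, Nat.cast_nonneg n, hn⟩

theorem decRearr_set_bddBelow (f : ℝ → ℝ) (t : ℝ) :
    BddBelow {s : ℝ | 0 ≤ s ∧ dist01 f s ≤ ENNReal.ofReal t} := ⟨0, fun _ h => h.1⟩

theorem decRearr_nonneg (f : ℝ → ℝ) (t : ℝ) : 0 ≤ decRearr f t :=
  Real.sInf_nonneg fun _ h => h.1

theorem decRearr_le {f : ℝ → ℝ} {s t : ℝ} (hs : 0 ≤ s) (h : dist01 f s ≤ ENNReal.ofReal t) :
    decRearr f t ≤ s := csInf_le (decRearr_set_bddBelow f t) ⟨hs, h⟩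

/-- The infimum is attained because the distribution function is right continuous: {|f| > s} is the
increasing union of the sets {|f| > s + 1/(n+1)}. -/
theorem decRearr_le_iff {f : ℝ → ℝ} (hf : AEMeasurable f lebesgue01) {s t : ℝ} (ht : 0 < t)
    (hs : 0 ≤ s) : decRearr f t ≤ s ↔ dist01 f s ≤ ENNReal.ofReal t := by
  refine ⟨fun h => ?_, decRearr_le hs⟩
  have hu : {u | s < |f u|} = ⋃ n : ℕ, {u | s + 1 / ((n : ℝ) + 1) < |f u|} := by
    ext u
    simp only [mem_iUnion]
    constructor
    · intro hu
      obtain ⟨n, hn⟩ := exists_nat_one_div_lt (sub_pos.2 (show s < |f u| from hu))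
      exact ⟨n, show s + 1 / ((n : ℝ) + 1) < |f u| by linarith⟩
    · rintro ⟨n, hn⟩
      have : (0 : ℝ) < 1 / ((n : ℝ) + 1) := by positivity
      exact show s < |f u| from lt_trans (by linarith) (show s + 1 / ((n : ℝ) + 1) < |f u| from hn)
  have hm : Monotone fun n : ℕ => {u | s + 1 / ((n : ℝ) + 1) < |f u|} := by
    intro a b hab u hu
    have : 1 / ((b : ℝ) + 1) ≤ 1 / ((a : ℝ) + 1) := by gcongr
    exact lt_of_le_of_lt (by linarith) (show s + 1 / ((a : ℝ) + 1) < |f u| from hu)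
  rw [dist01, hu, hm.measure_iUnion]
  refine iSup_le fun n => ?_
  have hlt : decRearr f t < s + 1 / ((n : ℝ) + 1) := by
    have : (0 : ℝ) < 1 / ((n : ℝ) + 1) := by positivity
    linarith
  obtain ⟨r, hr, hrlt⟩ := exists_lt_of_csInf_lt (decRearr_set_nonempty hf ht) hlt
  exact (dist01_anti f hrlt.le).trans hr.2

theorem lt_decRearr_iff {f : ℝ → ℝ} (hf : AEMeasurable f lebesgue01) {s t : ℝ} (ht : 0 < t)
    (hs : 0 ≤ s) : s < decRearr f t ↔ ENNReal.ofReal t < dist01 f s := by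
  rw [← not_le, decRearr_le_iff hf ht hs, not_le]

theorem dist01_decRearr_le {f : ℝ → ℝ} (hf : AEMeasurable f lebesgue01) {t : ℝ} (ht : 0 < t) :
    dist01 f (decRearr f t) ≤ ENNReal.ofReal t :=
  (decRearr_le_iff hf ht (decRearr_nonneg f t)).1 le_rfl

theorem decRearr_antitoneOn {f : ℝ → ℝ} (hf : AEMeasurable f lebesgue01) :
    AntitoneOn (decRearr f) (Ioi 0) := by
  intro a ha b hb hab
  exact decRearr_le (decRearr_nonneg f a)
    ((dist01_decRearr_le hf ha).trans (ENNReal.ofReal_le_ofReal hab))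

theorem decRearr_mono {f g : ℝ → ℝ} (hg : AEMeasurable g lebesgue01)
    (h : ∀ᵐ u ∂lebesgue01, |f u| ≤ |g u|) {t : ℝ} (ht : 0 < t) : decRearr f t ≤ decRearr g t := by
  refine decRearr_le (decRearr_nonneg g t) (le_trans ?_ (dist01_decRearr_le hg ht))
  refine measure_mono_ae ?_
  filter_upwards [h] with u hu hlt
  exact lt_of_lt_of_le hlt hu

theorem decRearr_add {f g : ℝ → ℝ} (hf : AEMeasurable f lebesgue01) (hg : AEMeasurable g lebesgue01)
    {a b : ℝ} (ha : 0 < a) (hb : 0 < b) :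
    decRearr (fun u => f u + g u) (a + b) ≤ decRearr f a + decRearr g b := by
  refine decRearr_le (add_nonneg (decRearr_nonneg _ _) (decRearr_nonneg _ _)) ?_
  rw [ENNReal.ofReal_add ha.le hb.le]
  refine le_trans ?_ (add_le_add (dist01_decRearr_le hf ha) (dist01_decRearr_le hg hb))
  refine le_trans (measure_mono ?_) (measure_union_le _ _)
  intro u hu
  by_contra hcon
  simp only [mem_union, not_or] at hcon
  have h1 : |f u| ≤ decRearr f a := not_lt.1 hcon.1
  have h2 : |g u| ≤ decRearr g b := not_lt.1 hcon.2
  have h3 : decRearr f a + decRearr g b < |f u + g u| := hu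
  linarith [abs_add_le (f u) (g u)]

theorem decRearr_const_mul {f : ℝ → ℝ} (hf : AEMeasurable f lebesgue01) (c : ℝ) {t : ℝ}
    (ht : 0 < t) : decRearr (fun u => c * f u) t ≤ |c| * decRearr f t := by
  refine decRearr_le (mul_nonneg (abs_nonneg c) (decRearr_nonneg f t))
    (le_trans (measure_mono ?_) (dist01_decRearr_le hf ht))
  intro u hu
  have hu' : |c| * decRearr f t < |c| * |f u| := by
    rw [← abs_mul]; exact hu
  exact lt_of_mul_lt_mul_left hu' (abs_nonneg c)

theorem aemeasurable_decRearr {f : ℝ → ℝ} (hf : AEMeasurable f lebesgue01) :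
    AEMeasurable (decRearr f) lebesgue01 :=
  aemeasurable_restrict_of_antitoneOn measurableSet_Ioo
    ((decRearr_antitoneOn hf).mono fun _ h => h.1)

theorem lebesgue01_ofReal_lt {d : ℝ≥0∞} (hd : d ≤ 1) :
    lebesgue01 {t | ENNReal.ofReal t < d} = d := by
  have hne : d ≠ ∞ := ne_top_of_le_ne_top ENNReal.one_ne_top hd
  have h1 : d.toReal ≤ 1 := by simpa using ENNReal.toReal_mono ENNReal.one_ne_top hd
  have hs : lebesgue01 {t | ENNReal.ofReal t < d} = lebesgue01 (Ioo 0 d.toReal) := by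
    refine measure_congr ?_
    filter_upwards [ae_mem_Ioo] with t ht
    apply propext
    change ENNReal.ofReal t < d ↔ t ∈ Ioo 0 d.toReal
    rw [ENNReal.ofReal_lt_iff_lt_toReal ht.1.le hne]
    exact ⟨fun h => ⟨ht.1, h⟩, fun h => h.2⟩
  rw [hs, lebesgue01, Measure.restrict_apply measurableSet_Ioo, Ioo_inter_Ioo]
  simp [h1, hne]

theorem ae_lt_decRearr_iff {f : ℝ → ℝ} (hf : AEMeasurable f lebesgue01) {s : ℝ} (hs : 0 ≤ s) :
    ∀ᵐ t ∂lebesgue01, s < |decRearr f t| ↔ ENNReal.ofReal t < dist01 f s := by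
  filter_upwards [ae_mem_Ioo] with t ht
  rw [abs_of_nonneg (decRearr_nonneg f t), lt_decRearr_iff hf ht.1 hs]

/-- Up to a null set of (0,1), the superlevel set of the rearrangement at `s` is the interval from 0
to `dist01 f s`. -/
theorem dist01_decRearr {f : ℝ → ℝ} (hf : AEMeasurable f lebesgue01) {s : ℝ} (hs : 0 ≤ s) :
    dist01 (decRearr f) s = dist01 f s := by
  rw [← lebesgue01_ofReal_lt (dist01_le_one f s)]
  refine measure_congr ?_
  filter_upwards [ae_lt_decRearr_iff hf hs] with t ht
  exact propext ht

theorem decRearr_decRearr {f : ℝ → ℝ} (hf : AEMeasurable f lebesgue01) (t : ℝ) :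
    decRearr (decRearr f) t = decRearr f t := by
  unfold decRearr
  congr 1
  ext s
  refine and_congr_right fun hs => ?_
  have := dist01_decRearr hf hs
  unfold decRearr at this
  rw [this]

theorem lintegral_enorm_eq_dist01 {f : ℝ → ℝ} {ν : Measure ℝ} (hf : AEMeasurable f ν) :
    ∫⁻ u, ‖f u‖ₑ ∂ν = ∫⁻ s in Ioi (0 : ℝ), ν {u | s < |f u|} := by
  simp_rw [Real.enorm_eq_ofReal_abs]
  exact lintegral_eq_lintegral_meas_lt ν (Eventually.of_forall fun u => abs_nonneg _) hf.abs

/-- Layer-cake formula applied twice: to `f` for the measure with density |g|, then to `g` on each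
superlevel set of `f`. -/
theorem lintegral_mul_eq_dist {f g : ℝ → ℝ} (hf : AEMeasurable f lebesgue01)
    (hg : AEMeasurable g lebesgue01) :
    ∫⁻ u, ‖f u‖ₑ * ‖g u‖ₑ ∂lebesgue01 = ∫⁻ a in Ioi (0 : ℝ), ∫⁻ b in Ioi (0 : ℝ),
      lebesgue01 ({u | b < |g u|} ∩ {u | a < |f u|}) := by
  have h1 : ∫⁻ u, ‖f u‖ₑ * ‖g u‖ₑ ∂lebesgue01
      = ∫⁻ u, ‖f u‖ₑ ∂(lebesgue01.withDensity fun u => ‖g u‖ₑ) := by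
    rw [lintegral_withDensity_eq_lintegral_mul₀ hg.enorm hf.enorm]
    simp [mul_comm]
  rw [h1, lintegral_enorm_eq_dist01
    (hf.mono_ac (withDensity_absolutelyContinuous _ _))]
  refine lintegral_congr fun a => ?_
  rw [withDensity_apply₀ _ (nullMeasurableSet_lt_abs hf a), lintegral_enorm_eq_dist01 hg.restrict]
  refine lintegral_congr fun b => ?_
  rw [Measure.restrict_apply₀ (((nullMeasurableSet_lt_abs hg b)).mono_ac
    Measure.restrict_le_self.absolutelyContinuous)]

/-- The Hardy–Littlewood rearrangement inequality. -/
theorem lintegral_mul_le_decRearr {f g : ℝ → ℝ} (hf : AEMeasurable f lebesgue01)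
    (hg : AEMeasurable g lebesgue01) :
    ∫⁻ u, ‖f u‖ₑ * ‖g u‖ₑ ∂lebesgue01
      ≤ ∫⁻ u, ‖decRearr f u‖ₑ * ‖decRearr g u‖ₑ ∂lebesgue01 := by
  rw [lintegral_mul_eq_dist hf hg,
    lintegral_mul_eq_dist (aemeasurable_decRearr hf) (aemeasurable_decRearr hg)]
  refine setLIntegral_mono' measurableSet_Ioi fun a ha => ?_
  refine setLIntegral_mono' measurableSet_Ioi fun b hb => ?_
  have ha' : (0 : ℝ) ≤ a := le_of_lt ha
  have hb' : (0 : ℝ) ≤ b := le_of_lt hb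
  -- Superlevel sets of the two rearrangements are nested intervals starting at 0, so their
  -- intersection has the smaller of the two measures, which bounds the measure of any intersection.
  rcases le_total (dist01 f a) (dist01 g b) with h | h
  · calc lebesgue01 ({u | b < |g u|} ∩ {u | a < |f u|}) ≤ dist01 f a :=
          measure_mono inter_subset_right
      _ = dist01 (decRearr f) a := (dist01_decRearr hf ha').symm
      _ ≤ _ := by
        refine measure_mono_ae ?_
        filter_upwards [ae_lt_decRearr_iff hf ha', ae_lt_decRearr_iff hg hb'] with t h1 h2 h3
        exact ⟨h2.2 ((h1.1 h3).trans_le h), h3⟩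
  · calc lebesgue01 ({u | b < |g u|} ∩ {u | a < |f u|}) ≤ dist01 g b :=
          measure_mono inter_subset_left
      _ = dist01 (decRearr g) b := (dist01_decRearr hg hb').symm
      _ ≤ _ := by
        refine measure_mono_ae ?_
        filter_upwards [ae_lt_decRearr_iff hf ha', ae_lt_decRearr_iff hg hb'] with t h1 h2 h3
        exact ⟨h3, h1.2 ((h2.1 h3).trans_le h)⟩

theorem lintegral_decRearr {f : ℝ → ℝ} (hf : AEMeasurable f lebesgue01) :
    ∫⁻ u, ‖decRearr f u‖ₑ ∂lebesgue01 = ∫⁻ u, ‖f u‖ₑ ∂lebesgue01 := by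
  rw [lintegral_enorm_eq_dist01 hf, lintegral_enorm_eq_dist01 (aemeasurable_decRearr hf)]
  exact setLIntegral_congr_fun measurableSet_Ioi fun s hs => dist01_decRearr hf (le_of_lt hs)

/-- In the double layer-cake formula with equal factors, the intersection of two superlevel sets is
the one at the larger height, so only the distribution function enters. -/
theorem lintegral_decRearr_mul_self {f : ℝ → ℝ} (hf : AEMeasurable f lebesgue01) :
    ∫⁻ u, ‖decRearr f u‖ₑ * ‖decRearr f u‖ₑ ∂lebesgue01 = ∫⁻ u, ‖f u‖ₑ * ‖f u‖ₑ ∂lebesgue01 := by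
  have key : ∀ (g : ℝ → ℝ) (a b : ℝ),
      lebesgue01 ({u | b < |g u|} ∩ {u | a < |g u|}) = dist01 g (max b a) := by
    intro g a b
    rw [dist01]
    congr 1
    ext u
    change b < |g u| ∧ a < |g u| ↔ max b a < |g u|
    exact max_lt_iff.symm
  rw [lintegral_mul_eq_dist hf hf,
    lintegral_mul_eq_dist (aemeasurable_decRearr hf) (aemeasurable_decRearr hf)]
  refine setLIntegral_congr_fun measurableSet_Ioi fun a ha => ?_
  refine setLIntegral_congr_fun measurableSet_Ioi fun b hb => ?_
  simp only [key]
  exact dist01_decRearr hf (le_max_of_le_right (le_of_lt ha))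

/-! ### The Calderón operator as integration over (0,1) against 1 / max(s,t). -/

/-- The kernel of the Calderón operator. -/
def calKer (t s : ℝ) : ℝ := (max s t)⁻¹

theorem calKer_nonneg {t : ℝ} (ht : 0 < t) (s : ℝ) : 0 ≤ calKer t s :=
  inv_nonneg.2 (le_max_of_le_right ht.le)

theorem measurable_calKer (t : ℝ) : Measurable (calKer t) := by
  unfold calKer; fun_prop

theorem calKer_le {t : ℝ} (ht : 0 < t) (s : ℝ) : calKer t s ≤ t⁻¹ := by
  unfold calKer
  gcongr
  exact le_max_right _ _

/-- Rearrangements of sums are estimated at half the argument; this doubling property makes that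
cost a factor 2 only. -/
theorem calKer_half_le {t : ℝ} (ht : 0 < t) {s : ℝ} (hs : 0 < s) :
    calKer (t / 2) s ≤ 2 * calKer t s := by
  unfold calKer
  rw [show (2 : ℝ) * (max s t)⁻¹ = (max s t / 2)⁻¹ by field_simp]
  have h0 : 0 < max s t := lt_max_of_lt_right ht
  gcongr
  · rcases max_cases s t with h | h
    · rw [h.1]; exact le_max_of_le_left (by linarith)
    · rw [h.1]; exact le_max_right _ _

/-- The kernel is nonincreasing in its second variable: it exceeds its value at `s` only to the left
of `s`. -/
theorem decRearr_calKer_le {t s : ℝ} (ht : 0 < t) (hs : 0 < s) :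
    decRearr (calKer t) s ≤ calKer t s := by
  refine decRearr_le (calKer_nonneg ht s) ?_
  rw [dist01, lebesgue01, Measure.restrict_apply
    (measurableSet_lt measurable_const (measurable_calKer t).abs)]
  calc volume ({u | calKer t s < |calKer t u|} ∩ Ioo 0 1) ≤ volume (Ioo 0 s) := by
        refine measure_mono ?_
        rintro u ⟨hu, hu1⟩
        refine ⟨hu1.1, ?_⟩
        by_contra hcon
        have h1 : calKer t s < |calKer t u| := hu
        rw [abs_of_nonneg (calKer_nonneg ht u)] at h1
        have h2 : calKer t u ≤ calKer t s := by
          unfold calKer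
          have : 0 < max s t := lt_max_of_lt_right ht
          gcongr
          exact not_lt.1 hcon
        linarith
    _ = ENNReal.ofReal s := by simp

/-- The Calderón operator, with values in `[0, ∞]`, applied to `|f|`. -/
def calInt (f : ℝ → ℝ) (t : ℝ) : ℝ≥0∞ :=
  ∫⁻ s, ‖f s‖ₑ * ENNReal.ofReal (calKer t s) ∂lebesgue01

theorem calInt_mono {f g : ℝ → ℝ} (h : ∀ᵐ u ∂lebesgue01, |f u| ≤ |g u|) (t : ℝ) :
    calInt f t ≤ calInt g t := by
  refine lintegral_mono_ae ?_
  filter_upwards [h] with u hu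
  gcongr
  rw [Real.enorm_eq_ofReal_abs, Real.enorm_eq_ofReal_abs]
  exact ENNReal.ofReal_le_ofReal hu

theorem calInt_congr {f g : ℝ → ℝ} (h : f =ᵐ[lebesgue01] g) (t : ℝ) :
    calInt f t = calInt g t := by
  refine lintegral_congr_ae ?_
  filter_upwards [h] with u hu
  rw [hu]

theorem calInt_add_le {f : ℝ → ℝ} (hf : AEMeasurable f lebesgue01) (g : ℝ → ℝ) (t : ℝ) :
    calInt f t + calInt g t ≤ calInt (fun u => |f u| + |g u|) t := by
  unfold calInt
  have hm : AEMeasurable (fun s => ‖f s‖ₑ * ENNReal.ofReal (calKer t s)) lebesgue01 :=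
    hf.enorm.mul (measurable_calKer t).ennreal_ofReal.aemeasurable
  rw [← lintegral_add_left' hm]
  refine lintegral_mono fun u => ?_
  rw [← add_mul]
  gcongr
  rw [Real.enorm_eq_ofReal_abs, Real.enorm_eq_ofReal_abs, Real.enorm_eq_ofReal_abs,
    ← ENNReal.ofReal_add (abs_nonneg _) (abs_nonneg _),
    abs_of_nonneg (add_nonneg (abs_nonneg (f u)) (abs_nonneg (g u)))]

theorem calInt_const_mul (f : ℝ → ℝ) (c t : ℝ) :
    calInt (fun u => c * f u) t = ENNReal.ofReal |c| * calInt f t := by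
  unfold calInt
  rw [← lintegral_const_mul' _ _ ENNReal.ofReal_ne_top]
  refine lintegral_congr fun u => ?_
  rw [enorm_mul, Real.enorm_eq_ofReal_abs c, mul_assoc]

theorem calInt_half_le {f : ℝ → ℝ} {t : ℝ} (ht : 0 < t) :
    calInt f (t / 2) ≤ 2 * calInt f t := by
  unfold calInt
  rw [← lintegral_const_mul' _ _ ENNReal.ofNat_ne_top]
  refine lintegral_mono_ae ?_
  filter_upwards [ae_mem_Ioo] with s hs
  rw [← mul_assoc, mul_comm 2, mul_assoc]
  gcongr
  rw [show (2 : ℝ≥0∞) = ENNReal.ofReal 2 by simp, ← ENNReal.ofReal_mul (by norm_num)]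
  exact ENNReal.ofReal_le_ofReal (calKer_half_le ht hs.1)

/-- Hardy–Littlewood against a kernel that rearrangement does not enlarge. -/
theorem calInt_le_decRearr {f : ℝ → ℝ} (hf : AEMeasurable f lebesgue01) {t : ℝ} (ht : 0 < t) :
    calInt f t ≤ calInt (decRearr f) t := by
  have h1 : ∀ s, ENNReal.ofReal (calKer t s) = ‖calKer t s‖ₑ := fun s =>
    (Real.enorm_of_nonneg (calKer_nonneg ht s)).symm
  unfold calInt
  simp_rw [h1]
  refine (lintegral_mul_le_decRearr hf (measurable_calKer t).aemeasurable).trans ?_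
  refine lintegral_mono_ae ?_
  filter_upwards [ae_mem_Ioo] with s hs
  gcongr
  rw [Real.enorm_of_nonneg (decRearr_nonneg _ _), Real.enorm_of_nonneg (calKer_nonneg ht s)]
  exact ENNReal.ofReal_le_ofReal (decRearr_calKer_le ht hs.1)

theorem calInt_le_lintegral {f : ℝ → ℝ} {t : ℝ} (ht : 0 < t) :
    calInt f t ≤ ENNReal.ofReal t⁻¹ * ∫⁻ u, ‖f u‖ₑ ∂lebesgue01 := by
  unfold calInt
  rw [← lintegral_const_mul' _ _ ENNReal.ofReal_ne_top]
  refine lintegral_mono fun u => ?_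
  rw [mul_comm]
  gcongr
  exact calKer_le ht u

/-- The average of a nonincreasing function over (0,t) is already at least its value at `t`. -/
theorem decRearr_le_calInt {f : ℝ → ℝ} (hf : AEMeasurable f lebesgue01) {t : ℝ}
    (ht : t ∈ Ioo (0 : ℝ) 1) : ENNReal.ofReal (decRearr f t) ≤ calInt (decRearr f) t := by
  have h0 : lebesgue01 (Ioo 0 t) = ENNReal.ofReal t := by
    rw [lebesgue01, Measure.restrict_apply measurableSet_Ioo, Ioo_inter_Ioo]
    simp [ht.2.le]
  calc ENNReal.ofReal (decRearr f t)
      = ∫⁻ _ in Ioo 0 t, ENNReal.ofReal (decRearr f t) * ENNReal.ofReal t⁻¹ ∂lebesgue01 := by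
        rw [setLIntegral_const, h0, mul_assoc, ← ENNReal.ofReal_mul (inv_nonneg.2 ht.1.le),
          inv_mul_cancel₀ ht.1.ne']
        simp
    _ ≤ ∫⁻ s in Ioo 0 t, ‖decRearr f s‖ₑ * ENNReal.ofReal (calKer t s) ∂lebesgue01 := by
        refine setLIntegral_mono' measurableSet_Ioo fun s hs => ?_
        rw [Real.enorm_of_nonneg (decRearr_nonneg _ _)]
        gcongr
        · exact decRearr_antitoneOn hf hs.1 ht.1 hs.2.le
        · rw [calKer, max_eq_right hs.2.le]
    _ ≤ _ := setLIntegral_le_lintegral _ _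

theorem calInt_eq_calderon {f : ℝ → ℝ} (hf : Integrable f lebesgue01) (hf0 : ∀ s, 0 ≤ f s) {t : ℝ}
    (ht : t ∈ Ioo (0 : ℝ) 1) : calInt f t = ENNReal.ofReal (calderon f t) := by
  have hint : Integrable (fun s => f s * calKer t s) lebesgue01 := by
    refine hf.mul_bdd (measurable_calKer t).aestronglyMeasurable (c := t⁻¹) ?_
    exact Eventually.of_forall fun s => by
      rw [Real.norm_of_nonneg (calKer_nonneg ht.1 s)]; exact calKer_le ht.1 s
  have h1 : calInt f t = ENNReal.ofReal (∫ s, f s * calKer t s ∂lebesgue01) := by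
    rw [ofReal_integral_eq_lintegral_ofReal hint
      (Eventually.of_forall fun s => mul_nonneg (hf0 s) (calKer_nonneg ht.1 s))]
    refine lintegral_congr fun s => ?_
    rw [ENNReal.ofReal_mul (hf0 s), Real.enorm_of_nonneg (hf0 s)]
  rw [h1]
  congr 1
  have h2 : lebesgue01 = volume.restrict (Ioc 0 1) := Measure.restrict_congr_set Ioo_ae_eq_Ioc
  rw [h2] at hint hf ⊢
  have hII : IntervalIntegrable (fun s => f s * calKer t s) volume 0 1 :=
    (intervalIntegrable_iff_integrableOn_Ioc_of_le zero_le_one).2 hint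
  have hsub1 : uIcc 0 t ⊆ uIcc (0 : ℝ) 1 := by
    rw [uIcc_of_le ht.1.le, uIcc_of_le zero_le_one]; exact Icc_subset_Icc_right ht.2.le
  have hsub2 : uIcc t 1 ⊆ uIcc (0 : ℝ) 1 := by
    rw [uIcc_of_le ht.2.le, uIcc_of_le zero_le_one]; exact Icc_subset_Icc_left ht.1.le
  rw [← intervalIntegral.integral_of_le zero_le_one,
    ← intervalIntegral.integral_add_adjacent_intervals (hII.mono_set hsub1) (hII.mono_set hsub2),
    calderon, ← intervalIntegral.integral_const_mul]
  congr 1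
  · refine intervalIntegral.integral_congr fun s hs => ?_
    rw [uIcc_of_le ht.1.le] at hs
    simp only [calKer, max_eq_right hs.2]
    ring
  · refine intervalIntegral.integral_congr fun s hs => ?_
    rw [uIcc_of_le ht.2.le] at hs
    simp only [calKer, max_eq_left hs.1]
    ring

/-! ### Calderón domination between elements of S(0,1). -/

/-- The rearrangement as an element of `S(0,1)`. -/
def rearrS (x : S01) : S01 :=
  AEEqFun.mk (rearr x) (aemeasurable_decRearr x.aemeasurable).aestronglyMeasurable

theorem coeFn_rearrS (x : S01) : rearrS x =ᵐ[lebesgue01] rearr x := AEEqFun.coeFn_mk _ _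

theorem rearr_rearrS (x : S01) (t : ℝ) : rearr (rearrS x) t = rearr x t := by
  rw [rearr_eq_decRearr, decRearr_congr (coeFn_rearrS x)]
  exact decRearr_decRearr x.aemeasurable t

theorem abs_rearrS_ae (x : S01) : ∀ᵐ u ∂lebesgue01, |rearrS x u| = rearr x u := by
  filter_upwards [coeFn_rearrS x] with u hu
  rw [hu]
  exact abs_of_nonneg (decRearr_nonneg _ _)

theorem rearrS_nonneg (x : S01) : ∀ᵐ u ∂lebesgue01, 0 ≤ rearrS x u := by
  filter_upwards [coeFn_rearrS x] with u hu
  rw [hu]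
  exact decRearr_nonneg _ _

/-- Domination of `μ(x)` by the Calderón integral of `|y|` itself. -/
def KerDominated (x y : S01) : Prop :=
  ∀ t ∈ Ioo (0 : ℝ) 1, ENNReal.ofReal (rearr x t) ≤ calInt y t

theorem integrable_rearr {y : S01} (hy : Integrable y lebesgue01) :
    Integrable (rearr y) lebesgue01 := by
  refine ⟨(aemeasurable_decRearr y.aemeasurable).aestronglyMeasurable, ?_⟩
  rw [hasFiniteIntegral_iff_enorm]
  calc _ = ∫⁻ u, ‖y u‖ₑ ∂lebesgue01 := lintegral_decRearr y.aemeasurable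
    _ < ∞ := hy.2

/-- After `y` is replaced by its rearrangement the two notions of domination agree; integrability
turns the extended integral into the real Calderón operator. -/
theorem calderonDominated_iff {x y : S01} (hy : Integrable y lebesgue01) :
    CalderonDominated x y ↔ KerDominated x (rearrS y) := by
  refine forall₂_congr fun t ht => ?_
  rw [calInt_congr (coeFn_rearrS y), calInt_eq_calderon (integrable_rearr hy)
    (fun s => decRearr_nonneg _ _) ht]
  constructor
  · exact fun h => ENNReal.ofReal_le_ofReal h
  · intro h
    rw [ENNReal.ofReal_le_ofReal_iff'] at h
    rcases h with h | h
    · exact h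
    -- Truncation by `ENNReal.ofReal` leaves the case `rearr x t ≤ 0`, settled by nonnegativity of
    -- the Calderón operator on nonnegative functions.
    · refine h.trans ?_
      have h1 := add_nonneg (a := (1 / t) * (∫ s in (0 : ℝ)..t, rearr y s))
        (b := ∫ s in t..(1 : ℝ), rearr y s / s)
        (mul_nonneg (one_div_nonneg.2 ht.1.le)
          (intervalIntegral.integral_nonneg ht.1.le fun s _ => decRearr_nonneg _ _))
        (intervalIntegral.integral_nonneg ht.2.le fun s hs =>
          div_nonneg (decRearr_nonneg _ _) (ht.1.le.trans hs.1))
      exact h1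

/-- This permits constructing dominating functions by sums and multiples in `E`, without looking at
their rearrangements. -/
theorem KerDominated.calderonDominated {x y : S01} (hy : Integrable y lebesgue01)
    (h : KerDominated x y) : CalderonDominated x y := by
  rw [calderonDominated_iff hy]
  intro t ht
  rw [calInt_congr (coeFn_rearrS y)]
  exact (h t ht).trans (calInt_le_decRearr y.aemeasurable ht.1)

theorem KerDominated.mono {x y z : S01} (h : KerDominated x y)
    (hyz : ∀ᵐ u ∂lebesgue01, |y u| ≤ |z u|) : KerDominated x z :=
  fun t ht => (h t ht).trans (calInt_mono hyz t)

theorem kerDominated_rearrS (x : S01) : KerDominated x (rearrS x) := by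
  intro t ht
  rw [calInt_congr (coeFn_rearrS x)]
  exact decRearr_le_calInt x.aemeasurable ht

theorem rearr_nonneg (x : S01) (t : ℝ) : 0 ≤ rearr x t := decRearr_nonneg x t

theorem rearr_add_le (x y : S01) {a b : ℝ} (ha : 0 < a) (hb : 0 < b) :
    rearr (x + y) (a + b) ≤ rearr x a + rearr y b := by
  rw [rearr_eq_decRearr, decRearr_congr (AEEqFun.coeFn_add x y)]
  exact decRearr_add x.aemeasurable y.aemeasurable ha hb

theorem rearr_smul_le (x : S01) (c : ℝ) {t : ℝ} (ht : 0 < t) :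
    rearr (c • x) t ≤ |c| * rearr x t := by
  rw [rearr_eq_decRearr, decRearr_congr (AEEqFun.coeFn_smul c x)]
  exact decRearr_const_mul x.aemeasurable c ht

/-- Use μ(t; x₁ + x₂) ≤ μ(t/2; x₁) + μ(t/2; x₂); the factor 2 pays for `calInt_half_le`. -/
theorem KerDominated.add {x₁ x₂ y₁ y₂ : S01} (h₁ : KerDominated x₁ y₁)
    (h₂ : KerDominated x₂ y₂) : KerDominated (x₁ + x₂) ((2 : ℝ) • (|y₁| + |y₂|)) := by
  intro t ht
  have ht2 : t / 2 ∈ Ioo (0 : ℝ) 1 := ⟨by linarith [ht.1], by linarith [ht.1, ht.2]⟩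
  have hc : (((2 : ℝ) • (|y₁| + |y₂|) : S01) : ℝ → ℝ) =ᵐ[lebesgue01]
      fun u => 2 * (|y₁ u| + |y₂ u|) := by
    filter_upwards [AEEqFun.coeFn_smul (2 : ℝ) (|y₁| + |y₂|), AEEqFun.coeFn_add |y₁| |y₂|,
      AEEqFun.coeFn_abs y₁, AEEqFun.coeFn_abs y₂] with u h1 h2 h3 h4
    rw [h1, Pi.smul_apply, h2, Pi.add_apply, h3, h4, smul_eq_mul]
  rw [calInt_congr hc, calInt_const_mul]
  calc ENNReal.ofReal (rearr (x₁ + x₂) t)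
      ≤ ENNReal.ofReal (rearr x₁ (t / 2)) + ENNReal.ofReal (rearr x₂ (t / 2)) := by
        rw [← ENNReal.ofReal_add (rearr_nonneg _ _) (rearr_nonneg _ _)]
        refine ENNReal.ofReal_le_ofReal ?_
        have := rearr_add_le x₁ x₂ ht2.1 ht2.1
        rwa [add_halves] at this
    _ ≤ 2 * calInt y₁ t + 2 * calInt y₂ t :=
        add_le_add ((h₁ _ ht2).trans (calInt_half_le ht.1)) ((h₂ _ ht2).trans (calInt_half_le ht.1))
    _ = 2 * (calInt y₁ t + calInt y₂ t) := by rw [mul_add]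
    _ ≤ _ := by
      have h2 : ENNReal.ofReal |(2 : ℝ)| = 2 := by simp
      rw [h2]
      gcongr
      exact calInt_add_le y₁.aemeasurable _ t

theorem KerDominated.smul {x y : S01} (h : KerDominated x y) (c : ℝ) :
    KerDominated (c • x) (c • y) := by
  intro t ht
  rw [calInt_congr (AEEqFun.coeFn_smul c y)]
  change _ ≤ calInt (fun u => c * y u) t
  rw [calInt_const_mul]
  calc ENNReal.ofReal (rearr (c • x) t) ≤ ENNReal.ofReal (|c| * rearr x t) :=
        ENNReal.ofReal_le_ofReal (rearr_smul_le x c ht.1)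
    _ = ENNReal.ofReal |c| * ENNReal.ofReal (rearr x t) := ENNReal.ofReal_mul (abs_nonneg c)
    _ ≤ _ := by gcongr; exact h t ht

theorem ae_abs_le_of_abs_le {x y : S01} : |y| ≤ |x| ↔ ∀ᵐ u ∂lebesgue01, |y u| ≤ |x u| := by
  rw [← AEEqFun.coeFn_le]
  constructor
  · intro h
    filter_upwards [h, AEEqFun.coeFn_abs x, AEEqFun.coeFn_abs y] with u h1 h2 h3
    rwa [h2, h3] at h1
  · intro h
    filter_upwards [h, AEEqFun.coeFn_abs x, AEEqFun.coeFn_abs y] with u h1 h2 h3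
    rwa [h2, h3]

/-- The indicator function of a measurable set as an element of `S(0,1)`. -/
def indS (B : Set ℝ) (hB : MeasurableSet B) : S01 :=
  AEEqFun.mk (B.indicator 1) (measurable_one.indicator hB).aestronglyMeasurable

theorem coeFn_indS (B : Set ℝ) (hB : MeasurableSet B) :
    indS B hB =ᵐ[lebesgue01] B.indicator 1 := AEEqFun.coeFn_mk _ _

theorem lebesgue01_Ico {s t : ℝ} (hs : 0 < s) (ht : t < 1) :
    lebesgue01 (Ico s t) = ENNReal.ofReal (t - s) := by
  rw [lebesgue01, Measure.restrict_apply measurableSet_Ico, inter_eq_left.2, Real.volume_Ico]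
  exact fun u hu => ⟨hs.trans_le hu.1, hu.2.trans ht⟩

/-- The rearrangement of `x` is at most 1 and vanishes from `δ` on, while that of `y` is at least 1
before `δ`. -/
theorem rearr_le_of_support {x y : S01} {δ : ℝ} (hx : ∀ᵐ u ∂lebesgue01, |x u| ≤ 1)
    (hδ : lebesgue01 {u | x u ≠ 0} ≤ ENNReal.ofReal δ)
    (hy : ∀ r, 0 ≤ r → r < 1 → ENNReal.ofReal δ ≤ dist01 y r) :
    ∀ t ∈ Ioo (0 : ℝ) 1, rearr x t ≤ rearr y t := by
  intro t ht
  by_cases h : δ ≤ t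
  · refine le_trans (decRearr_le le_rfl (le_trans (measure_mono ?_)
      (hδ.trans (ENNReal.ofReal_le_ofReal h)))) (rearr_nonneg y t)
    intro u hu
    exact abs_pos.1 (show 0 < |x u| from hu)
  · have h1 : rearr x t ≤ 1 := by
      refine decRearr_le zero_le_one (le_of_eq_of_le ?_ zero_le)
      have := ae_iff.1 hx
      simpa [dist01] using this
    refine h1.trans (le_of_forall_lt fun r hr => ?_)
    rcases lt_or_ge r 0 with h0 | h0
    · exact h0.trans_le (rearr_nonneg y t)
    · refine (lt_decRearr_iff y.aemeasurable ht.1 h0).2 (lt_of_lt_of_le ?_ (hy r h0 hr))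
      exact (ENNReal.ofReal_lt_ofReal_iff_of_nonneg ht.1.le).2 (not_le.1 h)

/-! ### General facts on symmetric quasi-Banach function spaces. -/

namespace SymmQuasiBanach

variable (E : SymmQuasiBanach)

theorem exists_const : ∃ K : ℝ, 1 ≤ K ∧ ∀ x ∈ E.carrier, ∀ y ∈ E.carrier,
    E.qnorm (x + y) ≤ K * (E.qnorm x + E.qnorm y) := by
  obtain ⟨K, hK⟩ := E.qnorm_add
  refine ⟨max K 1, le_max_right _ _, fun x hx y hy => (hK x hx y hy).trans ?_⟩
  gcongr
  · exact add_nonneg (E.qnorm_nonneg x hx) (E.qnorm_nonneg y hy)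
  · exact le_max_left _ _

theorem qnorm_zero : E.qnorm 0 = 0 := (E.qnorm_eq_zero 0 E.carrier.zero_mem).2 rfl

variable {E}

theorem solid_ae {x y : S01} (hx : x ∈ E.carrier) (h : ∀ᵐ u ∂lebesgue01, |y u| ≤ |x u|) :
    y ∈ E.carrier ∧ E.qnorm y ≤ E.qnorm x :=
  E.solid x hx y (ae_abs_le_of_abs_le.2 h)

theorem abs_mem {x : S01} (hx : x ∈ E.carrier) : |x| ∈ E.carrier ∧ E.qnorm |x| = E.qnorm x := by
  have h : ∀ᵐ u ∂lebesgue01, |(|x| : S01) u| = |x u| := by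
    filter_upwards [AEEqFun.coeFn_abs x] with u hu
    rw [hu, abs_abs]
  have h1 := solid_ae hx (h.mono fun _ hu => hu.le)
  exact ⟨h1.1, le_antisymm h1.2 (solid_ae h1.1 (h.mono fun _ hu => hu.ge)).2⟩

theorem qnorm_neg {x : S01} (hx : x ∈ E.carrier) : E.qnorm (-x) = E.qnorm x := by
  have := E.qnorm_smul (-1) x hx
  simpa using this

theorem qnorm_sub_comm {x y : S01} (hx : x ∈ E.carrier) (hy : y ∈ E.carrier) :
    E.qnorm (x - y) = E.qnorm (y - x) := by
  rw [← neg_sub, qnorm_neg (E.carrier.sub_mem hy hx)]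

theorem rearrS_mem {x : S01} (hx : x ∈ E.carrier) :
    rearrS x ∈ E.carrier ∧ E.qnorm (rearrS x) = E.qnorm x :=
  E.symmetric x hx _ fun t _ => rearr_rearrS x t

/-- Solidity applies to the rearrangements themselves; symmetry carries the conclusion back to the
functions. -/
theorem mem_of_rearr_le {x y : S01} (hx : x ∈ E.carrier)
    (h : ∀ t ∈ Ioo (0 : ℝ) 1, rearr y t ≤ rearr x t) :
    y ∈ E.carrier ∧ E.qnorm y ≤ E.qnorm x := by
  have h1 := rearrS_mem hx
  have h2 : rearrS y ∈ E.carrier ∧ E.qnorm (rearrS y) ≤ E.qnorm (rearrS x) := by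
    refine solid_ae h1.1 ?_
    filter_upwards [abs_rearrS_ae x, abs_rearrS_ae y, ae_mem_Ioo] with u hx hy hu
    rw [hx, hy]
    exact h u hu
  have h3 := E.symmetric _ h2.1 y fun t _ => (rearr_rearrS y t).symm
  exact ⟨h3.1, h3.2.le.trans (h2.2.trans h1.2.le)⟩

/-- For every `m ≥ n` the positive part of u n − x is at most |u m − x|, so its quasi-norm is zero.
-/
theorem le_of_tendsto_of_mono {u : ℕ → S01} {x : S01} (hu : ∀ n, u n ∈ E.carrier)
    (hx : x ∈ E.carrier) (hm : ∀ n m, n ≤ m → ∀ᵐ t ∂lebesgue01, u n t ≤ u m t)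
    (hlim : Tendsto (fun n => E.qnorm (u n - x)) atTop (𝓝 0)) (n : ℕ) :
    ∀ᵐ t ∂lebesgue01, u n t ≤ x t := by
  set z : S01 := (u n - x) ⊔ 0 with hz
  have hzt : ∀ᵐ t ∂lebesgue01, z t = max (u n t - x t) 0 := by
    filter_upwards [AEEqFun.coeFn_sup (u n - x) 0, AEEqFun.coeFn_sub (u n) x,
      AEEqFun.coeFn_zero (β := ℝ) (μ := lebesgue01)] with t h1 h2 h3
    rw [hz, h1, h2, h3]
    rfl
  have key : ∀ m, n ≤ m → z ∈ E.carrier ∧ E.qnorm z ≤ E.qnorm (u m - x) := by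
    intro m hnm
    refine solid_ae (E.carrier.sub_mem (hu m) hx) ?_
    filter_upwards [hzt, hm n m hnm, AEEqFun.coeFn_sub (u m) x] with t h1 h2 h3
    rw [h1, h3, abs_of_nonneg (le_max_right _ _)]
    refine max_le ?_ (abs_nonneg _)
    exact le_trans (by simpa using h2) (le_abs_self _)
  have hz0 : E.qnorm z = 0 := by
    refine le_antisymm (ge_of_tendsto hlim ?_) (E.qnorm_nonneg _ (key n le_rfl).1)
    filter_upwards [eventually_ge_atTop n] with m hm using (key m hm).2
  have hz1 := (E.qnorm_eq_zero z (key n le_rfl).1).1 hz0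
  have hz2 : ∀ᵐ t ∂lebesgue01, z t = 0 := by
    rw [hz1]
    exact AEEqFun.coeFn_zero
  filter_upwards [hzt, hz2] with t h1 h2
  have := le_max_left (u n t - x t) 0
  linarith

/-- The first term is split off at each induction step. The geometric ratio 1/(2K) offsets the
factor `K` lost there, and `2 * K * c` is the fixed point of the resulting recursion. -/
theorem qnorm_sum_le {K : ℝ} (hK1 : 1 ≤ K) (hK : ∀ x ∈ E.carrier, ∀ y ∈ E.carrier,
    E.qnorm (x + y) ≤ K * (E.qnorm x + E.qnorm y)) {y : ℕ → S01} (hy : ∀ j, y j ∈ E.carrier)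
    {c : ℝ} (hc0 : 0 ≤ c) (hc : ∀ j, E.qnorm (y j) ≤ c * ((2 * K)⁻¹) ^ j) (M a : ℕ) :
    E.qnorm (∑ j ∈ Finset.range M, y (a + j)) ≤ 2 * K * c * ((2 * K)⁻¹) ^ a := by
  induction M generalizing a with
  | zero =>
    simp only [Finset.range_zero, Finset.sum_empty, qnorm_zero]
    positivity
  | succ M ih =>
    rw [Finset.sum_range_succ']
    have h1 : ∑ j ∈ Finset.range M, y (a + (j + 1)) = ∑ j ∈ Finset.range M, y (a + 1 + j) :=
      Finset.sum_congr rfl fun j _ => by congr 1; ring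
    rw [h1, add_zero]
    refine (hK _ (E.carrier.sum_mem fun j _ => hy _) _ (hy a)).trans ?_
    calc _ ≤ K * (2 * K * c * ((2 * K)⁻¹) ^ (a + 1) + c * ((2 * K)⁻¹) ^ a) := by
          gcongr
          · exact ih (a + 1)
          · exact hc a
      _ = _ := by
        rw [pow_succ]
        field_simp
        ring

theorem tendsto_inv_two_mul_pow {K : ℝ} (hK1 : 1 ≤ K) (c : ℝ) :
    Tendsto (fun a : ℕ => c * ((2 * K)⁻¹) ^ a) atTop (𝓝 0) := by
  have h : Tendsto (fun a : ℕ => ((2 * K)⁻¹) ^ a) atTop (𝓝 0) :=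
    tendsto_pow_atTop_nhds_zero_of_lt_one (by positivity)
      (inv_lt_one_of_one_lt₀ (by linarith))
  simpa using h.const_mul c

theorem coeFn_sum (y : ℕ → S01) (s : Finset ℕ) :
    (∑ j ∈ s, y j : S01) =ᵐ[lebesgue01] fun t => ∑ j ∈ s, y j t := by
  classical
  induction s using Finset.induction_on with
  | empty =>
    simp only [Finset.sum_empty]
    exact AEEqFun.coeFn_zero
  | insert a s ha ih =>
    rw [Finset.sum_insert ha]
    filter_upwards [AEEqFun.coeFn_add (y a) (∑ j ∈ s, y j), ih] with t h1 h2
    rw [h1, Pi.add_apply, h2, Finset.sum_insert ha]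

/-- The quasi-norm limit of the increasing partial sums dominates each of them. One more
quasi-triangle inequality turns the bound `2 * K * c` into `2 * K ^ 2 * c`. -/
theorem exists_dominating_sum {K : ℝ} (hK1 : 1 ≤ K) (hK : ∀ x ∈ E.carrier, ∀ y ∈ E.carrier,
    E.qnorm (x + y) ≤ K * (E.qnorm x + E.qnorm y)) {y : ℕ → S01} (hy : ∀ j, y j ∈ E.carrier)
    (hy0 : ∀ j, ∀ᵐ t ∂lebesgue01, 0 ≤ y j t)
    {c : ℝ} (hc0 : 0 ≤ c) (hc : ∀ j, E.qnorm (y j) ≤ c * ((2 * K)⁻¹) ^ j) :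
    ∃ Y ∈ E.carrier, E.qnorm Y ≤ 2 * K ^ 2 * c ∧
      ∀ M, ∀ᵐ t ∂lebesgue01, ∑ j ∈ Finset.range M, y j t ≤ Y t := by
  set u : ℕ → S01 := fun M => ∑ j ∈ Finset.range M, y j with hu
  have hmem : ∀ M, u M ∈ E.carrier := fun M => E.carrier.sum_mem fun j _ => hy j
  have hdiff : ∀ i j, i ≤ j → E.qnorm (u j - u i) ≤ 2 * K * c * ((2 * K)⁻¹) ^ i := by
    intro i j hij
    have h1 : u j - u i = ∑ l ∈ Finset.range (j - i), y (i + l) := by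
      rw [hu]
      simp only
      rw [← Finset.sum_Ico_eq_sub _ hij, Finset.sum_Ico_eq_sum_range]
    rw [h1]
    exact qnorm_sum_le hK1 hK hy hc0 hc _ _
  have hae : ∀ M, (u M : ℝ → ℝ) =ᵐ[lebesgue01] fun t => ∑ j ∈ Finset.range M, y j t :=
    fun M => coeFn_sum y _
  obtain ⟨Y, hY, hlim⟩ := E.complete u hmem (by
    intro ε hε
    obtain ⟨N, hN⟩ := ((tendsto_inv_two_mul_pow hK1 (2 * K * c)).eventually_lt_const hε).exists
    have hN' : ∀ i, N ≤ i → 2 * K * c * ((2 * K)⁻¹) ^ i < ε := by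
      intro i hi
      refine lt_of_le_of_lt ?_ hN
      gcongr ?_ * ?_
      exact pow_le_pow_of_le_one (by positivity) (inv_le_one_of_one_le₀ (by linarith)) hi
    refine ⟨N, fun i hi j hj => ?_⟩
    rcases le_total i j with h | h
    · rw [qnorm_sub_comm (hmem i) (hmem j)]
      exact (hdiff i j h).trans_lt (hN' i hi)
    · exact (hdiff j i h).trans_lt (hN' j hj))
  refine ⟨Y, hY, ?_, fun M => ?_⟩
  · have h1 : Tendsto (fun n => K * (E.qnorm (u n - Y) + 2 * K * c)) atTop
        (𝓝 (K * (0 + 2 * K * c))) := (hlim.add_const _).const_mul K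
    have h2 : E.qnorm Y ≤ K * (0 + 2 * K * c) := by
      refine ge_of_tendsto h1 (Eventually.of_forall fun n => ?_)
      have h3 : Y = (Y - u n) + u n := by abel
      calc E.qnorm Y = E.qnorm ((Y - u n) + u n) := by rw [← h3]
        _ ≤ K * (E.qnorm (Y - u n) + E.qnorm (u n)) :=
            hK _ (E.carrier.sub_mem hY (hmem n)) _ (hmem n)
        _ ≤ _ := by
          rw [qnorm_sub_comm hY (hmem n)]
          gcongr
          have := qnorm_sum_le hK1 hK hy hc0 hc n 0
          simpa [hu] using this
    calc E.qnorm Y ≤ _ := h2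
      _ = _ := by ring
  · have h1 := le_of_tendsto_of_mono hmem hY (fun n m hnm => by
      have hall : ∀ᵐ t ∂lebesgue01, ∀ j, 0 ≤ y j t := ae_all_iff.2 hy0
      filter_upwards [hae n, hae m, hall] with t h1 h2 h3
      rw [h1, h2]
      exact Finset.sum_le_sum_of_subset_of_nonneg (Finset.range_mono hnm) fun j _ _ => h3 j) hlim M
    filter_upwards [h1, hae M] with t h2 h3
    rwa [← h3]

/-- The inclusion in L₁ is automatically bounded. Otherwise some `x j` have L₁ norm above (4K)^j
times their quasi-norm; rescaled to quasi-norm (2K)^(-j) they have L₁ norm above 2^j, and a function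
of `E` dominating their sum would not be integrable. -/
theorem exists_lintegral_le (hE : E.SubsetL1) : ∃ C : ℝ, 0 ≤ C ∧ ∀ x ∈ E.carrier,
    ∫⁻ u, ‖x u‖ₑ ∂lebesgue01 ≤ ENNReal.ofReal (C * E.qnorm x) := by
  obtain ⟨K, hK1, hK⟩ := E.exists_const
  by_contra! hcon
  have hK0 : 0 < K := by linarith
  choose x hx hlt using fun j : ℕ => hcon ((4 * K) ^ j) (by positivity)
  have hpos : ∀ j, 0 < E.qnorm (x j) := by
    intro j
    refine lt_of_le_of_ne (E.qnorm_nonneg _ (hx j)) fun h => ?_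
    have h0 := (E.qnorm_eq_zero _ (hx j)).1 h.symm
    have h1 := hlt j
    rw [h0, lintegral_congr_ae (g := fun _ => 0)] at h1
    · simp at h1
    · filter_upwards [AEEqFun.coeFn_zero (β := ℝ) (μ := lebesgue01)] with t ht
      rw [ht]; simp
  set a : ℕ → ℝ := fun j => ((2 * K)⁻¹) ^ j / E.qnorm (x j) with ha
  have ha0 : ∀ j, 0 ≤ a j := fun j => div_nonneg (by positivity) (hpos j).le
  have hy : ∀ j, a j • |x j| ∈ E.carrier := fun j => E.carrier.smul_mem _ (abs_mem (hx j)).1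
  have hyt : ∀ j, ∀ᵐ t ∂lebesgue01, (a j • |x j| : S01) t = a j * |x j t| := by
    intro j
    filter_upwards [AEEqFun.coeFn_smul (a j) |x j|, AEEqFun.coeFn_abs (x j)] with t h1 h2
    rw [h1, Pi.smul_apply, h2, smul_eq_mul]
  have hy0 : ∀ j, ∀ᵐ t ∂lebesgue01, 0 ≤ (a j • |x j| : S01) t := by
    intro j
    filter_upwards [hyt j] with t ht
    rw [ht]
    exact mul_nonneg (ha0 j) (abs_nonneg _)
  obtain ⟨Y, hY, -, hdom⟩ := exists_dominating_sum (y := fun j => a j • |x j|) hK1 hK hy hy0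
    zero_le_one (fun j => by
      rw [E.qnorm_smul _ _ (abs_mem (hx j)).1, (abs_mem (hx j)).2, abs_of_nonneg (ha0 j), ha,
        one_mul]
      simp only
      rw [div_mul_cancel₀ _ (hpos j).ne'])
  have hbig : ∀ j : ℕ, ENNReal.ofReal (2 ^ j) ≤ ∫⁻ u, ‖Y u‖ₑ ∂lebesgue01 := by
    intro j
    calc ENNReal.ofReal (2 ^ j) = ENNReal.ofReal (a j * ((4 * K) ^ j * E.qnorm (x j))) := by
          congr 1
          rw [ha]
          simp only
          have h4 : (2 * K)⁻¹ ^ j * (4 * K) ^ j = 2 ^ j := by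
            rw [← mul_pow]
            congr 1
            field_simp
            norm_num
          rw [← h4]
          have := (hpos j).ne'
          field_simp
      _ = ENNReal.ofReal (a j) * ENNReal.ofReal ((4 * K) ^ j * E.qnorm (x j)) :=
          ENNReal.ofReal_mul (ha0 j)
      _ ≤ ENNReal.ofReal (a j) * ∫⁻ u, ‖x j u‖ₑ ∂lebesgue01 := by
          gcongr
          exact (hlt j).le
      _ = ∫⁻ u, ENNReal.ofReal (a j) * ‖x j u‖ₑ ∂lebesgue01 :=
          (lintegral_const_mul' _ _ ENNReal.ofReal_ne_top).symm
      _ ≤ _ := by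
          refine lintegral_mono_ae ?_
          have hall : ∀ᵐ t ∂lebesgue01, ∀ j, 0 ≤ (a j • |x j| : S01) t := ae_all_iff.2 hy0
          filter_upwards [hyt j, hall, hdom (j + 1)] with t h1 h2 h3
          rw [Real.enorm_eq_ofReal_abs, ← ENNReal.ofReal_mul (ha0 j), ← h1,
            Real.enorm_eq_ofReal_abs]
          refine ENNReal.ofReal_le_ofReal (le_trans ?_ (le_abs_self _))
          refine le_trans ?_ h3
          exact Finset.single_le_sum (f := fun j => (a j • |x j| : S01) t) (fun i _ => h2 i)
            (Finset.self_mem_range_succ j)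
  have hfin : ∫⁻ u, ‖Y u‖ₑ ∂lebesgue01 < ∞ := (hE Y hY).2
  obtain ⟨n, hn⟩ := pow_unbounded_of_one_lt (∫⁻ u, ‖Y u‖ₑ ∂lebesgue01).toReal one_lt_two
  have h1 := ENNReal.toReal_mono hfin.ne (hbig n)
  rw [ENNReal.toReal_ofReal (by positivity)] at h1
  linarith

/-- A nonzero element of `E` exceeds some `c > 0` in absolute value on a set of positive measure
`a`. Divided by `c`, its rearrangement dominates that of every function bounded by 1 with support of
measure at most `a`. -/
theorem exists_indS_mem (hE0 : E.carrier ≠ ⊥) : ∃ a : ℝ, 0 < a ∧ ∀ x : S01,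
    (∀ᵐ u ∂lebesgue01, |x u| ≤ 1) → lebesgue01 {u | x u ≠ 0} ≤ ENNReal.ofReal a →
    x ∈ E.carrier := by
  obtain ⟨x, hx, hx0⟩ := (Submodule.ne_bot_iff _).1 hE0
  have h1 : ∃ n : ℕ, dist01 x (1 / ((n : ℝ) + 1)) ≠ 0 := by
    by_contra! hcon
    refine hx0 (AEEqFun.ext ?_)
    have hall : ∀ᵐ u ∂lebesgue01, ∀ n : ℕ, ¬ (1 / ((n : ℝ) + 1) < |x u|) :=
      ae_all_iff.2 fun n => by
        rw [ae_iff]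
        simpa [dist01] using hcon n
    filter_upwards [hall, AEEqFun.coeFn_zero (β := ℝ) (μ := lebesgue01)] with u hu h0
    rw [h0]
    by_contra hne
    obtain ⟨n, hn⟩ := exists_nat_one_div_lt (abs_pos.2 hne)
    exact hu n hn
  obtain ⟨n, hn⟩ := h1
  set c : ℝ := 1 / ((n : ℝ) + 1) with hc
  have hc0 : 0 < c := by positivity
  have hfin : dist01 x c ≠ ∞ := ne_top_of_le_ne_top ENNReal.one_ne_top (dist01_le_one _ _)
  refine ⟨(dist01 x c).toReal, ENNReal.toReal_pos hn hfin, fun y hy1 hy2 => ?_⟩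
  refine (mem_of_rearr_le (E.carrier.smul_mem c⁻¹ hx)
    (rearr_le_of_support hy1 hy2 fun r hr0 hr1 => ?_)).1
  rw [ENNReal.ofReal_toReal hfin, dist01_congr (AEEqFun.coeFn_smul c⁻¹ x)]
  refine measure_mono fun u hu => ?_
  have hu' : c < |x u| := hu
  change r < |c⁻¹ * x u|
  rw [abs_mul, abs_of_pos (inv_pos.2 hc0)]
  calc r < 1 := hr1
    _ = c⁻¹ * c := (inv_mul_cancel₀ hc0.ne').symm
    _ ≤ _ := by gcongr

/-- Finitely many intervals of the length `a` given by `exists_indS_mem` cover (0,1). -/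
theorem mem_of_bounded (hE0 : E.carrier ≠ ⊥) {x : S01} {C : ℝ}
    (hx : ∀ᵐ u ∂lebesgue01, |x u| ≤ C) : x ∈ E.carrier := by
  obtain ⟨a, ha, hmem⟩ := exists_indS_mem hE0
  have hstep : ∀ n : ℕ, indS (Ico 0 (n * a)) measurableSet_Ico ∈ E.carrier := by
    intro n
    induction n with
    | zero =>
      refine hmem _ ?_ ?_
      · filter_upwards [coeFn_indS (Ico 0 ((0 : ℕ) * a)) measurableSet_Ico] with u hu
        rw [hu]; simp
      · rw [measure_congr (t := ∅)]
        · simp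
        · filter_upwards [coeFn_indS (Ico 0 ((0 : ℕ) * a)) measurableSet_Ico] with u hu
          apply propext
          change _ ≠ _ ↔ False
          rw [hu]; simp
    | succ n ih =>
      have h1 : indS (Ico (n * a) ((n + 1) * a)) measurableSet_Ico ∈ E.carrier := by
        refine hmem _ ?_ ?_
        · filter_upwards [coeFn_indS (Ico (n * a) ((n + 1) * a)) measurableSet_Ico] with u hu
          rw [hu, indicator_apply]
          split_ifs <;> simp
        · calc _ = lebesgue01 (Ico (n * a) ((n + 1) * a)) := by
                refine measure_congr ?_
                filter_upwards [coeFn_indS (Ico (n * a) ((n + 1) * a)) measurableSet_Ico] with u hu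
                apply propext
                change _ ≠ _ ↔ u ∈ Ico (n * a) ((n + 1) * a)
                rw [hu]; simp [indicator_apply]
            _ ≤ volume (Ico (n * a) ((n + 1) * a)) := Measure.restrict_apply_le _ _
            _ = _ := by rw [Real.volume_Ico]; congr 1; ring
      refine (solid_ae (E.carrier.add_mem ih h1) ?_).1
      filter_upwards [coeFn_indS (Ico (n * a) ((n + 1) * a)) measurableSet_Ico,
        coeFn_indS (Ico 0 (n * a)) measurableSet_Ico,
        coeFn_indS (Ico 0 ((n + 1 : ℕ) * a)) measurableSet_Ico,
        AEEqFun.coeFn_add (indS (Ico 0 (n * a)) measurableSet_Ico)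
          (indS (Ico (n * a) ((n + 1) * a)) measurableSet_Ico)] with u h1 h2 h3 h4
      rw [h4, Pi.add_apply, h1, h2, h3]
      simp only [indicator_apply, mem_Ico, Pi.one_apply, Nat.cast_add, Nat.cast_one]
      by_cases hA : 0 ≤ u ∧ u < (n + 1) * a
      · rcases lt_or_ge u (n * a) with h | h
        · simp [hA, h, not_le.2 h]
        · simp [hA, h, not_lt.2 h]
      · simp [hA, abs_nonneg]
  obtain ⟨n, hn⟩ := exists_nat_gt (1 / a)
  refine (solid_ae (E.carrier.smul_mem C (hstep n)) ?_).1
  filter_upwards [hx, AEEqFun.coeFn_smul C (indS (Ico 0 (n * a)) measurableSet_Ico),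
    coeFn_indS (Ico 0 (n * a)) measurableSet_Ico, ae_mem_Ioo] with u h1 h2 h3 h4
  rw [h2, Pi.smul_apply, h3, indicator_of_mem]
  · simpa using h1.trans (le_abs_self C)
  · exact ⟨h4.1.le, h4.2.trans ((div_lt_iff₀ ha).1 hn)⟩

/-- The only use of separability. Among the uncountably many indicators of [0,s), two must share an
approximant from the countable dense set, so the indicator of some [s,t) is small. Its rearrangement
dominates that of any function bounded by 1 and supported on measure at most t − s. -/
theorem exists_qnorm_lt_of_support (hE0 : E.carrier ≠ ⊥) (hsep : E.IsSeparable) {ε : ℝ}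
    (hε : 0 < ε) : ∃ δ : ℝ, 0 < δ ∧ ∀ x : S01, (∀ᵐ u ∂lebesgue01, |x u| ≤ 1) →
      lebesgue01 {u | x u ≠ 0} ≤ ENNReal.ofReal δ → E.qnorm x < ε := by
  obtain ⟨K, hK1, hK⟩ := E.exists_const
  obtain ⟨D, hD, hDE, hdense⟩ := hsep
  have hK0 : 0 < K := by linarith
  set f : ℝ → S01 := fun s => indS (Ico 0 s) measurableSet_Ico with hf
  have hfE : ∀ s, f s ∈ E.carrier := fun s => mem_of_bounded hE0 (C := 1) (by
    filter_upwards [coeFn_indS (Ico 0 s) measurableSet_Ico] with u hu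
    rw [hf]
    simp only
    rw [hu, indicator_apply]
    split_ifs <;> simp)
  choose d hdD hd using fun s => hdense (f s) (hfE s) (ε / (2 * K)) (by positivity)
  have hninj : ¬ InjOn d (Ioo 0 1) := by
    intro hinj
    have hc : (Ioo (0 : ℝ) 1).Countable :=
      MapsTo.countable_of_injOn (fun s _ => hdD s) hinj hD
    have := hc.measure_zero volume
    simp at this
  have hst : ∃ s ∈ Ioo (0 : ℝ) 1, ∃ t ∈ Ioo (0 : ℝ) 1, s < t ∧ d s = d t := by
    simp only [InjOn, not_forall] at hninj
    obtain ⟨s, hs, t, ht, hst, hne⟩ := hninj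
    rcases lt_or_gt_of_ne hne with h | h
    · exact ⟨s, hs, t, ht, h, hst⟩
    · exact ⟨t, ht, s, hs, h, hst.symm⟩
  obtain ⟨s, hs, t, ht, hlt, heq⟩ := hst
  refine ⟨t - s, by linarith, fun x hx1 hx2 => ?_⟩
  have h1 : E.qnorm (f t - f s) < ε := by
    have h2 : f t - f s = (f t - d t) + (d s - f s) := by rw [heq]; abel
    have h3 := hd s
    rw [qnorm_sub_comm (hfE s) (hDE (hdD s))] at h3
    rw [h2]
    calc _ ≤ K * (E.qnorm (f t - d t) + E.qnorm (d s - f s)) :=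
          hK _ (E.carrier.sub_mem (hfE t) (hDE (hdD t))) _ (E.carrier.sub_mem (hDE (hdD s)) (hfE s))
      _ < K * (ε / (2 * K) + ε / (2 * K)) := by
          gcongr
          exact hd t
      _ = ε := by field_simp; norm_num
  refine lt_of_le_of_lt (mem_of_rearr_le (E.carrier.sub_mem (hfE t) (hfE s))
    (rearr_le_of_support hx1 hx2 fun r hr0 hr1 => ?_)).2 h1
  rw [← lebesgue01_Ico hs.1 ht.2]
  refine measure_mono_ae ?_
  filter_upwards [AEEqFun.coeFn_sub (f t) (f s), coeFn_indS (Ico 0 s) measurableSet_Ico,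
    coeFn_indS (Ico 0 t) measurableSet_Ico] with u h1 h2 h3 hu
  change r < |(f t - f s : S01) u|
  have hu' : u ∈ Ico s t := hu
  rw [h1, Pi.sub_apply, hf]
  simp only
  rw [h2, h3, indicator_of_mem (show u ∈ Ico 0 t from ⟨hs.1.le.trans hu'.1, hu'.2⟩),
    indicator_of_notMem (show u ∉ Ico 0 s from fun h => absurd h.2 (not_lt.2 hu'.1))]
  simpa using hr1

end SymmQuasiBanach

/-! ### Convergence in measure and its compatibility with domination. -/

/-- Convergence in measure of a sequence in `S(0,1)`, in terms of distribution functions. -/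
def ConvInMeasure (u : ℕ → S01) (x : S01) : Prop :=
  ∀ ε > 0, ∃ N, ∀ i ≥ N, dist01 (u i - x : S01) ε ≤ ENNReal.ofReal ε

theorem dist01_add_le (x y : S01) (a b : ℝ) :
    dist01 (x + y : S01) (a + b) ≤ dist01 x a + dist01 y b := by
  rw [dist01_congr (AEEqFun.coeFn_add x y)]
  refine le_trans (measure_mono ?_) (measure_union_le _ _)
  intro u hu
  by_contra hcon
  simp only [mem_union, not_or] at hcon
  have h1 : |x u| ≤ a := not_lt.1 hcon.1
  have h2 : |y u| ≤ b := not_lt.1 hcon.2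
  have h3 : a + b < |x u + y u| := hu
  linarith [abs_add_le (x u) (y u)]

theorem dist01_neg (x : S01) (a : ℝ) : dist01 (-x : S01) a = dist01 x a := by
  rw [dist01_congr (AEEqFun.coeFn_neg x), dist01, dist01]
  simp

theorem convInMeasure_of_tendsto_ae {u : ℕ → S01} {x : S01}
    (h : ∀ᵐ t ∂lebesgue01, Tendsto (fun n => u n t) atTop (𝓝 (x t))) : ConvInMeasure u x := by
  have h1 := tendstoInMeasure_of_tendsto_ae (fun n => (u n).aestronglyMeasurable) h
  rw [tendstoInMeasure_iff_norm] at h1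
  intro ε hε
  have h2 := (h1 ε hε).eventually_le_const (ENNReal.ofReal_pos.2 hε)
  obtain ⟨N, hN⟩ := eventually_atTop.1 h2
  refine ⟨N, fun i hi => le_trans ?_ (hN i hi)⟩
  rw [dist01_congr (AEEqFun.coeFn_sub (u i) x)]
  exact measure_mono fun t ht => le_of_lt (show ε < |u i t - x t| from ht)

/-- By Borel–Cantelli a subsequence with increments of size 2^(-k) outside sets of measure 2^(-k)
converges almost everywhere; the Cauchy property then carries the whole sequence along. -/
theorem exists_convInMeasure {u : ℕ → S01}
    (h : ∀ ε > 0, ∃ N, ∀ i ≥ N, ∀ j ≥ N, dist01 (u i - u j : S01) ε ≤ ENNReal.ofReal ε) :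
    ∃ x, ConvInMeasure u x := by
  obtain ⟨φ, hφ, hφu⟩ := extraction_forall_of_eventually
    (P := fun k m => ∀ i ≥ m, ∀ j ≥ m,
      dist01 (u i - u j : S01) ((1 / 2 : ℝ) ^ k) ≤ ENNReal.ofReal ((1 / 2 : ℝ) ^ k)) (by
    intro k
    obtain ⟨N, hN⟩ := h ((1 / 2 : ℝ) ^ k) (by positivity)
    filter_upwards [eventually_ge_atTop N] with m hm i hi j hj
    exact hN i (hm.trans hi) j (hm.trans hj))
  have hsum : ∑' k, dist01 (u (φ (k + 1)) - u (φ k) : S01) ((1 / 2 : ℝ) ^ k) ≠ ∞ := by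
    refine ne_top_of_le_ne_top ?_ (ENNReal.tsum_le_tsum fun k =>
      hφu k (φ (k + 1)) (hφ.monotone (Nat.le_succ k)) (φ k) le_rfl)
    exact summable_geometric_two.tsum_ofReal_ne_top
  have hconv : ∀ᵐ t ∂lebesgue01, ∃ l, Tendsto (fun k => u (φ k) t) atTop (𝓝 l) := by
    have hall : ∀ᵐ t ∂lebesgue01, ∀ k,
        (u (φ (k + 1)) - u (φ k) : S01) t = u (φ (k + 1)) t - u (φ k) t :=
      ae_all_iff.2 fun k => AEEqFun.coeFn_sub _ _
    filter_upwards [ae_eventually_notMem hsum, hall] with t ht h1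
    refine cauchySeq_tendsto_of_complete (cauchySeq_of_summable_dist ?_)
    refine Summable.of_norm_bounded_eventually_nat summable_geometric_two ?_
    filter_upwards [ht] with k hk
    have hk' : |(u (φ (k + 1)) - u (φ k) : S01) t| ≤ (1 / 2 : ℝ) ^ k := not_lt.1 hk
    rw [h1] at hk'
    rwa [Real.norm_of_nonneg dist_nonneg, dist_comm, Real.dist_eq]
  obtain ⟨f, hf, hlim⟩ := exists_stronglyMeasurable_limit_of_tendsto_ae
    (fun k => (u (φ k)).aestronglyMeasurable) hconv
  set x : S01 := AEEqFun.mk f hf.aestronglyMeasurable with hx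
  have hx' : x =ᵐ[lebesgue01] f := AEEqFun.coeFn_mk _ _
  have hsub : ConvInMeasure (fun k => u (φ k)) x := by
    refine convInMeasure_of_tendsto_ae ?_
    filter_upwards [hlim, hx'] with t h1 h2
    rwa [h2]
  refine ⟨x, fun ε hε => ?_⟩
  obtain ⟨N₁, hN₁⟩ := h (ε / 2) (by positivity)
  obtain ⟨N₂, hN₂⟩ := hsub (ε / 2) (by positivity)
  refine ⟨N₁, fun i hi => ?_⟩
  have hk1 : N₁ ≤ φ (max N₁ N₂) := (le_max_left _ _).trans (hφ.le_apply)
  have h1 : u i - x = (u i - u (φ (max N₁ N₂))) + (u (φ (max N₁ N₂)) - x) := by abel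
  calc dist01 (u i - x : S01) ε
      = dist01 ((u i - u (φ (max N₁ N₂))) + (u (φ (max N₁ N₂)) - x) : S01) (ε / 2 + ε / 2) := by
        rw [← h1, add_halves]
    _ ≤ ENNReal.ofReal (ε / 2) + ENNReal.ofReal (ε / 2) :=
        (dist01_add_le _ _ _ _).trans
          (add_le_add (hN₁ i hi _ hk1) (hN₂ _ (le_max_right _ _)))
    _ = ENNReal.ofReal ε := by
        rw [← ENNReal.ofReal_add (by positivity) (by positivity), add_halves]

/-- Write `x` as `u N` minus an error of arbitrarily small rearrangement at `t / 2`; evaluating `u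
N` at `t / 2` too costs the factor 2. -/
theorem KerDominated.of_convInMeasure {u : ℕ → S01} {x y : S01} (hu : ConvInMeasure u x)
    (h : ∀ i, KerDominated (u i) y) : KerDominated x ((2 : ℝ) • y) := by
  intro t ht
  rw [calInt_congr (AEEqFun.coeFn_smul (2 : ℝ) y)]
  change _ ≤ calInt (fun s => 2 * y s) t
  rw [calInt_const_mul, show ENNReal.ofReal |(2 : ℝ)| = 2 by simp]
  refine ENNReal.le_of_forall_pos_le_add fun ε hε _ => ?_
  have hδ : 0 < min (ε : ℝ) (t / 2) := lt_min (by exact_mod_cast hε) (by linarith [ht.1])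
  obtain ⟨N, hN⟩ := hu _ hδ
  have h1 : x = u N + -(u N - x) := by abel
  have h2 : rearr (-(u N - x)) (t / 2) ≤ ε := by
    refine decRearr_le ε.2 ?_
    rw [dist01_neg]
    calc _ ≤ dist01 (u N - x : S01) (min (ε : ℝ) (t / 2)) := dist01_anti _ (min_le_left _ _)
      _ ≤ _ := hN N le_rfl
      _ ≤ _ := ENNReal.ofReal_le_ofReal (min_le_right _ _)
  have h3 := rearr_add_le (u N) (-(u N - x)) (half_pos ht.1) (half_pos ht.1)
  rw [← h1, add_halves] at h3
  calc ENNReal.ofReal (rearr x t)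
      ≤ ENNReal.ofReal (rearr (u N) (t / 2) + ε) := ENNReal.ofReal_le_ofReal (by linarith)
    _ = ENNReal.ofReal (rearr (u N) (t / 2)) + ε := by
        rw [ENNReal.ofReal_add (rearr_nonneg _ _) ε.coe_nonneg, ENNReal.ofReal_coe_nnreal]
    _ ≤ 2 * calInt y t + ε := by
        gcongr
        exact (h N _ ⟨half_pos ht.1, by linarith [ht.1, ht.2]⟩).trans (calInt_half_le ht.1)

theorem KerDominated.of_rearr_le {x y z : S01} (h : KerDominated x y)
    (hz : ∀ t ∈ Ioo (0 : ℝ) 1, rearr z t ≤ rearr x t) : KerDominated z y :=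
  fun t ht => (ENNReal.ofReal_le_ofReal (hz t ht)).trans (h t ht)

theorem kerDominated_zero : KerDominated 0 0 := by
  simpa using (kerDominated_rearrS 0).smul 0

theorem eq_zero_of_rearr_le {x : S01} (h : ∀ t ∈ Ioo (0 : ℝ) 1, rearr x t ≤ 0) : x = 0 := by
  have h0 : dist01 x 0 ≤ 0 := by
    refine ENNReal.le_of_forall_pos_le_add fun ε hε _ => ?_
    have hδ : (0 : ℝ) < min (ε : ℝ) (1 / 2) := lt_min (by exact_mod_cast hε) (by norm_num)
    have h1 := (decRearr_le_iff x.aemeasurable hδ le_rfl).1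
      (h _ ⟨hδ, (min_le_right _ _).trans_lt (by norm_num)⟩)
    rw [zero_add, ← ENNReal.ofReal_coe_nnreal]
    exact h1.trans (ENNReal.ofReal_le_ofReal (min_le_left _ _))
  refine AEEqFun.ext ?_
  have h1 : ∀ᵐ u ∂lebesgue01, ¬ (0 < |x u|) := by
    rw [ae_iff]
    simpa [dist01] using h0
  filter_upwards [h1, AEEqFun.coeFn_zero (β := ℝ) (μ := lebesgue01)] with u h2 h3
  rw [h3]
  simpa using h2

/-! ### The space 𝒮_E is a symmetric quasi-Banach function space. -/

namespace SymmQuasiBanach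

variable {E : SymmQuasiBanach}

theorem rearr_le_of_kerDominated {C : ℝ} (hC : ∀ x ∈ E.carrier,
    ∫⁻ u, ‖x u‖ₑ ∂lebesgue01 ≤ ENNReal.ofReal (C * E.qnorm x)) (hC0 : 0 ≤ C) {x y : S01}
    (hy : y ∈ E.carrier) (h : KerDominated x y) {t : ℝ} (ht : t ∈ Ioo (0 : ℝ) 1) :
    rearr x t ≤ t⁻¹ * (C * E.qnorm y) := by
  have ht0 : 0 ≤ t⁻¹ := inv_nonneg.2 ht.1.le
  rw [← ENNReal.ofReal_le_ofReal_iff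
    (mul_nonneg ht0 (mul_nonneg hC0 (E.qnorm_nonneg y hy))), ENNReal.ofReal_mul ht0]
  exact (h t ht).trans ((calInt_le_lintegral ht.1).trans (by gcongr; exact hC y hy))

/-- The weak L₁ condition is automatic: the kernel is at most 1/t and `E` embeds boundedly in L₁. -/
theorem mem_calderonRange_iff (hE : E.SubsetL1) {x : S01} :
    x ∈ calderonRange E ↔ ∃ y ∈ E.carrier, KerDominated x y := by
  constructor
  · rintro ⟨-, y, hy, hxy⟩
    exact ⟨rearrS y, (rearrS_mem hy).1, (calderonDominated_iff (hE y hy)).1 hxy⟩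
  · rintro ⟨y, hy, hxy⟩
    refine ⟨?_, y, hy, hxy.calderonDominated (hE y hy)⟩
    obtain ⟨C, hC0, hC⟩ := exists_lintegral_le hE
    refine ⟨C * E.qnorm y, fun t ht => ?_⟩
    calc t * rearr x t ≤ t * (t⁻¹ * (C * E.qnorm y)) := by
          have := ht.1.le
          gcongr
          exact rearr_le_of_kerDominated hC hC0 hy hxy ht
      _ = _ := by rw [← mul_assoc, mul_inv_cancel₀ ht.1.ne', one_mul]

theorem calderonNorm_nonneg (x : S01) : 0 ≤ calderonNorm E x := by
  refine Real.sInf_nonneg ?_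
  rintro r ⟨y, hy, -, rfl⟩
  exact E.qnorm_nonneg y hy

theorem calderonNorm_le (hE : E.SubsetL1) {x y : S01} (hy : y ∈ E.carrier)
    (h : KerDominated x y) : calderonNorm E x ≤ E.qnorm y := by
  refine csInf_le ⟨0, ?_⟩ ⟨y, hy, h.calderonDominated (hE y hy), rfl⟩
  rintro r ⟨y, hy, -, rfl⟩
  exact E.qnorm_nonneg y hy

/-- A near-optimal dominating function may be taken rearranged, hence nonnegative, at no cost in
norm. -/
theorem exists_of_calderonNorm_lt (hE : E.SubsetL1) {x : S01} (hx : x ∈ calderonRange E) {r : ℝ}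
    (hr : calderonNorm E x < r) : ∃ y ∈ E.carrier, KerDominated x y ∧ E.qnorm y < r ∧
      ∀ᵐ t ∂lebesgue01, 0 ≤ y t := by
  obtain ⟨-, y₀, hy₀, hxy₀⟩ := hx
  obtain ⟨s, ⟨y, hy, hxy, rfl⟩, hs⟩ := exists_lt_of_csInf_lt
    (s := {r : ℝ | ∃ y ∈ E.carrier, CalderonDominated x y ∧ r = E.qnorm y})
    ⟨_, y₀, hy₀, hxy₀, rfl⟩ hr
  exact ⟨rearrS y, (rearrS_mem hy).1, (calderonDominated_iff (hE y hy)).1 hxy,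
    (rearrS_mem hy).2.trans_lt hs, rearrS_nonneg y⟩

theorem add_abs_mem {K : ℝ} (hK : ∀ x ∈ E.carrier, ∀ y ∈ E.carrier,
    E.qnorm (x + y) ≤ K * (E.qnorm x + E.qnorm y)) {x y : S01} (hx : x ∈ E.carrier)
    (hy : y ∈ E.carrier) : (2 : ℝ) • (|x| + |y|) ∈ E.carrier ∧
      E.qnorm ((2 : ℝ) • (|x| + |y|)) ≤ 2 * K * (E.qnorm x + E.qnorm y) := by
  have h1 := abs_mem hx
  have h2 := abs_mem hy
  have h3 := E.carrier.add_mem h1.1 h2.1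
  refine ⟨E.carrier.smul_mem _ h3, ?_⟩
  rw [E.qnorm_smul _ _ h3, abs_of_pos two_pos, mul_assoc, ← h1.2, ← h2.2]
  gcongr
  exact hK _ h1.1 _ h2.1

theorem add_mem_calderonRange (hE : E.SubsetL1) {x y : S01} (hx : x ∈ calderonRange E)
    (hy : y ∈ calderonRange E) : x + y ∈ calderonRange E := by
  rw [mem_calderonRange_iff hE] at hx hy ⊢
  obtain ⟨K, -, hK⟩ := E.exists_const
  obtain ⟨x', hx', hxx'⟩ := hx
  obtain ⟨y', hy', hyy'⟩ := hy
  exact ⟨_, (add_abs_mem hK hx' hy').1, hxx'.add hyy'⟩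

theorem calderonNorm_add_le (hE : E.SubsetL1) {K : ℝ} (hK1 : 1 ≤ K)
    (hK : ∀ x ∈ E.carrier, ∀ y ∈ E.carrier, E.qnorm (x + y) ≤ K * (E.qnorm x + E.qnorm y))
    {x y : S01} (hx : x ∈ calderonRange E) (hy : y ∈ calderonRange E) :
    calderonNorm E (x + y) ≤ 2 * K * (calderonNorm E x + calderonNorm E y) := by
  have hK0 : 0 < K := by linarith
  refine le_of_forall_pos_le_add fun ε hε => ?_
  obtain ⟨x', hx', hxx', hxlt, -⟩ := exists_of_calderonNorm_lt hE hx
    (lt_add_of_pos_right _ (show 0 < ε / (4 * K) by positivity))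
  obtain ⟨y', hy', hyy', hylt, -⟩ := exists_of_calderonNorm_lt hE hy
    (lt_add_of_pos_right _ (show 0 < ε / (4 * K) by positivity))
  have h := add_abs_mem hK hx' hy'
  calc calderonNorm E (x + y) ≤ _ := calderonNorm_le hE h.1 (hxx'.add hyy')
    _ ≤ _ := h.2
    _ ≤ 2 * K * ((calderonNorm E x + ε / (4 * K)) + (calderonNorm E y + ε / (4 * K))) := by gcongr
    _ = _ := by field_simp; ring

theorem smul_mem_calderonRange (hE : E.SubsetL1) {x : S01} (hx : x ∈ calderonRange E) (c : ℝ) :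
    c • x ∈ calderonRange E := by
  rw [mem_calderonRange_iff hE] at hx ⊢
  obtain ⟨x', hx', hxx'⟩ := hx
  exact ⟨_, E.carrier.smul_mem c hx', hxx'.smul c⟩

theorem calderonNorm_smul_le (hE : E.SubsetL1) {x : S01} (hx : x ∈ calderonRange E) (c : ℝ) :
    calderonNorm E (c • x) ≤ |c| * calderonNorm E x := by
  have h : ∀ r > calderonNorm E x, calderonNorm E (c • x) ≤ |c| * r := by
    intro r hr
    obtain ⟨x', hx', hxx', hxlt, -⟩ := exists_of_calderonNorm_lt hE hx hr
    refine (calderonNorm_le hE (E.carrier.smul_mem c hx') (hxx'.smul c)).trans ?_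
    rw [E.qnorm_smul _ _ hx']
    gcongr
  have hlim : Tendsto (fun r => |c| * r) (𝓝[>] calderonNorm E x) (𝓝 (|c| * calderonNorm E x)) :=
    ((continuous_const.mul continuous_id).tendsto _).mono_left nhdsWithin_le_nhds
  exact ge_of_tendsto hlim (eventually_mem_nhdsWithin.mono h)

theorem zero_mem_calderonRange (hE : E.SubsetL1) : (0 : S01) ∈ calderonRange E :=
  (mem_calderonRange_iff hE).2 ⟨0, E.carrier.zero_mem, kerDominated_zero⟩

theorem calderonNorm_zero (hE : E.SubsetL1) : calderonNorm E 0 = 0 :=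
  le_antisymm ((calderonNorm_le hE E.carrier.zero_mem kerDominated_zero).trans_eq E.qnorm_zero)
    (calderonNorm_nonneg 0)

theorem calderonNorm_smul (hE : E.SubsetL1) {x : S01} (hx : x ∈ calderonRange E) (c : ℝ) :
    calderonNorm E (c • x) = |c| * calderonNorm E x := by
  refine le_antisymm (calderonNorm_smul_le hE hx c) ?_
  rcases eq_or_ne c 0 with rfl | hc
  · simpa using calderonNorm_nonneg _
  · have h := calderonNorm_smul_le hE (smul_mem_calderonRange hE hx c) c⁻¹
    rw [smul_smul, inv_mul_cancel₀ hc, one_smul, abs_inv] at h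
    have hc' := abs_pos.2 hc
    calc |c| * calderonNorm E x ≤ |c| * (|c|⁻¹ * calderonNorm E (c • x)) := by gcongr
      _ = _ := by rw [← mul_assoc, mul_inv_cancel₀ hc'.ne', one_mul]

/-- Bounded inclusion of 𝒮_E in weak L₁. It gives definiteness of the functional and turns Cauchy
sequences into sequences Cauchy in measure. -/
theorem rearr_le_calderonNorm (hE : E.SubsetL1) : ∃ C : ℝ, 0 ≤ C ∧ ∀ x ∈ calderonRange E,
    ∀ t ∈ Ioo (0 : ℝ) 1, rearr x t ≤ t⁻¹ * (C * calderonNorm E x) := by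
  obtain ⟨C, hC0, hC⟩ := exists_lintegral_le hE
  refine ⟨C, hC0, fun x hx t ht => ?_⟩
  have hlim : Tendsto (fun r => t⁻¹ * (C * r)) (𝓝[>] calderonNorm E x)
      (𝓝 (t⁻¹ * (C * calderonNorm E x))) :=
    ((continuous_const.mul (continuous_const.mul continuous_id)).tendsto _).mono_left
      nhdsWithin_le_nhds
  refine ge_of_tendsto hlim (eventually_mem_nhdsWithin.mono fun r hr => ?_)
  obtain ⟨x', hx', hxx', hxlt, -⟩ := exists_of_calderonNorm_lt hE hx hr
  refine (rearr_le_of_kerDominated hC hC0 hx' hxx' ht).trans ?_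
  have := ht.1.le
  gcongr

theorem calderonRange_of_rearr_le (hE : E.SubsetL1) {x y : S01} (hx : x ∈ calderonRange E)
    (h : ∀ t ∈ Ioo (0 : ℝ) 1, rearr y t ≤ rearr x t) :
    y ∈ calderonRange E ∧ calderonNorm E y ≤ calderonNorm E x := by
  have hmem : y ∈ calderonRange E := by
    have hx2 := (mem_calderonRange_iff hE).1 hx
    rw [mem_calderonRange_iff hE]
    obtain ⟨x', hx', hxx'⟩ := hx2
    exact ⟨x', hx', hxx'.of_rearr_le h⟩
  refine ⟨hmem, le_of_forall_gt_imp_ge_of_dense fun r hr => ?_⟩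
  obtain ⟨x', hx', hxx', hxlt, -⟩ := exists_of_calderonNorm_lt hE hx hr
  exact (calderonNorm_le hE hx' (hxx'.of_rearr_le h)).trans hxlt.le

/-- Every use of `KerDominated.add` doubles the dominating function, so splitting off first terms
leaves the weight 2^(j+1) on the j-th one. -/
theorem kerDominated_sum {x y : ℕ → S01} (h : ∀ j, KerDominated (x j) (y j))
    (hy : ∀ j, ∀ᵐ t ∂lebesgue01, 0 ≤ y j t) (M k : ℕ) :
    KerDominated (∑ j ∈ Finset.range M, x (k + j))
      (∑ j ∈ Finset.range M, (2 : ℝ) ^ (j + 1) • y (k + j)) := by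
  induction M generalizing k with
  | zero => simpa using kerDominated_zero
  | succ M ih =>
    have h1 : ∑ j ∈ Finset.range (M + 1), x (k + j)
        = ∑ j ∈ Finset.range M, x (k + 1 + j) + x k := by
      rw [Finset.sum_range_succ']
      congr 1
      exact Finset.sum_congr rfl fun j _ => by congr 1; ring
    have h2 : ∑ j ∈ Finset.range (M + 1), (2 : ℝ) ^ (j + 1) • y (k + j)
        = (2 : ℝ) • (∑ j ∈ Finset.range M, (2 : ℝ) ^ (j + 1) • y (k + 1 + j) + y k) := by
      rw [Finset.sum_range_succ', smul_add, Finset.smul_sum]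
      congr 1
      · refine Finset.sum_congr rfl fun j _ => ?_
        rw [smul_smul, ← pow_succ', show k + (j + 1) = k + 1 + j by ring]
      · simp
    rw [h1, h2]
    refine ((ih (k + 1)).add (h k)).mono ?_
    set S := ∑ j ∈ Finset.range M, (2 : ℝ) ^ (j + 1) • y (k + 1 + j) with hS
    have hS0 : ∀ᵐ t ∂lebesgue01, 0 ≤ S t := by
      have hall : ∀ᵐ t ∂lebesgue01, ∀ j, 0 ≤ ((2 : ℝ) ^ (j + 1) • y (k + 1 + j) : S01) t := by
        refine ae_all_iff.2 fun j => ?_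
        filter_upwards [hy (k + 1 + j), AEEqFun.coeFn_smul ((2 : ℝ) ^ (j + 1)) (y (k + 1 + j))]
          with t h3 h4
        rw [h4, Pi.smul_apply, smul_eq_mul]
        positivity
      filter_upwards [hall, coeFn_sum (fun j => (2 : ℝ) ^ (j + 1) • y (k + 1 + j))
        (Finset.range M)] with t h3 h4
      rw [hS, h4]
      exact Finset.sum_nonneg fun j _ => h3 j
    filter_upwards [hS0, hy k, AEEqFun.coeFn_smul (2 : ℝ) (|S| + |y k|),
      AEEqFun.coeFn_smul (2 : ℝ) (S + y k), AEEqFun.coeFn_add |S| |y k|,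
      AEEqFun.coeFn_add S (y k), AEEqFun.coeFn_abs S, AEEqFun.coeFn_abs (y k)]
      with t a1 a2 a3 a4 a5 a6 a7 a8
    rw [a3, a4, Pi.smul_apply, Pi.smul_apply, a5, a6, Pi.add_apply, Pi.add_apply, a7, a8,
      abs_of_nonneg a1, abs_of_nonneg a2]

theorem calderonNorm_sub_comm (hE : E.SubsetL1) {x y : S01} (hx : x ∈ calderonRange E)
    (hy : y ∈ calderonRange E) : calderonNorm E (x - y) = calderonNorm E (y - x) := by
  have h1 : y - x = (-1 : ℝ) • (x - y) := by simp
  have h2 : x - y ∈ calderonRange E := by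
    have h3 : x - y = x + (-1 : ℝ) • y := by simp [sub_eq_add_neg]
    rw [h3]
    exact add_mem_calderonRange hE hx (smul_mem_calderonRange hE hy _)
  rw [h1, calderonNorm_smul hE h2]
  simp

/-- The limit is found in measure. Along a fast subsequence the increments have dominating functions
whose weighted sum lies in `E` and dominates the tails, and domination passes to the limit in
measure. -/
theorem calderonRange_complete (hE : E.SubsetL1) {u : ℕ → S01} (hu : ∀ n, u n ∈ calderonRange E)
    (hc : ∀ ε > 0, ∃ N, ∀ i ≥ N, ∀ j ≥ N, calderonNorm E (u i - u j) < ε) :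
    ∃ x ∈ calderonRange E, Tendsto (fun n => calderonNorm E (u n - x)) atTop (𝓝 0) := by
  obtain ⟨K, hK1, hK⟩ := E.exists_const
  have hK0 : 0 < K := by linarith
  obtain ⟨C, hC0, hC⟩ := rearr_le_calderonNorm hE
  have hsub : ∀ {x y : S01}, x ∈ calderonRange E → y ∈ calderonRange E →
      x - y ∈ calderonRange E := by
    intro x y hx hy
    have h3 : x - y = x + (-1 : ℝ) • y := by simp [sub_eq_add_neg]
    rw [h3]
    exact add_mem_calderonRange hE hx (smul_mem_calderonRange hE hy _)
  obtain ⟨x, hx⟩ := exists_convInMeasure (u := u) (by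
    intro ε hε
    set δ := min ε (1 / 2) with hδ
    have hδ0 : 0 < δ := lt_min hε (by norm_num)
    have hδ1 : δ ∈ Ioo (0 : ℝ) 1 := ⟨hδ0, (min_le_right _ _).trans_lt (by norm_num)⟩
    -- With this threshold the weak L₁ bound at the point `δ` makes the rearrangement at most `δ`;
    -- `C + 1` excludes division by zero.
    obtain ⟨N, hN⟩ := hc (δ * δ / (C + 1)) (by positivity)
    refine ⟨N, fun i hi j hj => ?_⟩
    have h1 : rearr (u i - u j) δ ≤ δ := by
      refine (hC _ (hsub (hu i) (hu j)) δ hδ1).trans ?_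
      calc δ⁻¹ * (C * calderonNorm E (u i - u j)) ≤ δ⁻¹ * ((C + 1) * (δ * δ / (C + 1))) := by
            gcongr
            · exact calderonNorm_nonneg _
            · linarith
            · exact (hN i hi j hj).le
        _ = δ := by field_simp
    calc dist01 (u i - u j : S01) ε ≤ dist01 (u i - u j : S01) δ :=
          dist01_anti _ (min_le_left _ _)
      _ ≤ ENNReal.ofReal δ := (decRearr_le_iff (AEEqFun.aemeasurable _) hδ0 hδ0.le).1 h1
      _ ≤ _ := ENNReal.ofReal_le_ofReal (min_le_left _ _))
  -- The ratio 1/(4K) is chosen so that the weights 2^(j+1) from `kerDominated_sum` still leave the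
  -- ratio 1/(2K) needed by `exists_dominating_sum`.
  obtain ⟨φ, hφ, hφu⟩ := extraction_forall_of_eventually
    (P := fun k m => ∀ i ≥ m, ∀ j ≥ m, calderonNorm E (u i - u j) < ((4 * K)⁻¹) ^ k) (by
    intro k
    obtain ⟨N, hN⟩ := hc (((4 * K)⁻¹) ^ k) (by positivity)
    filter_upwards [eventually_ge_atTop N] with m hm i hi j hj
    exact hN i (hm.trans hi) j (hm.trans hj))
  choose y hyE hxy hylt hy0 using fun j => exists_of_calderonNorm_lt hE
    (hsub (hu (φ (j + 1))) (hu (φ j)))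
    (hφu j (φ (j + 1)) (hφ.monotone (Nat.le_succ j)) (φ j) le_rfl)
  have hdom : ∀ k, ∃ Y ∈ E.carrier, E.qnorm Y ≤ 2 * K ^ 2 * (2 * ((4 * K)⁻¹) ^ k) ∧
      ∀ M, KerDominated (u (φ (k + M)) - u (φ k)) Y := by
    intro k
    have hz : ∀ j, (2 : ℝ) ^ (j + 1) • y (k + j) ∈ E.carrier := fun j =>
      E.carrier.smul_mem _ (hyE _)
    have hz0 : ∀ j, ∀ᵐ t ∂lebesgue01, 0 ≤ ((2 : ℝ) ^ (j + 1) • y (k + j) : S01) t := by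
      intro j
      filter_upwards [hy0 (k + j), AEEqFun.coeFn_smul ((2 : ℝ) ^ (j + 1)) (y (k + j))]
        with t h3 h4
      rw [h4, Pi.smul_apply, smul_eq_mul]
      positivity
    obtain ⟨Y, hY, hYn, hYd⟩ := exists_dominating_sum (y := fun j => (2 : ℝ) ^ (j + 1) • y (k + j))
      (c := 2 * ((4 * K)⁻¹) ^ k) hK1 hK hz hz0 (by positivity) (by
        intro j
        rw [E.qnorm_smul _ _ (hyE _), abs_of_pos (by positivity)]
        calc (2 : ℝ) ^ (j + 1) * E.qnorm (y (k + j))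
            ≤ 2 ^ (j + 1) * ((4 * K)⁻¹) ^ (k + j) := by
              gcongr
              exact (hylt _).le
          _ = 2 * ((4 * K)⁻¹) ^ k * (2 * (4 * K)⁻¹) ^ j := by
              rw [mul_pow, pow_add, pow_succ]
              ring
          _ = 2 * ((4 * K)⁻¹) ^ k * ((2 * K)⁻¹) ^ j := by
              congr 2
              field_simp
              norm_num)
    refine ⟨Y, hY, hYn, fun M => ?_⟩
    have h1 : u (φ (k + M)) - u (φ k)
        = ∑ j ∈ Finset.range M, (u (φ (k + j + 1)) - u (φ (k + j))) :=
      (Finset.sum_range_sub (fun j => u (φ (k + j))) M).symm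
    rw [h1]
    refine (kerDominated_sum hxy hy0 M k).mono ?_
    have hall := ae_all_iff.2 hz0
    filter_upwards [hall, hYd M,
      coeFn_sum (fun j => (2 : ℝ) ^ (j + 1) • y (k + j)) (Finset.range M)] with t h2 h3 h4
    rw [h4, abs_of_nonneg (Finset.sum_nonneg fun j _ => h2 j)]
    exact h3.trans (le_abs_self _)
  have htail : ∀ k, x - u (φ k) ∈ calderonRange E ∧
      calderonNorm E (x - u (φ k)) ≤ 2 * (2 * K ^ 2 * (2 * ((4 * K)⁻¹) ^ k)) := by
    intro k
    obtain ⟨Y, hY, hYn, hYd⟩ := hdom k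
    have hconv : ConvInMeasure (fun M => u (φ (k + M)) - u (φ k)) (x - u (φ k)) := by
      intro ε hε
      obtain ⟨N, hN⟩ := hx ε hε
      refine ⟨N, fun i hi => ?_⟩
      rw [sub_sub_sub_cancel_right]
      exact hN _ ((hi.trans (Nat.le_add_left i k)).trans hφ.le_apply)
    have hd := KerDominated.of_convInMeasure hconv hYd
    have hY2 := E.carrier.smul_mem (2 : ℝ) hY
    refine ⟨(mem_calderonRange_iff hE).2 ⟨_, hY2, hd⟩, (calderonNorm_le hE hY2 hd).trans ?_⟩
    rw [E.qnorm_smul _ _ hY, abs_of_pos two_pos]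
    gcongr
  have hxmem : x ∈ calderonRange E := by
    have := add_mem_calderonRange hE (htail 0).1 (hu (φ 0))
    rwa [sub_add_cancel] at this
  refine ⟨x, hxmem, ?_⟩
  rw [Metric.tendsto_atTop]
  intro ε hε
  have hlim : Tendsto (fun k : ℕ => 2 * (2 * K ^ 2 * (2 * ((4 * K)⁻¹) ^ k))) atTop (𝓝 0) := by
    have h : Tendsto (fun a : ℕ => ((4 * K)⁻¹) ^ a) atTop (𝓝 0) :=
      tendsto_pow_atTop_nhds_zero_of_lt_one (by positivity)
        (inv_lt_one_of_one_lt₀ (by linarith))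
    simpa using ((h.const_mul 2).const_mul (2 * K ^ 2)).const_mul 2
  obtain ⟨N, hN⟩ := hc (ε / (4 * K)) (by positivity)
  obtain ⟨k, hk, hkN⟩ := ((hlim.eventually_lt_const (show 0 < ε / (4 * K) by positivity)).and
    (eventually_ge_atTop N)).exists
  refine ⟨N, fun n hn => ?_⟩
  rw [Real.dist_eq, sub_zero, abs_of_nonneg (calderonNorm_nonneg _)]
  have h1 : u n - x = (u n - u (φ k)) + (u (φ k) - x) := by abel
  rw [h1]
  calc _ ≤ 2 * K * (calderonNorm E (u n - u (φ k)) + calderonNorm E (u (φ k) - x)) :=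
        calderonNorm_add_le hE hK1 hK (hsub (hu _) (hu _)) (hsub (hu _) hxmem)
    _ < 2 * K * (ε / (4 * K) + ε / (4 * K)) := by
        gcongr
        · exact hN n hn _ (hkN.trans hφ.le_apply)
        · rw [calderonNorm_sub_comm hE (hu _) hxmem]
          exact (htail k).2.trans_lt hk
    _ = ε := by field_simp; norm_num

/-- The space `𝒮_E` as a symmetric quasi-Banach function space. -/
def calderonSpace (E : SymmQuasiBanach) (hE : E.SubsetL1) : SymmQuasiBanach where
  carrier :=
    { carrier := calderonRange E
      add_mem' := add_mem_calderonRange hE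
      zero_mem' := zero_mem_calderonRange hE
      smul_mem' := fun c _ hx => smul_mem_calderonRange hE hx c }
  qnorm := calderonNorm E
  qnorm_nonneg := fun x _ => calderonNorm_nonneg x
  qnorm_eq_zero := fun x hx => by
    refine ⟨fun h => ?_, fun h => h ▸ calderonNorm_zero hE⟩
    obtain ⟨C, -, hC⟩ := rearr_le_calderonNorm hE
    refine eq_zero_of_rearr_le fun t ht => ?_
    simpa [h] using hC x hx t ht
  qnorm_smul := fun a x hx => calderonNorm_smul hE hx a
  qnorm_add := by
    obtain ⟨K, hK1, hK⟩ := E.exists_const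
    exact ⟨2 * K, fun x hx y hy => calderonNorm_add_le hE hK1 hK hx hy⟩
  complete := fun _ hu hc => calderonRange_complete hE hu hc
  solid := fun x hx y hyx => calderonRange_of_rearr_le hE hx fun _ ht =>
    decRearr_mono x.aemeasurable (ae_abs_le_of_abs_le.1 hyx) ht.1
  symmetric := fun x hx y h => by
    have h1 := calderonRange_of_rearr_le hE hx fun t ht => (h t ht).le
    exact ⟨h1.1, le_antisymm h1.2
      (calderonRange_of_rearr_le hE h1.1 fun t ht => (h t ht).ge).2⟩

end SymmQuasiBanach

/-! ### Dyadic filtration, martingale differences and the even transform. -/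

theorem dyadicSigma_le (n : ℕ) : dyadicSigma n ≤ (inferInstance : MeasurableSpace ℝ) := by
  have h : Measurable fun t : ℝ => ⌊(2 : ℝ) ^ n * t⌋ := by fun_prop
  exact h.comap_le

theorem floor_two_pow (n : ℕ) (t : ℝ) : ⌊(2 : ℝ) ^ n * t⌋ = ⌊(2 : ℝ) ^ (n + 1) * t⌋ / 2 := by
  have h := Int.floor_div_natCast ((2 : ℝ) ^ (n + 1) * t) 2
  rw [show (2 : ℝ) ^ (n + 1) * t / ((2 : ℕ) : ℝ) = 2 ^ n * t by push_cast; rw [pow_succ]; ring] at h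
  exact_mod_cast h

theorem dyadicSigma_mono : Monotone dyadicSigma := by
  refine monotone_nat_of_le_succ fun n => ?_
  have h : (fun t : ℝ => ⌊(2 : ℝ) ^ n * t⌋)
      = (fun k : ℤ => k / 2) ∘ fun t : ℝ => ⌊(2 : ℝ) ^ (n + 1) * t⌋ :=
    funext fun t => floor_two_pow n t
  rw [dyadicSigma, dyadicSigma, h, ← MeasurableSpace.comap_comp]
  exact MeasurableSpace.comap_mono le_top

/-- The dyadic filtration. -/
def dyadicFiltration : Filtration ℕ (inferInstance : MeasurableSpace ℝ) where
  seq := dyadicSigma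
  mono' := dyadicSigma_mono
  le' := dyadicSigma_le

/-- The identity is the pointwise limit of the dyadic roundings of `t`. -/
theorem measurable_iSup_dyadicSigma : (inferInstance : MeasurableSpace ℝ) ≤ ⨆ n, dyadicSigma n := by
  have hid : Measurable[⨆ n, dyadicSigma n] (fun t : ℝ => t) := by
    refine @measurable_of_tendsto_metrizable _ _ (⨆ n, dyadicSigma n) _ _ _ _
      (fun n : ℕ => fun t : ℝ => (⌊(2 : ℝ) ^ n * t⌋ : ℝ) / 2 ^ n) _ (fun n => ?_) ?_
    · have h1 : Measurable[dyadicSigma n] fun t : ℝ => ⌊(2 : ℝ) ^ n * t⌋ :=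
        comap_measurable _
      have h2 : Measurable fun k : ℤ => (k : ℝ) / 2 ^ n := measurable_from_top
      exact (h2.comp h1).mono (le_iSup _ n) le_rfl
    · rw [tendsto_pi_nhds]
      intro t
      have hp : Tendsto (fun n : ℕ => (2 : ℝ) ^ n) atTop atTop :=
        tendsto_pow_atTop_atTop_of_one_lt one_lt_two
      have hz : Tendsto (fun n : ℕ => ((2 : ℝ) ^ n)⁻¹) atTop (𝓝 0) := hp.inv_tendsto_atTop
      have hlow : Tendsto (fun n : ℕ => t - ((2 : ℝ) ^ n)⁻¹) atTop (𝓝 t) := by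
        simpa using tendsto_const_nhds.sub hz
      refine tendsto_of_tendsto_of_tendsto_of_le_of_le hlow tendsto_const_nhds ?_ ?_
      · intro n
        have h1 := Int.sub_one_lt_floor ((2 : ℝ) ^ n * t)
        have h2 : (0 : ℝ) < 2 ^ n := by positivity
        simp only
        rw [le_div_iff₀ h2, sub_mul, inv_mul_cancel₀ h2.ne']
        linarith
      · intro n
        have h1 := Int.floor_le ((2 : ℝ) ^ n * t)
        have h2 : (0 : ℝ) < 2 ^ n := by positivity
        simp only
        rw [div_le_iff₀ h2]
        linarith
  have h := hid.comap_le
  rwa [show (fun t : ℝ => t) = id from rfl, MeasurableSpace.comap_id] at h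

theorem dyadicExp_congr {f g : ℝ → ℝ} (h : f =ᵐ[lebesgue01] g) (n : ℕ) :
    dyadicExp n f =ᵐ[lebesgue01] dyadicExp n g := condExp_congr_ae h

theorem stronglyMeasurable_dyadicExp {m n : ℕ} (h : m ≤ n) (f : ℝ → ℝ) :
    StronglyMeasurable[dyadicSigma n] (dyadicExp m f) :=
  stronglyMeasurable_condExp.mono (dyadicSigma_mono h)

theorem integrable_dyadicExp (n : ℕ) (f : ℝ → ℝ) : Integrable (dyadicExp n f) lebesgue01 :=
  integrable_condExp

theorem dyadicExp_dyadicExp_of_le {m n : ℕ} (h : m ≤ n) (f : ℝ → ℝ) :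
    dyadicExp m (dyadicExp n f) =ᵐ[lebesgue01] dyadicExp m f :=
  condExp_condExp_of_le (dyadicSigma_mono h) (dyadicSigma_le n)

theorem dyadicExp_of_stronglyMeasurable {m n : ℕ} (h : m ≤ n) {f : ℝ → ℝ}
    (hf : StronglyMeasurable[dyadicSigma m] f) (hfi : Integrable f lebesgue01) :
    dyadicExp n f = f :=
  condExp_of_stronglyMeasurable (dyadicSigma_le n) (hf.mono (dyadicSigma_mono h)) hfi

theorem dyadicExp_add {f g : ℝ → ℝ} (hf : Integrable f lebesgue01) (hg : Integrable g lebesgue01)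
    (n : ℕ) : dyadicExp n (f + g) =ᵐ[lebesgue01] dyadicExp n f + dyadicExp n g :=
  condExp_add hf hg _

theorem dyadicExp_sub {f g : ℝ → ℝ} (hf : Integrable f lebesgue01) (hg : Integrable g lebesgue01)
    (n : ℕ) : dyadicExp n (f - g) =ᵐ[lebesgue01] dyadicExp n f - dyadicExp n g :=
  condExp_sub hf hg _

theorem dyadicExp_smul (c : ℝ) (f : ℝ → ℝ) (n : ℕ) :
    dyadicExp n (c • f) =ᵐ[lebesgue01] c • dyadicExp n f :=
  condExp_smul c f _

theorem dyadicDiff_congr {f g : ℝ → ℝ} (h : f =ᵐ[lebesgue01] g) (n : ℕ) :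
    dyadicDiff n f =ᵐ[lebesgue01] dyadicDiff n g := by
  cases n with
  | zero => exact dyadicExp_congr h 0
  | succ n => exact (dyadicExp_congr h (n + 1)).sub (dyadicExp_congr h n)

theorem dyadicDiff_add {f g : ℝ → ℝ} (hf : Integrable f lebesgue01) (hg : Integrable g lebesgue01)
    (n : ℕ) : dyadicDiff n (f + g) =ᵐ[lebesgue01] dyadicDiff n f + dyadicDiff n g := by
  cases n with
  | zero => exact dyadicExp_add hf hg 0
  | succ n =>
    filter_upwards [dyadicExp_add hf hg (n + 1), dyadicExp_add hf hg n] with t h1 h2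
    simp only [dyadicDiff, Pi.sub_apply, Pi.add_apply] at h1 h2 ⊢
    rw [h1, h2]; ring

theorem dyadicDiff_smul (c : ℝ) (f : ℝ → ℝ) (n : ℕ) :
    dyadicDiff n (c • f) =ᵐ[lebesgue01] c • dyadicDiff n f := by
  cases n with
  | zero => exact dyadicExp_smul c f 0
  | succ n =>
    filter_upwards [dyadicExp_smul c f (n + 1), dyadicExp_smul c f n] with t h1 h2
    simp only [dyadicDiff, Pi.sub_apply, Pi.smul_apply] at h1 h2 ⊢
    rw [h1, h2, smul_sub]

theorem stronglyMeasurable_dyadicDiff {m n : ℕ} (h : m ≤ n) (f : ℝ → ℝ) :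
    StronglyMeasurable[dyadicSigma n] (dyadicDiff m f) := by
  cases m with
  | zero => exact stronglyMeasurable_dyadicExp h f
  | succ m =>
    exact (stronglyMeasurable_dyadicExp h f).sub
      (stronglyMeasurable_dyadicExp ((Nat.le_succ m).trans h) f)

theorem dyadicExp_dyadicDiff (f : ℝ → ℝ) (n : ℕ) :
    dyadicExp n (dyadicDiff (n + 1) f) =ᵐ[lebesgue01] 0 := by
  have h0 := dyadicExp_sub (integrable_dyadicExp (n + 1) f) (integrable_dyadicExp n f) n
  filter_upwards [h0, dyadicExp_dyadicExp_of_le (Nat.le_succ n) f,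
    dyadicExp_dyadicExp_of_le (le_refl n) f] with t h1 h2 h3
  change dyadicExp n (dyadicExp (n + 1) f - dyadicExp n f) t = 0
  rw [h1, Pi.sub_apply, h2, h3, sub_self]

/-- The coefficients of the even martingale transform. -/
def evenCoeff (j : ℕ) : ℝ := if Even j then 1 else 0

theorem evenCoeff_eq (j : ℕ) : evenCoeff j = 0 ∨ evenCoeff j = 1 := by
  unfold evenCoeff; split_ifs <;> simp

/-- Partial sums of the even martingale transform, over all levels below `n`. -/
def evenSum (n : ℕ) (f : ℝ → ℝ) (t : ℝ) : ℝ :=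
  ∑ j ∈ Finset.range n, evenCoeff j * dyadicDiff j f t

theorem evenSum_two_mul (N : ℕ) (f : ℝ → ℝ) (t : ℝ) :
    evenSum (2 * N) f t = ∑ m ∈ Finset.range N, dyadicDiff (2 * m) f t := by
  induction N with
  | zero => simp [evenSum]
  | succ N ih =>
    rw [Finset.sum_range_succ, ← ih, evenSum, evenSum, show 2 * (N + 1) = 2 * N + 1 + 1 by ring,
      Finset.sum_range_succ, Finset.sum_range_succ]
    simp [evenCoeff]

theorem evenSum_congr {f g : ℝ → ℝ} (h : f =ᵐ[lebesgue01] g) (n : ℕ) :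
    evenSum n f =ᵐ[lebesgue01] evenSum n g := by
  have hall : ∀ᵐ t ∂lebesgue01, ∀ j, dyadicDiff j f t = dyadicDiff j g t :=
    ae_all_iff.2 fun j => dyadicDiff_congr h j
  filter_upwards [hall] with t ht
  simp only [evenSum, ht]

theorem evenSum_add {f g : ℝ → ℝ} (hf : Integrable f lebesgue01) (hg : Integrable g lebesgue01)
    (n : ℕ) : evenSum n (f + g) =ᵐ[lebesgue01] evenSum n f + evenSum n g := by
  have hall : ∀ᵐ t ∂lebesgue01, ∀ j, dyadicDiff j (f + g) t = dyadicDiff j f t + dyadicDiff j g t :=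
    ae_all_iff.2 fun j => dyadicDiff_add hf hg j
  filter_upwards [hall] with t ht
  simp only [evenSum, ht, Pi.add_apply, mul_add, Finset.sum_add_distrib]

theorem evenSum_smul (c : ℝ) (f : ℝ → ℝ) (n : ℕ) :
    evenSum n (c • f) =ᵐ[lebesgue01] c • evenSum n f := by
  have hall : ∀ᵐ t ∂lebesgue01, ∀ j, dyadicDiff j (c • f) t = c * dyadicDiff j f t :=
    ae_all_iff.2 fun j => dyadicDiff_smul c f j
  filter_upwards [hall] with t ht
  simp only [evenSum, ht, Pi.smul_apply, smul_eq_mul, Finset.mul_sum]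
  exact Finset.sum_congr rfl fun j _ => by ring

theorem evenSum_succ (n : ℕ) (f : ℝ → ℝ) :
    evenSum (n + 1) f = evenSum n f + evenCoeff n • dyadicDiff n f := by
  ext t
  simp [evenSum, Finset.sum_range_succ]

theorem evenSum_zero (f : ℝ → ℝ) : evenSum 0 f = 0 := by
  ext t; simp [evenSum]

/-- The sum up to `n + 1` involves only levels 0 to `n`; this makes it a predictable factor against
the difference of level `n + 1`. -/
theorem stronglyMeasurable_evenSum (n : ℕ) (f : ℝ → ℝ) :
    StronglyMeasurable[dyadicSigma n] (evenSum (n + 1) f) := by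
  have h : ∀ k ≤ n + 1, StronglyMeasurable[dyadicSigma n] (evenSum k f) := by
    intro k
    induction k with
    | zero => intro _; rw [evenSum_zero]; exact stronglyMeasurable_zero
    | succ k ih =>
      intro hk
      rw [evenSum_succ]
      exact (ih (by omega)).add ((stronglyMeasurable_dyadicDiff (by omega) f).const_smul _)
  exact h _ le_rfl

theorem measurable_evenSum (n : ℕ) (f : ℝ → ℝ) : Measurable (evenSum n f) := by
  cases n with
  | zero => rw [evenSum_zero]; exact measurable_zero
  | succ n => exact ((stronglyMeasurable_evenSum n f).mono (dyadicSigma_le n)).measurable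

/-- The integral of a predictable factor against a function of zero conditional expectation. -/
theorem integral_mul_eq_zero_of_dyadicExp {a d : ℝ → ℝ} {n : ℕ}
    (ha : StronglyMeasurable[dyadicSigma n] a) (hd : Integrable d lebesgue01)
    (had : Integrable (a * d) lebesgue01) (h0 : dyadicExp n d =ᵐ[lebesgue01] 0) :
    ∫ t, a t * d t ∂lebesgue01 = 0 := by
  have h1 := condExp_mul_of_stronglyMeasurable_left ha had hd
  have h2 : ∫ t, (condExp (dyadicSigma n) lebesgue01 (a * d)) t ∂lebesgue01
      = ∫ t, (a * d) t ∂lebesgue01 := integral_condExp (dyadicSigma_le n)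
  rw [show (∫ t, a t * d t ∂lebesgue01) = ∫ t, (a * d) t ∂lebesgue01 from rfl, ← h2]
  refine integral_eq_zero_of_ae ?_
  filter_upwards [h1, h0] with t h3 h4
  have h5 : (condExp (dyadicSigma n) lebesgue01 d) t = 0 := h4
  rw [h3, Pi.mul_apply, h5, mul_zero]
  rfl

/-! ### Burkholder's method and the weak type (1,1) inequality. -/

/-- A function with the zigzag concavity property decreases in mean along the pair formed by a
dyadic martingale and its even transform. -/
theorem integral_transform_le {U : ℝ → ℝ → ℝ} {A : ℝ → ℝ → ℝ → ℝ}
    (hA : ∀ e, Measurable (Function.uncurry (A e)))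
    (hU0 : U 0 0 = 0) (hA0 : ∀ e, A e 0 0 = 0)
    (hUA : ∀ x y h e, (e = 0 ∨ e = 1) → U (x + h) (y + e * h) ≤ U x y + A e x y * h)
    -- The class `P` supplies integrability: integrable functions for the weak type bound, bounded
    -- ones for the L₂ bound.
    {P : (ℝ → ℝ) → Prop} (hP0 : P 0) (hPadd : ∀ f g, P f → P g → P (f + g))
    (hPmul : ∀ f (c : ℝ), P f → P (c • f)) (hPexp : ∀ f n, P f → P (dyadicExp n f))
    (hPint : ∀ f, P f → Integrable f lebesgue01)
    (hPU : ∀ f g, P f → P g → Integrable (fun t => U (f t) (g t)) lebesgue01)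
    (hPA : ∀ e f g d, (e = 0 ∨ e = 1) → P f → P g → P d →
      Integrable (fun t => A e (f t) (g t) * d t) lebesgue01)
    {f : ℝ → ℝ} (hf : P f) (n : ℕ) :
    ∫ t, U (f t) (evenSum n f t) ∂lebesgue01 ≤ 0 := by
  have hPsub : ∀ f g, P f → P g → P (f - g) := by
    intro f g hf hg
    have h := hPadd f ((-1 : ℝ) • g) hf (hPmul g (-1) hg)
    rwa [neg_one_smul, ← sub_eq_add_neg] at h
  have hPd : ∀ n, P (dyadicDiff n f) := by
    intro n
    cases n with
    | zero => exact hPexp f 0 hf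
    | succ n => exact hPsub _ _ (hPexp f (n + 1) hf) (hPexp f n hf)
  have hPG : ∀ n, P (evenSum n f) := by
    intro n
    induction n with
    | zero => rwa [evenSum_zero]
    | succ n ih => rw [evenSum_succ]; exact hPadd _ _ ih (hPmul _ _ (hPd n))
  -- One move of the pair by (d, e·d): the first-order term integrates to zero, so the mean of `U`
  -- does not increase.
  have step : ∀ (a b d : ℝ → ℝ) (e : ℝ), (e = 0 ∨ e = 1) → P a → P b → P d →
      ∫ t, A e (a t) (b t) * d t ∂lebesgue01 = 0 →
      ∫ t, U (a t + d t) (b t + e * d t) ∂lebesgue01 ≤ ∫ t, U (a t) (b t) ∂lebesgue01 := by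
    intro a b d e he ha hb hd h0
    have h1 := hPU a b ha hb
    have h2 := hPA e a b d he ha hb hd
    have h3 := hPU (a + d) (b + e • d) (hPadd _ _ ha hd) (hPadd _ _ hb (hPmul _ _ hd))
    calc ∫ t, U (a t + d t) (b t + e * d t) ∂lebesgue01
        ≤ ∫ t, (U (a t) (b t) + A e (a t) (b t) * d t) ∂lebesgue01 :=
          integral_mono h3 (h1.add h2) fun t => hUA _ _ _ _ he
      _ = _ := by rw [integral_add h1 h2, h0, add_zero]
  have hzero : ∀ (a b d : ℝ → ℝ) (e : ℝ) (k : ℕ), (e = 0 ∨ e = 1) → P a → P b → P d →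
      StronglyMeasurable[dyadicSigma k] a → StronglyMeasurable[dyadicSigma k] b →
      dyadicExp k d =ᵐ[lebesgue01] 0 → ∫ t, A e (a t) (b t) * d t ∂lebesgue01 = 0 := by
    intro a b d e k he ha hb hd ham hbm h0
    have hm : Measurable[dyadicSigma k] fun t => A e (a t) (b t) :=
      (hA e).comp (ham.measurable.prodMk hbm.measurable)
    exact integral_mul_eq_zero_of_dyadicExp hm.stronglyMeasurable (hPint d hd)
      (hPA e a b d he ha hb hd) h0
  have main : ∀ n, ∫ t, U (dyadicExp n f t) (evenSum (n + 1) f t) ∂lebesgue01 ≤ 0 := by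
    intro n
    induction n with
    | zero =>
      have h := step 0 0 (dyadicDiff 0 f) (evenCoeff 0) (evenCoeff_eq 0) hP0 hP0 (hPd 0)
        (by simp [hA0])
      simpa [evenSum, dyadicDiff, hU0] using h
    | succ n ih =>
      have h := step (dyadicExp n f) (evenSum (n + 1) f) (dyadicDiff (n + 1) f) (evenCoeff (n + 1))
        (evenCoeff_eq _) (hPexp f n hf) (hPG _) (hPd _)
        (hzero _ _ _ _ n (evenCoeff_eq _) (hPexp f n hf) (hPG _) (hPd _)
          (stronglyMeasurable_dyadicExp le_rfl f) (stronglyMeasurable_evenSum n f)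
          (dyadicExp_dyadicDiff f n))
      refine le_trans (le_of_eq ?_) (h.trans ih)
      refine integral_congr_ae (Eventually.of_forall fun t => ?_)
      simp only [evenSum_succ (n + 1), Pi.add_apply, Pi.smul_apply, smul_eq_mul]
      congr 1
      simp [dyadicDiff]
  cases n with
  | zero =>
    have h := step 0 0 f 0 (Or.inl rfl) hP0 hP0 hf (by simp [hA0])
    simpa [evenSum_zero, hU0] using h
  | succ n =>
    -- A last move with increment f − 𝔼ₙf and `e = 0` replaces 𝔼ₙf by `f` and leaves the transform
    -- unchanged.
    have h0 : dyadicExp n (f - dyadicExp n f) =ᵐ[lebesgue01] 0 := by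
      filter_upwards [dyadicExp_sub (hPint f hf) (integrable_dyadicExp n f) n,
        dyadicExp_dyadicExp_of_le (le_refl n) f] with t h1 h2
      rw [h1, Pi.sub_apply, h2, sub_self]; rfl
    have hd := hPsub _ _ hf (hPexp f n hf)
    have h := step (dyadicExp n f) (evenSum (n + 1) f) (f - dyadicExp n f) 0 (Or.inl rfl)
      (hPexp f n hf) (hPG _) hd
      (hzero _ _ _ _ n (Or.inl rfl) (hPexp f n hf) (hPG _) hd
          (stronglyMeasurable_dyadicExp le_rfl f) (stronglyMeasurable_evenSum n f) h0)
    simpa using h.trans (main n)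

/-- Burkholder's function for the weak type inequality. -/
def burkU (x y : ℝ) : ℝ := if |x| + |y| ≤ 1 then y ^ 2 - x ^ 2 else 1 - 2 * |x|

/-- The slope of Burkholder's function along the direction `(1, e)`. -/
def burkA (e x y : ℝ) : ℝ :=
  if |x| + |y| ≤ 1 then 2 * (e * y - x) else if 0 ≤ x then -2 else 2

theorem burkU_le (x y : ℝ) : burkU x y ≤ 1 - 2 * |x| := by
  unfold burkU
  split_ifs with h
  · have h1 : y ^ 2 ≤ (1 - |x|) ^ 2 := by
      rw [← sq_abs y]
      have := abs_nonneg y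
      gcongr
      linarith
    nlinarith [sq_abs x]
  · exact le_rfl

/-- Between points of the diamond |x| + |y| ≤ 1 the error of the linear approximation is (e² − 1)h²
≤ 0. From a point outside, use the global majorant 1 − 2|x|, which is concave in `x` and equals
`burkU` there. -/
theorem burkU_step (x y h e : ℝ) (he : e = 0 ∨ e = 1) :
    burkU (x + h) (y + e * h) ≤ burkU x y + burkA e x y * h := by
  by_cases hin : |x| + |y| ≤ 1
  · have hU : burkU x y = y ^ 2 - x ^ 2 := if_pos hin
    have hA : burkA e x y = 2 * (e * y - x) := if_pos hin
    rw [hU, hA]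
    by_cases hout : |x + h| + |y + e * h| ≤ 1
    · rw [burkU, if_pos hout]
      rcases he with rfl | rfl <;> nlinarith [sq_nonneg h]
    · rw [burkU, if_neg hout]
      -- The claim after completing the square, since the linear expression equals (y + eh)² − (x +
      -- h)² + (1 − e²)h².
      have key : (1 - |x + h|) ^ 2 ≤ (y + e * h) ^ 2 + (1 - e ^ 2) * h ^ 2 := by
        by_cases h1 : |x + h| ≤ 1
        · have h2 : (1 - |x + h|) ^ 2 ≤ (y + e * h) ^ 2 := by
            rw [← sq_abs (y + e * h)]
            have : 1 - |x + h| ≤ |y + e * h| := by linarith [not_le.1 hout]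
            have h3 : 0 ≤ 1 - |x + h| := by linarith
            gcongr
          have h4 : 0 ≤ (1 - e ^ 2) * h ^ 2 := by rcases he with rfl | rfl <;> nlinarith [sq_nonneg h]
          linarith
        · have h2 : 0 ≤ |x + h| - 1 := by linarith [not_le.1 h1]
          have h3 : |x + h| - 1 ≤ |h| - |y| := by linarith [abs_add_le x h]
          have h4 : (|x + h| - 1) ^ 2 ≤ (|h| - |y|) ^ 2 := by gcongr
          have h5 : (|h| - |y|) ^ 2 ≤ (y + e * h) ^ 2 + (1 - e ^ 2) * h ^ 2 := by
            have h6 : -(|y| * |h|) ≤ y * h := by rw [← abs_mul]; exact neg_abs_le _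
            have h7 : 0 ≤ |y| * |h| := by positivity
            rcases he with rfl | rfl <;> nlinarith [sq_abs h, sq_abs y]
          nlinarith
      nlinarith [sq_abs (x + h)]
  · have hU : burkU x y = 1 - 2 * |x| := if_neg hin
    rw [hU]
    refine (burkU_le _ _).trans ?_
    rw [burkA, if_neg hin]
    split_ifs with h0
    · rw [abs_of_nonneg h0]
      linarith [le_abs_self (x + h)]
    · rw [abs_of_neg (not_le.1 h0)]
      linarith [neg_abs_le (x + h)]

/-- With nonpositive mean of `burkU`, this majorization becomes the weak type inequality at height 1
with constant 2. -/
theorem indicator_le_burkU (x y : ℝ) : (if 1 ≤ |y| then 1 else 0) ≤ burkU x y + 2 * |x| := by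
  unfold burkU
  have hx := abs_nonneg x
  have hy := abs_nonneg y
  split_ifs with h1 h2 h2
  · nlinarith [sq_abs x, sq_abs y]
  · linarith
  · nlinarith [sq_abs x, sq_abs y]
  · linarith

theorem abs_burkU_le (x y : ℝ) : |burkU x y| ≤ 1 + 2 * |x| := by
  rw [abs_le]
  have h1 := burkU_le x y
  have h2 := indicator_le_burkU x y
  have h3 := abs_nonneg x
  split_ifs at h2 <;> constructor <;> linarith

theorem abs_burkA_le (e x y : ℝ) (he : e = 0 ∨ e = 1) : |burkA e x y| ≤ 4 := by
  unfold burkA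
  split_ifs with h
  · rw [abs_le]
    rcases he with rfl | rfl <;> constructor <;>
      linarith [le_abs_self x, le_abs_self y, neg_abs_le x, neg_abs_le y, abs_nonneg x,
        abs_nonneg y]
  · norm_num
  · norm_num

theorem measurable_burkU : Measurable (Function.uncurry burkU) := by
  have h : MeasurableSet {p : ℝ × ℝ | |p.1| + |p.2| ≤ 1} :=
    measurableSet_le (by fun_prop) (by fun_prop)
  exact Measurable.ite h (by fun_prop) (by fun_prop)

theorem measurable_burkA (e : ℝ) : Measurable (Function.uncurry (burkA e)) := by
  have h : MeasurableSet {p : ℝ × ℝ | |p.1| + |p.2| ≤ 1} :=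
    measurableSet_le (by fun_prop) (by fun_prop)
  have h' : MeasurableSet {p : ℝ × ℝ | 0 ≤ p.1} :=
    measurableSet_le (by fun_prop) (by fun_prop)
  exact Measurable.ite h (by fun_prop) (Measurable.ite h' (by fun_prop) (by fun_prop))

theorem integrable_dyadicDiff (n : ℕ) (f : ℝ → ℝ) : Integrable (dyadicDiff n f) lebesgue01 := by
  cases n with
  | zero => exact integrable_dyadicExp 0 f
  | succ n => exact (integrable_dyadicExp (n + 1) f).sub (integrable_dyadicExp n f)

theorem integrable_evenSum (n : ℕ) (f : ℝ → ℝ) : Integrable (evenSum n f) lebesgue01 :=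
  integrable_finsetSum _ fun j _ => (integrable_dyadicDiff j f).const_mul _

/-- The weak type `(1,1)` inequality for the even martingale transform. -/
theorem dist01_evenSum_le {f : ℝ → ℝ} (hf : Integrable f lebesgue01) (n : ℕ) {s : ℝ} (hs : 0 < s) :
    dist01 (evenSum n f) s ≤ ENNReal.ofReal (2 * (∫ t, |f t| ∂lebesgue01) / s) := by
  have hc : 0 < s⁻¹ := inv_pos.2 hs
  have hUint : ∀ f g : ℝ → ℝ, Integrable f lebesgue01 → Integrable g lebesgue01 →
      Integrable (fun t => burkU (s⁻¹ * f t) (s⁻¹ * g t)) lebesgue01 := by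
    intro f g hf hg
    refine Integrable.mono' (g := fun t => 1 + 2 * |s⁻¹ * f t|)
      ((integrable_const 1).add (((hf.const_mul s⁻¹).abs).const_mul 2)) ?_
      (Eventually.of_forall fun t => abs_burkU_le _ _)
    exact (measurable_burkU.comp_aemeasurable
      ((hf.aemeasurable.const_mul s⁻¹).prodMk (hg.aemeasurable.const_mul s⁻¹))).aestronglyMeasurable
  -- Rescaling by 1/s reduces the height `s` to height 1.
  have key := integral_transform_le (U := fun x y => burkU (s⁻¹ * x) (s⁻¹ * y))
    (A := fun e x y => s⁻¹ * burkA e (s⁻¹ * x) (s⁻¹ * y))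
    (fun e => ((measurable_burkA e).comp (g := Function.uncurry (burkA e))
      (f := fun p : ℝ × ℝ => (s⁻¹ * p.1, s⁻¹ * p.2)) (by fun_prop)).const_mul _)
    (by simp [burkU]) (fun e => by simp [burkA])
    (fun x y h e he => by
      have := burkU_step (s⁻¹ * x) (s⁻¹ * y) (s⁻¹ * h) e he
      calc _ = burkU (s⁻¹ * x + s⁻¹ * h) (s⁻¹ * y + e * (s⁻¹ * h)) := by
            congr 1 <;> ring
        _ ≤ _ := this
        _ = _ := by ring)
    (P := fun f => Integrable f lebesgue01) (integrable_zero _ _ _)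
    (fun f g hf hg => hf.add hg) (fun f c hf => hf.smul c)
    (fun f n _ => integrable_dyadicExp n f) (fun f hf => hf) hUint
    (fun e f g d he hf hg hd => by
      refine hd.bdd_mul (c := s⁻¹ * 4) ?_ (Eventually.of_forall fun t => ?_)
      · exact (((measurable_burkA e).comp_aemeasurable ((hf.aemeasurable.const_mul s⁻¹).prodMk
          (hg.aemeasurable.const_mul s⁻¹))).const_mul _).aestronglyMeasurable
      · rw [Real.norm_eq_abs, abs_mul, abs_of_pos hc]
        gcongr
        exact abs_burkA_le _ _ _ he) hf n
  have hS : MeasurableSet {t | 1 ≤ |s⁻¹ * evenSum n f t|} :=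
    measurableSet_le measurable_const ((measurable_evenSum n f).const_mul _).abs
  have hfi : Integrable (fun t => 2 * |s⁻¹ * f t|) lebesgue01 :=
    ((hf.const_mul s⁻¹).abs).const_mul 2
  have h1 : lebesgue01.real {t | 1 ≤ |s⁻¹ * evenSum n f t|}
      ≤ 2 * (∫ t, |f t| ∂lebesgue01) / s := by
    calc lebesgue01.real {t | 1 ≤ |s⁻¹ * evenSum n f t|}
        = ∫ t, {t | 1 ≤ |s⁻¹ * evenSum n f t|}.indicator 1 t ∂lebesgue01 :=
          (integral_indicator_one hS).symm
      _ ≤ ∫ t, (burkU (s⁻¹ * f t) (s⁻¹ * evenSum n f t) + 2 * |s⁻¹ * f t|) ∂lebesgue01 := by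
          refine integral_mono ((integrable_const 1).indicator hS)
            ((hUint _ _ hf (integrable_evenSum n f)).add hfi) fun t => ?_
          refine le_trans (le_of_eq ?_) (indicator_le_burkU _ _)
          simp [indicator_apply]
      _ = ∫ t, burkU (s⁻¹ * f t) (s⁻¹ * evenSum n f t) ∂lebesgue01
            + ∫ t, 2 * |s⁻¹ * f t| ∂lebesgue01 :=
          integral_add (hUint _ _ hf (integrable_evenSum n f)) hfi
      _ ≤ 0 + ∫ t, 2 * |s⁻¹ * f t| ∂lebesgue01 := by gcongr
      _ = _ := by
          simp_rw [abs_mul, abs_of_pos hc]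
          rw [integral_const_mul, integral_const_mul]
          field_simp
          simp
  calc dist01 (evenSum n f) s ≤ lebesgue01 {t | 1 ≤ |s⁻¹ * evenSum n f t|} := by
        refine measure_mono fun t ht => ?_
        have ht' : s < |evenSum n f t| := ht
        change 1 ≤ |s⁻¹ * evenSum n f t|
        rw [abs_mul, abs_of_pos hc, ← inv_mul_cancel₀ hs.ne']
        gcongr
    _ = ENNReal.ofReal (lebesgue01.real {t | 1 ≤ |s⁻¹ * evenSum n f t|}) :=
        (ofReal_measureReal (measure_ne_top _ _)).symm
    _ ≤ _ := ENNReal.ofReal_le_ofReal h1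

/-! ### L₂ contraction and self-adjointness on bounded functions. -/

/-- Measurable and almost everywhere bounded functions. -/
def BddMeas (f : ℝ → ℝ) : Prop :=
  AEStronglyMeasurable f lebesgue01 ∧ ∃ C : ℝ, ∀ᵐ t ∂lebesgue01, |f t| ≤ C

theorem BddMeas.integrable {f : ℝ → ℝ} (hf : BddMeas f) : Integrable f lebesgue01 := by
  obtain ⟨C, hC⟩ := hf.2
  exact Integrable.of_bound hf.1 C hC

theorem BddMeas.add {f g : ℝ → ℝ} (hf : BddMeas f) (hg : BddMeas g) : BddMeas (f + g) := by
  obtain ⟨C, hC⟩ := hf.2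
  obtain ⟨D, hD⟩ := hg.2
  refine ⟨hf.1.add hg.1, C + D, ?_⟩
  filter_upwards [hC, hD] with t h1 h2
  exact (abs_add_le _ _).trans (add_le_add h1 h2)

theorem BddMeas.mul {f g : ℝ → ℝ} (hf : BddMeas f) (hg : BddMeas g) : BddMeas (f * g) := by
  obtain ⟨C, hC⟩ := hf.2
  obtain ⟨D, hD⟩ := hg.2
  refine ⟨hf.1.mul hg.1, C * D, ?_⟩
  filter_upwards [hC, hD] with t h1 h2
  rw [Pi.mul_apply, abs_mul]
  exact mul_le_mul h1 h2 (abs_nonneg _) ((abs_nonneg _).trans h1)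

theorem BddMeas.smul {f : ℝ → ℝ} (hf : BddMeas f) (c : ℝ) : BddMeas (c • f) := by
  obtain ⟨C, hC⟩ := hf.2
  refine ⟨hf.1.const_smul c, |c| * C, ?_⟩
  filter_upwards [hC] with t h1
  rw [Pi.smul_apply, smul_eq_mul, abs_mul]
  gcongr

theorem bddMeas_zero : BddMeas 0 := ⟨aestronglyMeasurable_zero, 0, by simp⟩

theorem BddMeas.dyadicExp {f : ℝ → ℝ} (hf : BddMeas f) (n : ℕ) : BddMeas (dyadicExp n f) := by
  obtain ⟨C, hC⟩ := hf.2
  exact ⟨(integrable_dyadicExp n f).1, C, ae_bdd_abs_condExp_of_ae_bdd_abs hC⟩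

theorem BddMeas.dyadicDiff {f : ℝ → ℝ} (hf : BddMeas f) (n : ℕ) : BddMeas (dyadicDiff n f) := by
  cases n with
  | zero => exact hf.dyadicExp 0
  | succ n =>
    have h := (hf.dyadicExp (n + 1)).add ((hf.dyadicExp n).smul (-1))
    rwa [neg_one_smul, ← sub_eq_add_neg] at h

theorem BddMeas.evenSum {f : ℝ → ℝ} (hf : BddMeas f) (n : ℕ) : BddMeas (evenSum n f) := by
  induction n with
  | zero => rw [evenSum_zero]; exact bddMeas_zero
  | succ n ih => rw [evenSum_succ]; exact ih.add ((hf.dyadicDiff n).smul _)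

/-- The function y² − x² itself has the zigzag property, with second-order term (e² − 1)h² ≤ 0. -/
theorem integral_evenSum_sq_le {f : ℝ → ℝ} (hf : BddMeas f) (n : ℕ) :
    ∫ t, evenSum n f t * evenSum n f t ∂lebesgue01 ≤ ∫ t, f t * f t ∂lebesgue01 := by
  have key := integral_transform_le (U := fun x y => y * y - x * x)
    (A := fun e x y => 2 * (e * y - x)) (fun e => by
      unfold Function.uncurry
      fun_prop) (by simp) (fun e => by simp)
    (fun x y h e he => by rcases he with rfl | rfl <;> nlinarith [sq_nonneg h])
    (P := BddMeas) bddMeas_zero (fun f g hf hg => hf.add hg) (fun f c hf => hf.smul c)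
    (fun f n hf => hf.dyadicExp n) (fun f hf => hf.integrable)
    (fun f g hf hg => (hg.mul hg).integrable.sub (hf.mul hf).integrable)
    (fun e f g d he hf hg hd => ((((hg.smul e).add (hf.smul (-1))).mul hd).smul 2).integrable.congr
      (Eventually.of_forall fun t => by simp; ring)) hf n
  have h1 := integral_sub ((hf.evenSum n).mul (hf.evenSum n)).integrable (hf.mul hf).integrable
  simp only [Pi.mul_apply] at h1
  rw [h1] at key
  linarith

/-- The difference g − 𝔼ₙg is orthogonal to functions measurable at level `n`; this yields the
symmetry of 𝔼ₙ. -/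
theorem integral_dyadicExp_mul {f g : ℝ → ℝ} (hf : BddMeas f) (hg : BddMeas g) (n : ℕ) :
    ∫ t, dyadicExp n f t * g t ∂lebesgue01 = ∫ t, dyadicExp n f t * dyadicExp n g t ∂lebesgue01 := by
  have h0 : dyadicExp n (g - dyadicExp n g) =ᵐ[lebesgue01] 0 := by
    filter_upwards [dyadicExp_sub hg.integrable (integrable_dyadicExp n g) n,
      dyadicExp_dyadicExp_of_le (le_refl n) g] with t h1 h2
    rw [h1, Pi.sub_apply, h2, sub_self]; rfl
  have hd : BddMeas (g - dyadicExp n g) := by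
    have h := hg.add ((hg.dyadicExp n).smul (-1))
    rwa [neg_one_smul, ← sub_eq_add_neg] at h
  have h1 := integral_mul_eq_zero_of_dyadicExp (stronglyMeasurable_dyadicExp le_rfl f)
    hd.integrable ((hf.dyadicExp n).mul hd).integrable h0
  have h2 := integral_sub ((hf.dyadicExp n).mul hg).integrable
    ((hf.dyadicExp n).mul (hg.dyadicExp n)).integrable
  simp only [Pi.mul_apply] at h2
  simp only [Pi.sub_apply, mul_sub] at h1
  rw [h1] at h2
  linarith

theorem integral_dyadicExp_mul_comm {f g : ℝ → ℝ} (hf : BddMeas f) (hg : BddMeas g) (n : ℕ) :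
    ∫ t, dyadicExp n f t * g t ∂lebesgue01 = ∫ t, f t * dyadicExp n g t ∂lebesgue01 := by
  rw [integral_dyadicExp_mul hf hg]
  simp_rw [mul_comm (f _)]
  rw [integral_dyadicExp_mul hg hf]
  simp_rw [mul_comm]

theorem integral_dyadicDiff_mul_comm {f g : ℝ → ℝ} (hf : BddMeas f) (hg : BddMeas g) (n : ℕ) :
    ∫ t, dyadicDiff n f t * g t ∂lebesgue01 = ∫ t, f t * dyadicDiff n g t ∂lebesgue01 := by
  cases n with
  | zero => exact integral_dyadicExp_mul_comm hf hg 0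
  | succ n =>
    have h1 := integral_sub ((hf.dyadicExp (n + 1)).mul hg).integrable
      ((hf.dyadicExp n).mul hg).integrable
    have h2 := integral_sub (hf.mul (hg.dyadicExp (n + 1))).integrable
      (hf.mul (hg.dyadicExp n)).integrable
    simp only [Pi.mul_apply] at h1 h2
    simp only [dyadicDiff, Pi.sub_apply, sub_mul, mul_sub]
    rw [h1, h2, integral_dyadicExp_mul_comm hf hg, integral_dyadicExp_mul_comm hf hg]

theorem integral_evenSum_mul_comm {f g : ℝ → ℝ} (hf : BddMeas f) (hg : BddMeas g) (n : ℕ) :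
    ∫ t, evenSum n f t * g t ∂lebesgue01 = ∫ t, f t * evenSum n g t ∂lebesgue01 := by
  simp only [evenSum, Finset.sum_mul, Finset.mul_sum]
  rw [integral_finsetSum, integral_finsetSum]
  · refine Finset.sum_congr rfl fun j _ => ?_
    simp_rw [mul_left_comm (f _), mul_assoc]
    rw [integral_const_mul, integral_const_mul, integral_dyadicDiff_mul_comm hf hg]
  · exact fun j _ => (hf.mul ((hg.dyadicDiff j).smul _)).integrable
  · exact fun j _ => (((hf.dyadicDiff j).smul _).mul hg).integrable

/-! ### The Calderón estimate for the partial sums. -/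

theorem decRearr_le_div {f : ℝ → ℝ} {a t : ℝ} (ha : 0 ≤ a) (ht : 0 < t)
    (h : ∀ s > 0, dist01 f s ≤ ENNReal.ofReal (a / s)) : decRearr f t ≤ a / t := by
  refine le_of_forall_gt_imp_ge_of_dense fun s hs => ?_
  have hs0 : 0 < s := lt_of_le_of_lt (div_nonneg ha ht.le) hs
  refine decRearr_le hs0.le ((h s hs0).trans (ENNReal.ofReal_le_ofReal ?_))
  rw [div_le_iff₀ hs0, mul_comm]
  exact ((div_lt_iff₀ ht).1 hs).le

theorem decRearr_le_of_bdd {f : ℝ → ℝ} {M : ℝ} (hM : 0 ≤ M) (h : ∀ᵐ u ∂lebesgue01, |f u| ≤ M)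
    (t : ℝ) : decRearr f t ≤ M := by
  refine decRearr_le hM (le_of_eq_of_le ?_ zero_le)
  have := ae_iff.1 h
  simpa [dist01] using this

theorem lebesgue01_Iio_le (t : ℝ) : lebesgue01 (Iio t) ≤ ENNReal.ofReal t := by
  rw [lebesgue01, Measure.restrict_apply measurableSet_Iio]
  calc volume (Iio t ∩ Ioo 0 1) ≤ volume (Ioo 0 t) := measure_mono fun u hu => ⟨hu.2.1, hu.1⟩
    _ = ENNReal.ofReal t := by simp

/-- The rearrangement of the even transform of a bounded function, estimated by duality. -/
theorem decRearr_evenSum_le_of_bdd {f : ℝ → ℝ} (hf : AEStronglyMeasurable f lebesgue01) {M : ℝ}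
    (hM : 0 ≤ M) (hfM : ∀ᵐ u ∂lebesgue01, |f u| ≤ M) (n : ℕ) {t : ℝ} (ht : 0 < t) :
    ENNReal.ofReal (decRearr (evenSum n f) (t / 2))
      ≤ 3 * ENNReal.ofReal M + 2 * calInt (decRearr f) t := by
  have hfB : BddMeas f := ⟨hf, M, hfM⟩
  set g := evenSum n f with hg
  have hgm : Measurable g := measurable_evenSum n f
  refine le_of_forall_lt_imp_le_of_dense fun c hc => ?_
  have hctop : c ≠ ∞ := (hc.trans_le le_top).ne
  rw [← ENNReal.ofReal_toReal hctop] at hc ⊢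
  set l := c.toReal with hl
  have hl0 : 0 ≤ l := ENNReal.toReal_nonneg
  have hlt : l < decRearr g (t / 2) := (ENNReal.ofReal_lt_ofReal_iff_of_nonneg hl0).1 hc
  rw [lt_decRearr_iff hgm.aemeasurable (half_pos ht) hl0] at hlt
  have hB : MeasurableSet {u | l < |g u|} := measurableSet_lt measurable_const hgm.abs
  set b := dist01 g l with hb
  have hbtop : b ≠ ∞ := measure_ne_top _ _
  have hb0 : b ≠ 0 := (lt_of_le_of_lt zero_le hlt).ne'
  have htb : ENNReal.ofReal t ≤ 2 * b := by
    calc ENNReal.ofReal t = 2 * ENNReal.ofReal (t / 2) := by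
          rw [show (2 : ℝ≥0∞) = ENNReal.ofReal 2 by simp, ← ENNReal.ofReal_mul (by norm_num)]
          congr 1; ring
      _ ≤ 2 * b := by gcongr
  -- The test function is the sign of `g` on {|g| > l}, a set of measure `b` > t/2. Then l·b ≤ ∫ g
  -- z, and self-adjointness turns this into ∫ f·(transform of z).
  set z : ℝ → ℝ := fun u => if l < |g u| then (if 0 ≤ g u then 1 else -1) else 0 with hz
  have hzm : Measurable z := Measurable.ite hB
    (Measurable.ite (measurableSet_le measurable_const hgm) measurable_const measurable_const)
    measurable_const
  have hzabs : ∀ u, |z u| = {u | l < |g u|}.indicator 1 u := by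
    intro u
    rw [hz]
    by_cases h : l < |g u|
    · by_cases h' : 0 ≤ g u <;> simp [h, h']
    · simp [h]
  have hzB : BddMeas z := ⟨hzm.aestronglyMeasurable, 1, Eventually.of_forall fun u => by
    rw [hzabs, indicator_apply]; split_ifs <;> simp⟩
  have hzint : ∫ u, |z u| ∂lebesgue01 = b.toReal := by
    simp_rw [hzabs]
    exact integral_indicator_one hB
  have hzsq : ∫ u, z u * z u ∂lebesgue01 = b.toReal := by
    rw [← hzint]
    refine integral_congr_ae (Eventually.of_forall fun u => ?_)
    change z u * z u = |z u|
    rw [← abs_mul_abs_self, hzabs, indicator_apply]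
    split_ifs <;> simp
  have h1 : ENNReal.ofReal l * b ≤ ENNReal.ofReal (∫ u, g u * z u ∂lebesgue01) := by
    have hgz : ∀ u, g u * z u = {u | l < |g u|}.indicator (fun u => |g u|) u := by
      intro u
      rw [hz]
      by_cases h : l < |g u|
      · by_cases h' : 0 ≤ g u
        · simp [h', indicator_apply, abs_of_nonneg h']
        · simp [h', indicator_apply, abs_of_neg (not_le.1 h')]
      · simp [h]
    have hgzi : Integrable (fun u => g u * z u) lebesgue01 := ((hfB.evenSum n).mul hzB).integrable
    rw [ofReal_integral_eq_lintegral_ofReal hgzi (Eventually.of_forall fun u => by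
      change 0 ≤ g u * z u
      rw [hgz]; exact indicator_nonneg (fun _ _ => abs_nonneg _) _)]
    calc ENNReal.ofReal l * b = ∫⁻ _ in {u | l < |g u|}, ENNReal.ofReal l ∂lebesgue01 :=
          (setLIntegral_const _ _).symm
      _ ≤ ∫⁻ u in {u | l < |g u|}, ENNReal.ofReal (g u * z u) ∂lebesgue01 := by
          refine setLIntegral_mono' hB fun u hu => ENNReal.ofReal_le_ofReal ?_
          rw [hgz, indicator_of_mem hu]
          exact le_of_lt hu
      _ ≤ _ := setLIntegral_le_lintegral _ _
  -- Two bounds on `r` are used: ∫ r² ≤ b from the L₂ contraction, and r(s) ≤ 2b/s from the weak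
  -- type inequality.
  set r := decRearr (evenSum n z) with hr
  have hezm := measurable_evenSum n z
  have h2 : ENNReal.ofReal (∫ u, g u * z u ∂lebesgue01)
      ≤ ∫⁻ s, ‖decRearr f s‖ₑ * ‖r s‖ₑ ∂lebesgue01 := by
    rw [integral_evenSum_mul_comm hfB hzB]
    calc _ ≤ ‖∫ u, f u * evenSum n z u ∂lebesgue01‖ₑ := Real.ofReal_le_enorm _
      _ ≤ ∫⁻ u, ‖f u * evenSum n z u‖ₑ ∂lebesgue01 := enorm_integral_le_lintegral_enorm _
      _ = ∫⁻ u, ‖f u‖ₑ * ‖evenSum n z u‖ₑ ∂lebesgue01 := by simp_rw [enorm_mul]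
      _ ≤ _ := lintegral_mul_le_decRearr hf.aemeasurable hezm.aemeasurable
  have hr2 : ∫⁻ s, ‖r s‖ₑ * ‖r s‖ₑ ∂lebesgue01 ≤ b := by
    rw [hr, lintegral_decRearr_mul_self hezm.aemeasurable]
    have h3 := integral_evenSum_sq_le hzB n
    rw [hzsq] at h3
    calc ∫⁻ u, ‖evenSum n z u‖ₑ * ‖evenSum n z u‖ₑ ∂lebesgue01
        = ∫⁻ u, ENNReal.ofReal (evenSum n z u * evenSum n z u) ∂lebesgue01 := by
          refine lintegral_congr fun u => ?_
          rw [← enorm_mul, Real.enorm_of_nonneg (mul_self_nonneg _)]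
      _ = ENNReal.ofReal (∫ u, evenSum n z u * evenSum n z u ∂lebesgue01) :=
          (ofReal_integral_eq_lintegral_ofReal ((hzB.evenSum n).mul (hzB.evenSum n)).integrable
            (Eventually.of_forall fun u => mul_self_nonneg _)).symm
      _ ≤ ENNReal.ofReal b.toReal := ENNReal.ofReal_le_ofReal h3
      _ = b := ENNReal.ofReal_toReal hbtop
  have hrs : ∀ s, 0 < s → r s ≤ 2 * b.toReal / s := by
    intro s hs
    refine decRearr_le_div (by positivity) hs fun s hs => ?_
    have h3 := dist01_evenSum_le hzB.integrable n hs
    rwa [hzint] at h3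
  have h3 : ∫⁻ s, ‖decRearr f s‖ₑ * ‖r s‖ₑ ∂lebesgue01
      ≤ ∫⁻ s, (ENNReal.ofReal M * ((Iio t).indicator 1 s + ‖r s‖ₑ * ‖r s‖ₑ)
        + 2 * b * (‖decRearr f s‖ₑ * ENNReal.ofReal (calKer t s))) ∂lebesgue01 := by
    refine lintegral_mono_ae ?_
    filter_upwards [ae_mem_Ioo] with s hs
    -- Before `t` use μ(f) ≤ M and r ≤ 1 + r²; after `t` use r(s) ≤ 2b/s, which is 2b times the
    -- kernel.
    rcases lt_or_ge s t with hst | hst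
    · refine le_trans ?_ le_self_add
      rw [indicator_of_mem (show s ∈ Iio t from hst)]
      gcongr
      · rw [Real.enorm_of_nonneg (decRearr_nonneg _ _)]
        exact ENNReal.ofReal_le_ofReal (decRearr_le_of_bdd hM hfM s)
      · rcases le_total ‖r s‖ₑ 1 with h | h
        · exact h.trans le_self_add
        · refine le_trans ?_ le_add_self
          calc ‖r s‖ₑ = 1 * ‖r s‖ₑ := (one_mul _).symm
            _ ≤ _ := by gcongr
    · refine le_trans ?_ le_add_self
      rw [mul_left_comm]
      gcongr
      rw [Real.enorm_of_nonneg (decRearr_nonneg _ _), calKer, max_eq_left hst]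
      calc ENNReal.ofReal (r s) ≤ ENNReal.ofReal (2 * b.toReal / s) :=
            ENNReal.ofReal_le_ofReal (hrs s hs.1)
        _ = 2 * b * ENNReal.ofReal s⁻¹ := by
            rw [div_eq_mul_inv, ENNReal.ofReal_mul (by positivity), ENNReal.ofReal_mul two_pos.le,
              ENNReal.ofReal_toReal hbtop]
            simp
  have hrm : AEMeasurable (fun s => ‖r s‖ₑ * ‖r s‖ₑ) lebesgue01 :=
    (aemeasurable_decRearr hezm.aemeasurable).enorm.mul
      (aemeasurable_decRearr hezm.aemeasurable).enorm
  have h4 : ∫⁻ s, (ENNReal.ofReal M * ((Iio t).indicator 1 s + ‖r s‖ₑ * ‖r s‖ₑ)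
        + 2 * b * (‖decRearr f s‖ₑ * ENNReal.ofReal (calKer t s))) ∂lebesgue01
      ≤ (3 * ENNReal.ofReal M + 2 * calInt (decRearr f) t) * b := by
    have hi : Measurable ((Iio t).indicator (1 : ℝ → ℝ≥0∞)) :=
      measurable_one.indicator measurableSet_Iio
    have hm : AEMeasurable (fun s => ENNReal.ofReal M * ((Iio t).indicator 1 s + ‖r s‖ₑ * ‖r s‖ₑ))
        lebesgue01 := (hi.aemeasurable.add hrm).const_mul _
    rw [lintegral_add_left' hm,
      lintegral_const_mul' _ _ ENNReal.ofReal_ne_top,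
      lintegral_const_mul' _ _ (ENNReal.mul_ne_top ENNReal.ofNat_ne_top hbtop),
      lintegral_add_left hi, lintegral_indicator_one measurableSet_Iio]
    -- Here `t ≤ 2 * b` bounds the measure of the initial interval and the L₂ bound gives the other
    -- `b`; every term is then a multiple of `b`, which cancels.
    calc _ ≤ ENNReal.ofReal M * (2 * b + b) + 2 * b * calInt (decRearr f) t := by
          unfold calInt
          gcongr
          exact (lebesgue01_Iio_le t).trans htb
      _ = _ := by ring
  have h5 := h1.trans (h2.trans (h3.trans h4))
  exact (ENNReal.mul_le_mul_iff_left hb0 hbtop).1 h5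

/-- The Calderón estimate for the partial sums of the even transform. -/
theorem decRearr_evenSum_le {x : ℝ → ℝ} (hxm : Measurable x) (hx : Integrable x lebesgue01) (n : ℕ)
    {t : ℝ} (ht : t ∈ Ioo (0 : ℝ) 1) :
    ENNReal.ofReal (decRearr (evenSum n x) t) ≤ 9 * calInt (decRearr x) t := by
  -- Truncation at this height leaves a large part supported on measure at most `t`, and `M` is
  -- itself at most the Calderón integral. The two parts contribute 4 and 5 to the constant 9.
  set M := decRearr x t with hM
  have hM0 : 0 ≤ M := decRearr_nonneg x t
  set S : Set ℝ := {u | M < |x u|} with hS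
  have hSm : MeasurableSet S := measurableSet_lt measurable_const hxm.abs
  have hSt : lebesgue01 S ≤ ENNReal.ofReal t := dist01_decRearr_le hxm.aemeasurable ht.1
  have hx1 : Integrable (S.indicator x) lebesgue01 := hx.indicator hSm
  have hx2 : Integrable (Sᶜ.indicator x) lebesgue01 := hx.indicator hSm.compl
  have hML : ENNReal.ofReal M ≤ calInt (decRearr x) t := decRearr_le_calInt hxm.aemeasurable ht
  have hsplit : evenSum n x =ᵐ[lebesgue01]
      fun u => evenSum n (S.indicator x) u + evenSum n (Sᶜ.indicator x) u := by
    have h := evenSum_add hx1 hx2 n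
    rwa [indicator_self_add_compl] at h
  have hlarge : ENNReal.ofReal (decRearr (evenSum n (S.indicator x)) (t / 2))
      ≤ 4 * calInt (decRearr x) t := by
    have hI0 : 0 ≤ ∫ u, |S.indicator x u| ∂lebesgue01 := integral_nonneg fun u => abs_nonneg _
    have h1 := decRearr_le_div (mul_nonneg two_pos.le hI0) (half_pos ht.1)
      fun s hs => dist01_evenSum_le hx1 n hs
    have h2 : ENNReal.ofReal (∫ u, |S.indicator x u| ∂lebesgue01)
        ≤ ENNReal.ofReal t * calInt (decRearr x) t := by
      rw [ofReal_integral_eq_lintegral_ofReal hx1.abs (Eventually.of_forall fun u => abs_nonneg _)]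
      calc ∫⁻ u, ENNReal.ofReal |S.indicator x u| ∂lebesgue01
          = ∫⁻ u, ‖x u‖ₑ * ‖S.indicator (1 : ℝ → ℝ) u‖ₑ ∂lebesgue01 := by
            refine lintegral_congr fun u => ?_
            rw [← Real.enorm_eq_ofReal_abs, ← enorm_mul]
            congr 1
            by_cases hu : u ∈ S <;> simp [hu]
        _ ≤ ∫⁻ s, ‖decRearr x s‖ₑ * ‖decRearr (S.indicator (1 : ℝ → ℝ)) s‖ₑ ∂lebesgue01 :=
            lintegral_mul_le_decRearr hxm.aemeasurable (measurable_one.indicator hSm).aemeasurable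
        _ ≤ ∫⁻ s, ENNReal.ofReal t * (‖decRearr x s‖ₑ * ENNReal.ofReal (calKer t s))
              ∂lebesgue01 := by
            refine lintegral_mono_ae ?_
            filter_upwards [ae_mem_Ioo] with s hs
            rw [mul_left_comm]
            gcongr
            rw [Real.enorm_of_nonneg (decRearr_nonneg _ _), ← ENNReal.ofReal_mul ht.1.le]
            refine ENNReal.ofReal_le_ofReal ?_
            -- The rearranged indicator of `S` is at most 1 before `t` and zero from `t` on, hence
            -- at most `t` times the kernel.
            rcases lt_or_ge s t with hst | hst
            · rw [calKer, max_eq_right hst.le, mul_inv_cancel₀ ht.1.ne']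
              refine decRearr_le_of_bdd zero_le_one (Eventually.of_forall fun u => ?_) s
              rw [indicator_apply]
              split_ifs <;> simp
            · refine (decRearr_le le_rfl (le_trans (measure_mono ?_)
                (hSt.trans (ENNReal.ofReal_le_ofReal hst)))).trans
                (mul_nonneg ht.1.le (calKer_nonneg ht.1 s))
              intro u hu
              by_contra hcon
              have hu' : 0 < |S.indicator (1 : ℝ → ℝ) u| := hu
              rw [indicator_of_notMem hcon] at hu'
              simp at hu'
        _ = _ := lintegral_const_mul' _ _ ENNReal.ofReal_ne_top
    calc _ ≤ ENNReal.ofReal (2 * (∫ u, |S.indicator x u| ∂lebesgue01) / (t / 2)) :=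
          ENNReal.ofReal_le_ofReal h1
      _ = ENNReal.ofReal (4 * t⁻¹) * ENNReal.ofReal (∫ u, |S.indicator x u| ∂lebesgue01) := by
          rw [← ENNReal.ofReal_mul (mul_nonneg (by norm_num) (inv_nonneg.2 ht.1.le))]
          congr 1
          have := ht.1.ne'
          field_simp
          ring
      _ ≤ ENNReal.ofReal (4 * t⁻¹) * (ENNReal.ofReal t * calInt (decRearr x) t) := by gcongr
      _ = _ := by
          rw [← mul_assoc, ← ENNReal.ofReal_mul (mul_nonneg (by norm_num) (inv_nonneg.2 ht.1.le)),
            mul_assoc, inv_mul_cancel₀ ht.1.ne']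
          simp
  have hsmall : ENNReal.ofReal (decRearr (evenSum n (Sᶜ.indicator x)) (t / 2))
      ≤ 5 * calInt (decRearr x) t := by
    have hle : ∀ u, |Sᶜ.indicator x u| ≤ |x u| := by
      intro u
      rw [indicator_apply]
      split_ifs
      · exact le_rfl
      · simp
    refine (decRearr_evenSum_le_of_bdd hx2.1 hM0 (Eventually.of_forall fun u => ?_) n ht.1).trans ?_
    · rw [indicator_apply]
      split_ifs with hu
      · exact not_lt.1 hu
      · simpa using hM0
    · calc _ ≤ 3 * calInt (decRearr x) t + 2 * calInt (decRearr x) t := by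
            gcongr
            refine calInt_mono ?_ t
            filter_upwards [ae_mem_Ioo] with s hs
            rw [abs_of_nonneg (decRearr_nonneg _ _), abs_of_nonneg (decRearr_nonneg _ _)]
            exact decRearr_mono hxm.aemeasurable (Eventually.of_forall hle) hs.1
        _ = _ := by rw [← add_mul]; norm_num
  have hadd := decRearr_add (measurable_evenSum n (S.indicator x)).aemeasurable
    (measurable_evenSum n (Sᶜ.indicator x)).aemeasurable (half_pos ht.1) (half_pos ht.1)
  rw [add_halves, ← decRearr_congr hsplit] at hadd
  calc ENNReal.ofReal (decRearr (evenSum n x) t)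
      ≤ ENNReal.ofReal (decRearr (evenSum n (S.indicator x)) (t / 2))
        + ENNReal.ofReal (decRearr (evenSum n (Sᶜ.indicator x)) (t / 2)) := by
        rw [← ENNReal.ofReal_add (decRearr_nonneg _ _) (decRearr_nonneg _ _)]
        exact ENNReal.ofReal_le_ofReal hadd
    _ ≤ 4 * calInt (decRearr x) t + 5 * calInt (decRearr x) t := add_le_add hlarge hsmall
    _ = _ := by rw [← add_mul]; norm_num

/-! ### Convergence in measure of the transform and linearity of limits. -/

/-- The partial sums of the even transform, as elements of `S(0,1)`. -/
def evenS (n : ℕ) (x : S01) : S01 :=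
  AEEqFun.mk (evenSum n x) (measurable_evenSum n x).aestronglyMeasurable

theorem coeFn_evenS (n : ℕ) (x : S01) : evenS n x =ᵐ[lebesgue01] evenSum n x :=
  AEEqFun.coeFn_mk _ _

theorem evenS_add {x y : S01} (hx : Integrable x lebesgue01) (hy : Integrable y lebesgue01)
    (n : ℕ) : evenS n (x + y) = evenS n x + evenS n y := by
  refine AEEqFun.ext ?_
  filter_upwards [coeFn_evenS n (x + y), coeFn_evenS n x, coeFn_evenS n y,
    AEEqFun.coeFn_add (evenS n x) (evenS n y), evenSum_congr (AEEqFun.coeFn_add x y) n,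
    evenSum_add hx hy n] with t h1 h2 h3 h4 h5 h6
  rw [h1, h4, h5, h6, Pi.add_apply, Pi.add_apply, h2, h3]

theorem evenS_smul (c : ℝ) (x : S01) (n : ℕ) : evenS n (c • x) = c • evenS n x := by
  refine AEEqFun.ext ?_
  filter_upwards [coeFn_evenS n (c • x), coeFn_evenS n x,
    AEEqFun.coeFn_smul c (evenS n x), evenSum_congr (AEEqFun.coeFn_smul c x) n,
    evenSum_smul c x n] with t h1 h2 h3 h4 h5
  rw [h1, h3, h4, h5, Pi.smul_apply, Pi.smul_apply, h2]

theorem kerDominated_evenS {x : S01} (hx : Integrable x lebesgue01) (n : ℕ) :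
    KerDominated (evenS n x) ((9 : ℝ) • rearrS x) := by
  intro t ht
  have h1 : (((9 : ℝ) • rearrS x : S01) : ℝ → ℝ) =ᵐ[lebesgue01] fun u => 9 * decRearr x u := by
    filter_upwards [AEEqFun.coeFn_smul (9 : ℝ) (rearrS x), coeFn_rearrS x] with u h2 h3
    rw [h2, Pi.smul_apply, h3, smul_eq_mul]
    rfl
  rw [calInt_congr h1, calInt_const_mul, rearr_eq_decRearr, decRearr_congr (coeFn_evenS n x)]
  have h2 := decRearr_evenSum_le x.measurable hx n ht
  simpa using h2

/-- Norm convergence in `L₁` of the dyadic conditional expectations. -/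
theorem tendsto_integral_abs_sub_dyadicExp {f : ℝ → ℝ} (hfm : Measurable f)
    (hf : Integrable f lebesgue01) :
    Tendsto (fun n => ∫ t, |f t - dyadicExp n f t| ∂lebesgue01) atTop (𝓝 0) := by
  have h := Integrable.tendsto_eLpNorm_condExp (ℱ := dyadicFiltration) hf
    ((hfm.mono measurable_iSup_dyadicSigma le_rfl).stronglyMeasurable)
  have h2 := (ENNReal.tendsto_toReal ENNReal.zero_ne_top).comp h
  refine h2.congr fun n => ?_
  simp only [Function.comp_apply]
  rw [eLpNorm_one_eq_lintegral_enorm, ← integral_norm_eq_lintegral_enorm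
    ((integrable_condExp.sub hf).1)]
  refine integral_congr_ae (Eventually.of_forall fun t => ?_)
  exact (abs_sub_comm _ _)

theorem dyadicDiff_eq_zero_of_stronglyMeasurable {f : ℝ → ℝ} {k j : ℕ}
    (hf : StronglyMeasurable[dyadicSigma k] f) (hfi : Integrable f lebesgue01) (hj : k < j) :
    dyadicDiff j f = 0 := by
  cases j with
  | zero => omega
  | succ j =>
    rw [dyadicDiff, dyadicExp_of_stronglyMeasurable (by omega) hf hfi,
      dyadicExp_of_stronglyMeasurable (by omega) hf hfi, sub_self]

theorem evenSum_eq_of_stronglyMeasurable {f : ℝ → ℝ} {k : ℕ}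
    (hf : StronglyMeasurable[dyadicSigma k] f) (hfi : Integrable f lebesgue01) {i : ℕ}
    (hi : k < i) : evenSum i f = evenSum (k + 1) f := by
  obtain ⟨d, rfl⟩ := Nat.exists_eq_add_of_le (Nat.succ_le_of_lt hi)
  induction d with
  | zero => rfl
  | succ d ih =>
    rw [show k.succ + (d + 1) = k.succ + d + 1 by ring, evenSum_succ, ih (by omega),
      dyadicDiff_eq_zero_of_stronglyMeasurable hf hfi (by omega), smul_zero, add_zero]

/-- Split `x` into 𝔼ₖx, whose partial sums stabilize after level `k`, and a remainder of small L₁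
norm, whose partial sums are uniformly small in measure by the weak type bound. -/
theorem exists_convInMeasure_evenS {x : S01} (hx : Integrable x lebesgue01) :
    ∃ y, ConvInMeasure (fun n => evenS n x) y := by
  refine exists_convInMeasure fun ε hε => ?_
  -- At height ε/2 the weak type bound gives 2·(ε²/8)/(ε/2) = ε/2.
  obtain ⟨k, hk⟩ := ((tendsto_integral_abs_sub_dyadicExp x.measurable hx).eventually_lt_const
    (show 0 < ε * ε / 8 by positivity)).exists
  set w : ℝ → ℝ := x - dyadicExp k x with hw
  have hwi : Integrable w lebesgue01 := hx.sub (integrable_dyadicExp k x)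
  have hk' : ∫ t, |w t| ∂lebesgue01 < ε * ε / 8 := hk
  have hdec : ∀ i, evenSum i x =ᵐ[lebesgue01] evenSum i w + evenSum i (dyadicExp k x) := by
    intro i
    have h := evenSum_add hwi (integrable_dyadicExp k x) i
    rwa [hw, sub_add_cancel] at h
  have hsmall : ∀ i, dist01 (evenSum i w) (ε / 2) ≤ ENNReal.ofReal (ε / 2) := by
    intro i
    refine (dist01_evenSum_le hwi i (half_pos hε)).trans (ENNReal.ofReal_le_ofReal ?_)
    rw [div_le_iff₀ (half_pos hε)]
    linarith
  refine ⟨k + 1, fun i hi j hj => ?_⟩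
  have heq : (evenS i x - evenS j x : S01) =ᵐ[lebesgue01]
      fun t => evenSum i w t - evenSum j w t := by
    filter_upwards [AEEqFun.coeFn_sub (evenS i x) (evenS j x), coeFn_evenS i x, coeFn_evenS j x,
      hdec i, hdec j] with t h1 h2 h3 h4 h5
    rw [h1, Pi.sub_apply, h2, h3, h4, h5, Pi.add_apply, Pi.add_apply,
      evenSum_eq_of_stronglyMeasurable (stronglyMeasurable_dyadicExp le_rfl x)
        (integrable_dyadicExp k x) (show k < i by omega),
      evenSum_eq_of_stronglyMeasurable (stronglyMeasurable_dyadicExp le_rfl x)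
        (integrable_dyadicExp k x) (show k < j by omega)]
    ring
  rw [dist01_congr heq]
  calc dist01 (fun t => evenSum i w t - evenSum j w t) ε
      ≤ dist01 (evenSum i w) (ε / 2) + dist01 (evenSum j w) (ε / 2) := by
        refine le_trans (measure_mono ?_) (measure_union_le _ _)
        intro u hu
        by_contra hcon
        simp only [mem_union, not_or] at hcon
        have h1 : |evenSum i w u| ≤ ε / 2 := not_lt.1 hcon.1
        have h2 : |evenSum j w u| ≤ ε / 2 := not_lt.1 hcon.2
        have h3 : ε < |evenSum i w u - evenSum j w u| := hu
        linarith [abs_sub (evenSum i w u) (evenSum j w u)]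
    _ ≤ ENNReal.ofReal (ε / 2) + ENNReal.ofReal (ε / 2) := add_le_add (hsmall i) (hsmall j)
    _ = ENNReal.ofReal ε := by
        rw [← ENNReal.ofReal_add (half_pos hε).le (half_pos hε).le, add_halves]

theorem ConvInMeasure.tendstoInMeasure {u : ℕ → S01} {x : S01} (h : ConvInMeasure u x) :
    TendstoInMeasure lebesgue01 (fun n => (u n : ℝ → ℝ)) atTop x := by
  rw [tendstoInMeasure_iff_norm]
  intro ε hε
  rw [ENNReal.tendsto_nhds_zero]
  intro δ hδ
  have hη : 0 < min (ε / 2) (min δ 1).toReal := lt_min (half_pos hε)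
    (ENNReal.toReal_pos (lt_min hδ one_pos).ne' (ne_top_of_le_ne_top ENNReal.one_ne_top
      (min_le_right _ _)))
  obtain ⟨N, hN⟩ := h _ hη
  filter_upwards [eventually_ge_atTop N] with n hn
  calc lebesgue01 {t | ε ≤ ‖u n t - x t‖} ≤ dist01 (u n - x : S01) (min (ε / 2) (min δ 1).toReal) := by
        rw [dist01_congr (AEEqFun.coeFn_sub (u n) x)]
        refine measure_mono fun t ht => ?_
        have ht' : ε ≤ |u n t - x t| := ht
        change min (ε / 2) (min δ 1).toReal < |u n t - x t|
        exact (min_le_left _ _).trans_lt (by linarith)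
    _ ≤ _ := hN n hn
    _ ≤ ENNReal.ofReal (min δ 1).toReal := ENNReal.ofReal_le_ofReal (min_le_right _ _)
    _ ≤ min δ 1 := ENNReal.ofReal_toReal_le
    _ ≤ δ := min_le_left _ _

theorem ConvInMeasure.unique {u : ℕ → S01} {x y : S01} (hx : ConvInMeasure u x)
    (hy : ConvInMeasure u y) : x = y :=
  AEEqFun.ext (tendstoInMeasure_ae_unique hx.tendstoInMeasure hy.tendstoInMeasure)

theorem ConvInMeasure.add {u v : ℕ → S01} {x y : S01} (hx : ConvInMeasure u x)
    (hy : ConvInMeasure v y) : ConvInMeasure (fun n => u n + v n) (x + y) := by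
  intro ε hε
  obtain ⟨N, hN⟩ := hx _ (half_pos hε)
  obtain ⟨M, hM⟩ := hy _ (half_pos hε)
  refine ⟨max N M, fun i hi => ?_⟩
  rw [add_sub_add_comm, ← add_halves ε, ENNReal.ofReal_add (half_pos hε).le (half_pos hε).le]
  exact (dist01_add_le _ _ _ _).trans
    (add_le_add (hN i ((le_max_left _ _).trans hi)) (hM i ((le_max_right _ _).trans hi)))

theorem ConvInMeasure.smul {u : ℕ → S01} {x : S01} (hx : ConvInMeasure u x) (c : ℝ) :
    ConvInMeasure (fun n => c • u n) (c • x) := by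
  intro ε hε
  have hc : 0 < |c| + 1 := by positivity
  have hη : 0 < min ε (ε / (|c| + 1)) := lt_min hε (by positivity)
  obtain ⟨N, hN⟩ := hx _ hη
  refine ⟨N, fun i hi => ?_⟩
  rw [← smul_sub, dist01_congr (AEEqFun.coeFn_smul c (u i - x))]
  refine le_trans (measure_mono fun t ht => ?_)
    ((hN i hi).trans (ENNReal.ofReal_le_ofReal (min_le_left _ _)))
  have ht' : ε < |c * (u i - x : S01) t| := ht
  change min ε (ε / (|c| + 1)) < |(u i - x : S01) t|
  refine (min_le_right _ _).trans_lt ((div_lt_iff₀ hc).2 (ht'.trans_le ?_))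
  rw [abs_mul, mul_comm]
  gcongr
  linarith

theorem convInMeasure_of_eventually_eq {u : ℕ → S01} {x : S01} {N : ℕ} (h : ∀ i ≥ N, u i = x) :
    ConvInMeasure u x := by
  intro ε hε
  refine ⟨N, fun i hi => ?_⟩
  rw [h i hi, sub_self, dist01_congr AEEqFun.coeFn_zero, dist01]
  simp [not_lt.2 (le_of_lt hε)]

theorem isEvenTransform_of_convInMeasure {x y : S01} (h : ConvInMeasure (fun n => evenS n x) y) :
    IsEvenTransform x y := by
  have h1 := h.tendstoInMeasure.comp (ns := fun N : ℕ => 2 * N)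
    (tendsto_id.const_mul_atTop' two_pos)
  refine h1.congr_left fun N => ?_
  filter_upwards [coeFn_evenS (2 * N) x] with t ht
  simp only [Function.comp_apply]
  rw [ht, evenSum_two_mul]

/-! ### Rademacher and Haar functions under the transform. -/

/-- The Rademacher function of level `n`. -/
def rad (n : ℕ) (t : ℝ) : ℝ := if Even ⌊(2 : ℝ) ^ (n + 1) * t⌋ then 1 else -1

theorem abs_rad (n : ℕ) (t : ℝ) : |rad n t| = 1 := by
  unfold rad; split_ifs <;> simp

theorem stronglyMeasurable_rad (n : ℕ) : StronglyMeasurable[dyadicSigma (n + 1)] (rad n) := by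
  have h1 : Measurable[dyadicSigma (n + 1)] fun t : ℝ => ⌊(2 : ℝ) ^ (n + 1) * t⌋ :=
    comap_measurable _
  have h2 : Measurable fun k : ℤ => if Even k then (1 : ℝ) else -1 := measurable_from_top
  exact (h2.comp h1).stronglyMeasurable

theorem measurable_rad (n : ℕ) : Measurable (rad n) :=
  ((stronglyMeasurable_rad n).mono (dyadicSigma_le _)).measurable

theorem mem_Ico_iff_floor (n : ℕ) (t : ℝ) :
    t ∈ Ico (0 : ℝ) 1 ↔ 0 ≤ ⌊(2 : ℝ) ^ n * t⌋ ∧ ⌊(2 : ℝ) ^ n * t⌋ < 2 ^ n := by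
  have h2 : (0 : ℝ) < 2 ^ n := by positivity
  rw [Int.floor_nonneg, Int.floor_lt, mem_Ico]
  push_cast
  rw [mul_nonneg_iff_of_pos_left h2, mul_lt_iff_lt_one_right h2]

/-- Translation by half a dyadic interval of level `n` maps the part of the set where `rad n` is 1
onto the part where it is −1, up to null sets. -/
theorem setIntegral_rad (n : ℕ) {s : Set ℝ} (hs : MeasurableSet[dyadicSigma n] s) :
    ∫ t in s, rad n t ∂lebesgue01 = 0 := by
  have hsm : MeasurableSet s := dyadicSigma_le n _ hs
  obtain ⟨S, -, rfl⟩ := hs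
  set s : Set ℝ := (fun t : ℝ => ⌊(2 : ℝ) ^ n * t⌋) ⁻¹' S with hsdef
  have hfl : Measurable fun t : ℝ => ⌊(2 : ℝ) ^ (n + 1) * t⌋ := by fun_prop
  -- Membership in [0,1) is encoded by k / 2, which does not change when an even `k` becomes k + 1;
  -- the translation therefore stays inside [0,1).
  set Q : ℤ → Prop := fun k => k / 2 ∈ S ∧ 0 ≤ k / 2 ∧ k / 2 < 2 ^ n with hQ
  set Ev : Set ℝ := {t | Even ⌊(2 : ℝ) ^ (n + 1) * t⌋ ∧ Q ⌊(2 : ℝ) ^ (n + 1) * t⌋} with hEv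
  set Od : Set ℝ := {t | ¬ Even ⌊(2 : ℝ) ^ (n + 1) * t⌋ ∧ Q ⌊(2 : ℝ) ^ (n + 1) * t⌋} with hOd
  have hEvm : MeasurableSet Ev :=
    hfl (show MeasurableSet {k : ℤ | Even k ∧ Q k} from MeasurableSet.of_discrete)
  have hOdm : MeasurableSet Od :=
    hfl (show MeasurableSet {k : ℤ | ¬ Even k ∧ Q k} from MeasurableSet.of_discrete)
  have hmemQ : ∀ t : ℝ, Q ⌊(2 : ℝ) ^ (n + 1) * t⌋ ↔ t ∈ s ∩ Ico 0 1 := by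
    intro t
    rw [mem_inter_iff, mem_Ico_iff_floor n, hQ]
    simp only [← floor_two_pow]
    rfl
  have hsubE : Ev ⊆ Ico 0 1 := fun t ht => ((hmemQ t).1 ht.2).2
  have hsubO : Od ⊆ Ico 0 1 := fun t ht => ((hmemQ t).1 ht.2).2
  have hfin : ∀ B : Set ℝ, B ⊆ Ico 0 1 → volume B ≠ ∞ := fun B hB =>
    measure_ne_top_of_subset hB (by simp)
  have hshift : volume Od = volume Ev := by
    rw [← measure_preimage_add_right volume (((2 : ℝ) ^ (n + 1))⁻¹) Od]
    congr 1
    ext t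
    have h2 : (2 : ℝ) ^ (n + 1) ≠ 0 := by positivity
    have h3 : ⌊(2 : ℝ) ^ (n + 1) * (t + ((2 : ℝ) ^ (n + 1))⁻¹)⌋ = ⌊(2 : ℝ) ^ (n + 1) * t⌋ + 1 := by
      rw [mul_add, mul_inv_cancel₀ h2, Int.floor_add_one]
    change (¬ Even ⌊(2 : ℝ) ^ (n + 1) * (t + ((2 : ℝ) ^ (n + 1))⁻¹)⌋
      ∧ Q ⌊(2 : ℝ) ^ (n + 1) * (t + ((2 : ℝ) ^ (n + 1))⁻¹)⌋) ↔
      Even ⌊(2 : ℝ) ^ (n + 1) * t⌋ ∧ Q ⌊(2 : ℝ) ^ (n + 1) * t⌋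
    rw [h3]
    generalize ⌊(2 : ℝ) ^ (n + 1) * t⌋ = k
    rw [Int.even_add_one, not_not]
    refine and_congr_right fun hk => ?_
    have h4 : (k + 1) / 2 = k / 2 := by
      obtain ⟨m, rfl⟩ := hk
      omega
    rw [hQ]
    simp only [h4]
  have hI : ∫ t in s, rad n t ∂lebesgue01 = ∫ t, (Ev.indicator 1 t - Od.indicator 1 t) := by
    have hl : lebesgue01 = volume.restrict (Ico 0 1) := Measure.restrict_congr_set Ioo_ae_eq_Ico
    rw [hl, Measure.restrict_restrict hsm, ← integral_indicator (hsm.inter measurableSet_Ico)]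
    refine integral_congr_ae (Eventually.of_forall fun t => ?_)
    change (s ∩ Ico 0 1).indicator (rad n) t = Ev.indicator 1 t - Od.indicator 1 t
    by_cases h : t ∈ s ∩ Ico 0 1
    · have hq := (hmemQ t).2 h
      rw [indicator_of_mem h, rad]
      by_cases he : Even ⌊(2 : ℝ) ^ (n + 1) * t⌋
      · rw [if_pos he, indicator_of_mem (show t ∈ Ev from ⟨he, hq⟩),
          indicator_of_notMem (show t ∉ Od from fun h => h.1 he)]
        simp
      · rw [if_neg he, indicator_of_notMem (show t ∉ Ev from fun h => he h.1),
          indicator_of_mem (show t ∈ Od from ⟨he, hq⟩)]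
        simp
    · rw [indicator_of_notMem h, indicator_of_notMem (show t ∉ Ev from fun h' => h ((hmemQ t).1 h'.2)),
        indicator_of_notMem (show t ∉ Od from fun h' => h ((hmemQ t).1 h'.2)), sub_zero]
  have hint : ∀ B : Set ℝ, MeasurableSet B → B ⊆ Ico 0 1 →
      Integrable (B.indicator (1 : ℝ → ℝ)) volume := fun B hB hB1 =>
    (integrable_indicator_iff hB).2 (integrableOn_const (hfin B hB1))
  rw [hI, integral_sub (hint Ev hEvm hsubE) (hint Od hOdm hsubO), integral_indicator_one hEvm,
    integral_indicator_one hOdm, measureReal_def, measureReal_def, hshift, sub_self]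

theorem integrable_rad (n : ℕ) : Integrable (rad n) lebesgue01 :=
  Integrable.of_bound (measurable_rad n).aestronglyMeasurable 1
    (Eventually.of_forall fun t => (abs_rad n t).le)

theorem dyadicExp_rad (n : ℕ) : dyadicExp n (rad n) =ᵐ[lebesgue01] 0 := by
  refine (ae_eq_condExp_of_forall_setIntegral_eq (dyadicSigma_le n) (integrable_rad n)
    (fun s _ _ => integrableOn_zero) (fun s hs _ => ?_)
    (stronglyMeasurable_zero : StronglyMeasurable[dyadicSigma n] (0 : ℝ → ℝ)).aestronglyMeasurable).symm
  rw [setIntegral_rad n hs]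
  simp

theorem integrable_indicator_rad (n : ℕ) {S : Set ℝ} (hS : MeasurableSet S) :
    Integrable (S.indicator (rad n)) lebesgue01 := (integrable_rad n).indicator hS

theorem dyadicExp_indicator_rad (n : ℕ) {S : Set ℝ} (hS : MeasurableSet[dyadicSigma n] S) :
    dyadicExp n (S.indicator (rad n)) =ᵐ[lebesgue01] 0 := by
  classical
  have h := condExp_indicator (integrable_rad n) hS
  filter_upwards [h, dyadicExp_rad n] with t h1 h2
  rw [dyadicExp, h1, indicator_apply]
  split_ifs
  · exact h2
  · rfl

theorem dyadicExp_zero_ae {f : ℝ → ℝ} {n j : ℕ} (hj : j ≤ n)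
    (h0 : dyadicExp n f =ᵐ[lebesgue01] 0) : dyadicExp j f =ᵐ[lebesgue01] 0 := by
  have h1 := dyadicExp_congr h0 j
  rw [show dyadicExp j (0 : ℝ → ℝ) = 0 from condExp_zero] at h1
  exact (dyadicExp_dyadicExp_of_le hj f).symm.trans h1

/-- The even transform of a single martingale difference. -/
theorem evenSum_of_dyadicExp_eq_zero {f : ℝ → ℝ} {n : ℕ}
    (hf : StronglyMeasurable[dyadicSigma (n + 1)] f) (hfi : Integrable f lebesgue01)
    (h0 : dyadicExp n f =ᵐ[lebesgue01] 0) {i : ℕ} (hi : n + 2 ≤ i) :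
    evenSum i f =ᵐ[lebesgue01] evenCoeff (n + 1) • f := by
  rw [evenSum_eq_of_stronglyMeasurable hf hfi (show n + 1 < i by omega), evenSum_succ]
  have hd : ∀ j ≤ n, dyadicDiff j f =ᵐ[lebesgue01] 0 := by
    intro j hj
    cases j with
    | zero => exact dyadicExp_zero_ae hj h0
    | succ j =>
      filter_upwards [dyadicExp_zero_ae hj h0, dyadicExp_zero_ae (show j ≤ n by omega) h0]
        with t h1 h2
      rw [dyadicDiff, Pi.sub_apply, h1, h2, sub_self]; rfl
  have hall : ∀ᵐ t ∂lebesgue01, ∀ j ≤ n, dyadicDiff j f t = 0 :=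
    ae_all_iff.2 fun j => by
      by_cases hj : j ≤ n
      · filter_upwards [hd j hj] with t ht _
        exact ht
      · exact Eventually.of_forall fun t h => absurd h hj
  filter_upwards [hall, h0] with t h1 h2
  have h3 : evenSum (n + 1) f t = 0 := Finset.sum_eq_zero fun j hj => by
    rw [h1 j (Nat.lt_succ_iff.1 (Finset.mem_range.1 hj)), mul_zero]
  rw [Pi.add_apply, h3, zero_add, Pi.smul_apply, Pi.smul_apply, dyadicDiff, Pi.sub_apply, h2,
    dyadicExp_of_stronglyMeasurable le_rfl hf hfi]
  simp

/-- A Rademacher function of level `n` on a set of level `n` is a martingale difference of level `n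
+ 1`, so the coefficient is that of `n + 1`: parity flips. The partial sums are constant from `n +
2` on. -/
theorem convInMeasure_indicator_rad {n : ℕ} {S : Set ℝ} (hS : MeasurableSet[dyadicSigma n] S)
    {x : S01} (hx : x =ᵐ[lebesgue01] S.indicator (rad n)) :
    ConvInMeasure (fun i => evenS i x) (evenCoeff (n + 1) • x) := by
  refine convInMeasure_of_eventually_eq (N := n + 2) fun i hi => AEEqFun.ext ?_
  have hSm : MeasurableSet S := dyadicSigma_le n _ hS
  have hf : StronglyMeasurable[dyadicSigma (n + 1)] (S.indicator (rad n)) :=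
    (stronglyMeasurable_rad n).indicator (dyadicSigma_mono (Nat.le_succ n) _ hS)
  filter_upwards [coeFn_evenS i x, evenSum_congr hx i, AEEqFun.coeFn_smul (evenCoeff (n + 1)) x, hx,
    evenSum_of_dyadicExp_eq_zero hf (integrable_indicator_rad n hSm)
      (dyadicExp_indicator_rad n hS) hi] with t h1 h2 h3 h4 h5
  rw [h1, h2, h3, h5, Pi.smul_apply, Pi.smul_apply, h4]

theorem convInMeasure_one {x : S01} (hx : x =ᵐ[lebesgue01] fun _ => (1 : ℝ)) :
    ConvInMeasure (fun i => evenS i x) x := by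
  refine convInMeasure_of_eventually_eq (N := 1) fun i hi => AEEqFun.ext ?_
  have hc : StronglyMeasurable[dyadicSigma 0] fun _ : ℝ => (1 : ℝ) := stronglyMeasurable_const
  have hci : Integrable (fun _ : ℝ => (1 : ℝ)) lebesgue01 := integrable_const 1
  filter_upwards [coeFn_evenS i x, evenSum_congr hx i, hx] with t h1 h2 h3
  rw [h1, h2, h3, evenSum_eq_of_stronglyMeasurable hc hci (show 0 < i by omega), evenSum_succ,
    evenSum_zero, dyadicDiff, dyadicExp_of_stronglyMeasurable le_rfl hc hci]
  simp [evenCoeff]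

/-- A Haar function is a Rademacher function on one dyadic interval. The two sides can differ only
at left endpoints of the halves, since the open intervals omit them. -/
theorem haarFun_ae_eq {n k : ℕ} : haarFun n k =ᵐ[lebesgue01]
    ((fun t : ℝ => ⌊(2 : ℝ) ^ n * t⌋) ⁻¹' {(k : ℤ) - 1}).indicator (rad n) := by
  classical
  have h2 : (0 : ℝ) < 2 ^ (n + 1) := by positivity
  have hne : ∀ a : ℝ, ∀ᵐ t ∂lebesgue01, t ≠ a := fun a =>
    ae_restrict_of_ae (Measure.ae_ne volume a)
  filter_upwards [hne ((2 * (k : ℝ) - 2) / 2 ^ (n + 1)), hne ((2 * (k : ℝ) - 1) / 2 ^ (n + 1))]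
    with t ha hb
  have hmem : t ∈ ((fun t : ℝ => ⌊(2 : ℝ) ^ n * t⌋) ⁻¹' {(k : ℤ) - 1}) ↔
      ⌊(2 : ℝ) ^ (n + 1) * t⌋ / 2 = (k : ℤ) - 1 := by
    rw [← floor_two_pow]; rfl
  have h1 : t ∈ Ioo ((2 * (k : ℝ) - 2) / 2 ^ (n + 1)) ((2 * (k : ℝ) - 1) / 2 ^ (n + 1)) ↔
      ⌊(2 : ℝ) ^ (n + 1) * t⌋ = 2 * (k : ℤ) - 2 := by
    rw [Int.floor_eq_iff, mem_Ioo, div_lt_iff₀ h2, lt_div_iff₀ h2]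
    push_cast
    rw [mul_comm t]
    constructor
    · rintro ⟨h3, h4⟩
      exact ⟨h3.le, by linarith⟩
    · rintro ⟨h3, h4⟩
      refine ⟨lt_of_le_of_ne h3 fun h => ha ?_, by linarith⟩
      rw [eq_div_iff h2.ne', h, mul_comm]
  have h1' : t ∈ Ioo ((2 * (k : ℝ) - 1) / 2 ^ (n + 1)) ((2 * (k : ℝ)) / 2 ^ (n + 1)) ↔
      ⌊(2 : ℝ) ^ (n + 1) * t⌋ = 2 * (k : ℤ) - 1 := by
    rw [Int.floor_eq_iff, mem_Ioo, div_lt_iff₀ h2, lt_div_iff₀ h2]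
    push_cast
    rw [mul_comm t]
    constructor
    · rintro ⟨h3, h4⟩
      exact ⟨h3.le, by linarith⟩
    · rintro ⟨h3, h4⟩
      refine ⟨lt_of_le_of_ne h3 fun h => hb ?_, by linarith⟩
      rw [eq_div_iff h2.ne', h, mul_comm]
  rw [haarFun, indicator_apply, indicator_apply, indicator_apply, rad]
  simp only [h1, h1', hmem, Pi.one_apply]
  generalize ⌊(2 : ℝ) ^ (n + 1) * t⌋ = m
  by_cases e1 : m = 2 * (k : ℤ) - 2
  · have e2 : ¬ m = 2 * (k : ℤ) - 1 := by omega
    have e3 : m / 2 = (k : ℤ) - 1 := by omega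
    have e4 : Even m := ⟨(k : ℤ) - 1, by omega⟩
    rw [if_pos e1, if_neg e2, if_pos e3, if_pos e4, sub_zero]
  · by_cases e2 : m = 2 * (k : ℤ) - 1
    · have e3 : m / 2 = (k : ℤ) - 1 := by omega
      have e4 : ¬ Even m := by rintro ⟨r, hr⟩; omega
      rw [if_neg e1, if_pos e2, if_pos e3, if_neg e4, zero_sub]
    · have e3 : ¬ m / 2 = (k : ℤ) - 1 := by omega
      rw [if_neg e1, if_neg e2, if_neg e3, sub_zero]

/-! ### Narrowness, and the operators from `E` to 𝒮_E. -/

namespace SymmQuasiBanach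

variable {E : SymmQuasiBanach}

/-- A bounded operator which annihilates the Rademacher functions of arbitrarily high levels on
dyadic sets is narrow. -/
theorem isNarrow_of_rad (hE0 : E.carrier ≠ ⊥) (hsep : E.IsSeparable) {X : SymmQuasiBanach}
    {V : E.carrier →ₗ[ℝ] X.carrier} (hV : IsBoundedOp V) {P : ℕ → Prop}
    (hP : ∀ N, ∃ n ≥ N, P n) (h0 : ∀ n, P n → ∀ S : Set ℝ, MeasurableSet[dyadicSigma n] S →
      ∀ x : E.carrier, (x : S01) =ᵐ[lebesgue01] S.indicator (rad n) → V x = 0) : IsNarrow V := by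
  classical
  refine ⟨hV, fun A hA _ ε hε => ?_⟩
  obtain ⟨C, hC⟩ := hV
  have hC1 : 0 < |C| + 1 := by positivity
  obtain ⟨δ, hδ0, hδ⟩ := exists_qnorm_lt_of_support hE0 hsep (show 0 < ε / (|C| + 1) by positivity)
  set a : ℝ → ℝ := A.indicator 1 with ha
  have ham : Measurable a := measurable_one.indicator hA
  have hai : Integrable a lebesgue01 := (integrable_const (1 : ℝ)).indicator hA
  obtain ⟨N, hN⟩ := eventually_atTop.1 ((tendsto_integral_abs_sub_dyadicExp ham hai).eventually_lt_const
    (show 0 < δ / 2 by positivity))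
  obtain ⟨n, hnN, hPn⟩ := hP N
  have hn := hN n hnN
  -- `A` and `B` differ only where 𝔼ₙ of the indicator of `A` is at least 1/2 away from it; by
  -- Markov's inequality and the choice of `N` this set has measure at most `δ`.
  set B : Set ℝ := {t | 1 / 2 < dyadicExp n a t} with hB
  have hBm : MeasurableSet[dyadicSigma n] B :=
    (stronglyMeasurable_dyadicExp le_rfl a).measurable measurableSet_Ioi
  have hBm' : MeasurableSet B := dyadicSigma_le n _ hBm
  have hmeas : ∀ S : Set ℝ, MeasurableSet S →
      AEStronglyMeasurable (S.indicator (rad n)) lebesgue01 := fun S hS =>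
    ((measurable_rad n).indicator hS).aestronglyMeasurable
  have hbd : ∀ (S : Set ℝ) (t : ℝ), |S.indicator (rad n) t| ≤ 1 := by
    intro S t
    rw [indicator_apply]
    split_ifs
    · exact (abs_rad n t).le
    · simp
  set xA : S01 := AEEqFun.mk _ (hmeas A hA) with hxA
  set xB : S01 := AEEqFun.mk _ (hmeas B hBm') with hxB
  have hxA' : xA =ᵐ[lebesgue01] A.indicator (rad n) := AEEqFun.coeFn_mk _ _
  have hxB' : xB =ᵐ[lebesgue01] B.indicator (rad n) := AEEqFun.coeFn_mk _ _
  have hxAE : xA ∈ E.carrier := mem_of_bounded hE0 (C := 1) (by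
    filter_upwards [hxA'] with t ht
    rw [ht]; exact hbd A t)
  have hxBE : xB ∈ E.carrier := mem_of_bounded hE0 (C := 1) (by
    filter_upwards [hxB'] with t ht
    rw [ht]; exact hbd B t)
  have hdiff : ∀ᵐ t ∂lebesgue01, (xA - xB : S01) t = A.indicator (rad n) t - B.indicator (rad n) t := by
    filter_upwards [hxA', hxB', AEEqFun.coeFn_sub xA xB] with t h1 h2 h3
    rw [h3, Pi.sub_apply, h1, h2]
  have hw : E.qnorm (xA - xB) < ε / (|C| + 1) := by
    refine hδ _ ?_ ?_
    · filter_upwards [hdiff] with t ht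
      rw [ht]
      by_cases h1 : t ∈ A <;> by_cases h2 : t ∈ B <;> simp [h1, h2, abs_rad]
    · have hmk := mul_meas_ge_le_integral_of_nonneg (μ := lebesgue01)
        (f := fun t => |a t - dyadicExp n a t|) (Eventually.of_forall fun t => abs_nonneg _)
        ((hai.sub (integrable_dyadicExp n a)).abs) (1 / 2)
      calc lebesgue01 {t | (xA - xB : S01) t ≠ 0}
          ≤ lebesgue01 {t | 1 / 2 ≤ |a t - dyadicExp n a t|} := by
            refine measure_mono_ae ?_
            filter_upwards [hdiff] with t ht hne
            have hne' : (xA - xB : S01) t ≠ 0 := hne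
            rw [ht] at hne'
            change 1 / 2 ≤ |a t - dyadicExp n a t|
            by_cases h1 : t ∈ A
            · have h2 : t ∉ B := fun h2 => hne' (by simp [h1, h2])
              have h3 : dyadicExp n a t ≤ 1 / 2 := not_lt.1 h2
              rw [ha, indicator_of_mem h1, ← ha]
              exact le_trans (by simp; linarith) (le_abs_self _)
            · have h2 : t ∈ B := by
                by_contra h2
                exact hne' (by simp [h1, h2])
              have h3 : 1 / 2 < dyadicExp n a t := h2
              rw [ha, indicator_of_notMem h1, ← ha, zero_sub, abs_neg]
              exact h3.le.trans (le_abs_self _)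
        _ = ENNReal.ofReal (lebesgue01.real {t | 1 / 2 ≤ |a t - dyadicExp n a t|}) :=
            (ofReal_measureReal (measure_ne_top _ _)).symm
        _ ≤ ENNReal.ofReal δ := ENNReal.ofReal_le_ofReal (by linarith)
  have hVB : V ⟨xB, hxBE⟩ = 0 := h0 n hPn B hBm _ hxB'
  -- `V` annihilates the sign on `B`, so only the small difference of the two signs contributes.
  have hsplit : (⟨xA, hxAE⟩ : E.carrier) = ⟨xB, hxBE⟩ + ⟨xA - xB, E.carrier.sub_mem hxAE hxBE⟩ := by
    ext1
    simp
  refine ⟨⟨xA, hxAE⟩, ?_, ?_⟩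
  · filter_upwards [hxA'] with t ht
    refine ⟨fun h1 => ?_, fun h1 => ?_⟩
    · rw [ht, indicator_of_mem h1, rad]
      split_ifs <;> simp
    · rw [ht, indicator_of_notMem h1]
  · rw [hsplit, map_add, hVB, zero_add]
    have hq := E.qnorm_nonneg _ (E.carrier.sub_mem hxAE hxBE)
    calc X.qnorm (V ⟨xA - xB, E.carrier.sub_mem hxAE hxBE⟩) ≤ C * E.qnorm (xA - xB) := hC _
      _ ≤ (|C| + 1) * E.qnorm (xA - xB) := by
          gcongr
          linarith [le_abs_self C]
      _ < (|C| + 1) * (ε / (|C| + 1)) := by gcongr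
      _ = ε := by field_simp

/-- The limit of the even transform of an element of `E`. -/
def evenLim (hE : E.SubsetL1) (x : E.carrier) : S01 :=
  (exists_convInMeasure_evenS (hE x x.2)).choose

theorem convInMeasure_evenLim (hE : E.SubsetL1) (x : E.carrier) :
    ConvInMeasure (fun n => evenS n x) (evenLim hE x) :=
  (exists_convInMeasure_evenS (hE x x.2)).choose_spec

theorem kerDominated_evenLim (hE : E.SubsetL1) (x : E.carrier) :
    KerDominated (evenLim hE x) ((2 : ℝ) • (9 : ℝ) • rearrS (x : S01)) :=
  KerDominated.of_convInMeasure (convInMeasure_evenLim hE x) fun n =>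
    kerDominated_evenS (hE x x.2) n

/-- The constant is 9 for the partial sums times 2 for the passage to the limit in measure. -/
theorem evenLim_bound (hE : E.SubsetL1) (x : E.carrier) :
    evenLim hE x ∈ calderonRange E ∧ calderonNorm E (evenLim hE x) ≤ 18 * E.qnorm x := by
  have h1 := rearrS_mem x.2
  have h2 := E.carrier.smul_mem (9 : ℝ) h1.1
  have h3 := E.carrier.smul_mem (2 : ℝ) h2
  refine ⟨(mem_calderonRange_iff hE).2 ⟨_, h3, kerDominated_evenLim hE x⟩,
    (calderonNorm_le hE h3 (kerDominated_evenLim hE x)).trans_eq ?_⟩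
  rw [E.qnorm_smul _ _ h2, E.qnorm_smul _ _ h1.1, h1.2, abs_of_pos two_pos,
    abs_of_pos (by norm_num : (0 : ℝ) < 9)]
  ring

/-- The even transform as an operator from `E` to `𝒮_E`. -/
def evenOp (hE : E.SubsetL1) : E.carrier →ₗ[ℝ] (calderonSpace E hE).carrier where
  toFun x := ⟨evenLim hE x, (evenLim_bound hE x).1⟩
  map_add' x y := Subtype.ext <| by
    refine (convInMeasure_evenLim hE (x + y)).unique ?_
    have h : (fun n => evenS n ((x + y : E.carrier) : S01))
        = fun n => evenS n (x : S01) + evenS n (y : S01) :=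
      funext fun n => evenS_add (hE x x.2) (hE y y.2) n
    rw [h]
    exact (convInMeasure_evenLim hE x).add (convInMeasure_evenLim hE y)
  map_smul' c x := Subtype.ext <| by
    refine (convInMeasure_evenLim hE (c • x)).unique ?_
    have h : (fun n => evenS n ((c • x : E.carrier) : S01)) = fun n => c • evenS n (x : S01) :=
      funext fun n => evenS_smul c x n
    rw [h]
    exact (convInMeasure_evenLim hE x).smul c

theorem incl_bound (hE : E.SubsetL1) (x : E.carrier) :
    (x : S01) ∈ calderonRange E ∧ calderonNorm E x ≤ E.qnorm x := by
  have h1 := rearrS_mem x.2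
  exact ⟨(mem_calderonRange_iff hE).2 ⟨_, h1.1, kerDominated_rearrS x⟩,
    (calderonNorm_le hE h1.1 (kerDominated_rearrS x)).trans_eq h1.2⟩

/-- The inclusion of `E` in `𝒮_E`. -/
def inclOp (hE : E.SubsetL1) : E.carrier →ₗ[ℝ] (calderonSpace E hE).carrier where
  toFun x := ⟨x, (incl_bound hE x).1⟩
  map_add' _ _ := rfl
  map_smul' _ _ := rfl

theorem isBoundedOp_evenOp (hE : E.SubsetL1) : IsBoundedOp (evenOp hE) :=
  ⟨18, fun x => (evenLim_bound hE x).2⟩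

theorem isBoundedOp_sub (hE : E.SubsetL1) : IsBoundedOp (inclOp hE - evenOp hE) := by
  obtain ⟨K, hK1, hK⟩ := (calderonSpace E hE).exists_const
  refine ⟨K * 19, fun x => ?_⟩
  have h1 := (incl_bound hE x).2
  have h2 := (evenLim_bound hE x).2
  have h3 : (((inclOp hE - evenOp hE) x : (calderonSpace E hE).carrier) : S01)
      = (inclOp hE x : S01) + -(evenOp hE x : S01) := by
    simp [sub_eq_add_neg]
  rw [h3]
  calc _ ≤ K * ((calderonSpace E hE).qnorm (inclOp hE x) +
        (calderonSpace E hE).qnorm (-(evenOp hE x : S01))) :=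
        hK _ (inclOp hE x).2 _ ((calderonSpace E hE).carrier.neg_mem (evenOp hE x).2)
    _ ≤ K * (E.qnorm x + 18 * E.qnorm x) := by
        rw [qnorm_neg (evenOp hE x).2]
        gcongr
        · exact h1
        · exact h2
    _ = _ := by ring

theorem evenOp_of_conv (hE : E.SubsetL1) {x : E.carrier} {y : S01}
    (h : ConvInMeasure (fun n => evenS n (x : S01)) y) : (evenOp hE x : S01) = y :=
  (convInMeasure_evenLim hE x).unique h

end SymmQuasiBanach

theorem evenCoeff_succ_of_odd {n : ℕ} (hn : Odd n) : evenCoeff (n + 1) = 1 := if_pos hn.add_one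

theorem evenCoeff_succ_of_even {n : ℕ} (hn : Even n) : evenCoeff (n + 1) = 0 :=
  if_neg (Nat.not_even_iff_odd.2 hn.add_one)

end

theorem mainTheorem5 (E : SymmQuasiBanach) (hE0 : E.carrier ≠ ⊥)
    (hEsep : E.IsSeparable) (hEL1 : E.SubsetL1) :
    -- the space `𝒮_E`
    ∃ X : SymmQuasiBanach,
      (X.carrier : Set S01) = calderonRange E ∧
      (∀ x ∈ X.carrier, X.qnorm x = calderonNorm E x) ∧
      -- the operators `T` and `id - T`
      ∃ T U : E.carrier →ₗ[ℝ] X.carrier,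
        (∀ x : E.carrier, IsEvenTransform (x : S01) (T x : S01)) ∧
        (∀ x : E.carrier, (x : S01) = (T x : S01) + (U x : S01)) ∧
        -- they are the projections associated with the Haar system
        (∀ x : E.carrier, (x : S01) =ᵐ[lebesgue01] (fun _ => (1 : ℝ)) →
          (T x : S01) = x ∧ (U x : S01) = 0) ∧
        (∀ n k : ℕ, 1 ≤ k → k ≤ 2 ^ n → ∀ x : E.carrier,
          (x : S01) =ᵐ[lebesgue01] haarFun n k →
            (Odd n → (T x : S01) = x ∧ (U x : S01) = 0) ∧
            (Even n → (T x : S01) = 0 ∧ (U x : S01) = x)) ∧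
        IsNarrow T ∧ IsNarrow U := by
  have hU : ∀ x : E.carrier,
      (((SymmQuasiBanach.inclOp hEL1 - SymmQuasiBanach.evenOp hEL1) x :
        (SymmQuasiBanach.calderonSpace E hEL1).carrier) : S01) = (x : S01) - (SymmQuasiBanach.evenOp hEL1 x : S01) := fun x => rfl
  refine ⟨SymmQuasiBanach.calderonSpace E hEL1, rfl, fun _ _ => rfl, SymmQuasiBanach.evenOp hEL1, SymmQuasiBanach.inclOp hEL1 - SymmQuasiBanach.evenOp hEL1,
    fun x => isEvenTransform_of_convInMeasure (SymmQuasiBanach.convInMeasure_evenLim hEL1 x), fun x => ?_,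
    fun x hx => ?_, fun n k _ _ x hx => ?_, ?_, ?_⟩
  · rw [hU, add_sub_cancel]
  · have h := SymmQuasiBanach.evenOp_of_conv hEL1 (convInMeasure_one hx)
    exact ⟨h, by rw [hU, h, sub_self]⟩
  · have h := SymmQuasiBanach.evenOp_of_conv hEL1 (convInMeasure_indicator_rad
      (show MeasurableSet[dyadicSigma n] _ from ⟨_, trivial, rfl⟩) (hx.trans haarFun_ae_eq))
    refine ⟨fun hn => ?_, fun hn => ?_⟩
    · rw [evenCoeff_succ_of_odd hn, one_smul] at h
      exact ⟨h, by rw [hU, h, sub_self]⟩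
    · rw [evenCoeff_succ_of_even hn, zero_smul] at h
      exact ⟨h, by rw [hU, h, sub_zero]⟩
  -- Rademacher functions of even level are differences of odd level, killed by `T`; those of odd
  -- level are fixed by `T` and killed by id − `T`.
  · refine SymmQuasiBanach.isNarrow_of_rad hE0 hEsep (SymmQuasiBanach.isBoundedOp_evenOp hEL1) (P := Even)
      (fun N => ⟨2 * N, by omega, even_two_mul N⟩) fun n hn S hS x hx => Subtype.ext ?_
    have h := SymmQuasiBanach.evenOp_of_conv hEL1 (convInMeasure_indicator_rad hS hx)
    rwa [evenCoeff_succ_of_even hn, zero_smul] at h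
  · refine SymmQuasiBanach.isNarrow_of_rad hE0 hEsep (SymmQuasiBanach.isBoundedOp_sub hEL1) (P := Odd)
      (fun N => ⟨2 * N + 1, by omega, odd_two_mul_add_one N⟩) fun n hn S hS x hx => Subtype.ext ?_
    have h := SymmQuasiBanach.evenOp_of_conv hEL1 (convInMeasure_indicator_rad hS hx)
    rw [evenCoeff_succ_of_odd hn, one_smul] at h
    rw [hU, h, sub_self]
    rfl
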